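/- Let $n\ge 0$ and $f=\sum_{j=1}^{n+2}\sigma_j x^{\alpha_j}\in\mathbb C[x_0,\dots,x_n]$ with $\sigma_j\in\mathbb C^*$, $\alpha_j\in\mathbb N^{n+1}$, such that the square matrix $\tilde M$, whose columns are the $\alpha_j$ below a first line $(1,\dots,1)$, has rank $n+2$. (The normalization $\sigma_1=\dots=\sigma_{n+1}=1$, $\sigma_{n+2}=\lambda\neq0$ is a special case.) *Algebras.* Let $\mathcal A=\mathbb C\langle a,b\rangle/(ab-ba=b^2)$ and let $\tilde{\mathcal A}=\varprojlim_\nu \mathcal A/b^\nu\mathcal A$ be its $b$-adic completion. An (a,b)-module is a left $\tilde{\mathcal A}$-module that is free of finite rank over $\mathbb C[[b]]\subset\tilde{\mathcal A}$. *The module $E_f$.* Let $E_f=\Omega^{n+1}/df\wedge d\Omega^{n-1}$ (polynomial forms on $\mathbb C^{n+1}$, $dx=dx_0\wedge\dots\wedge dx_n$), on which $\mathcal A$ acts, $a$ as multiplication by $f$ and $b$ as $df\wedge d^{-1}$ (for $n=0$, $d^{-1}$ is the primitive vanishing at $0$). Put $M_f=\big(E_f\otimes_{\mathbb C[b]}\mathbb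 C[[b]]\big)/b\text{-torsion}$, with $a$ extended by $a(x\otimes s)=ax\otimes s+x\otimes b^2 s'(b)$. An element of $\tilde{\mathcal A}$ acts on $x\in M_f$ by the $b$-adic limit, taken in finitely generated $a$-stable $\mathbb C[[b]]$-submodules containing $x$. *The element $P_d$.* Let $k\in\mathbb Z^{n+2}$ be the unique vector with $\sum_j k_j\alpha_j=0$, $\gcd(k_j)=1$ and $\sum_j k_j>0$; let $\delta_j=\max(-k_j,0)$ and $d=\sum_j\delta_j$. (So, with $\Delta_j=\max(k_j,0)$, the primitive relation between the monomials $m_j=\sigma_jx^{\alpha_j}$ of $f$ is $m^\Delta=\mathrm{const}\cdot m^\delta$.) Fix a monomial $\mu=x^\beta$. For $\gamma\in\mathbb N^{n+2}$ and $1\le j\le n+2$ put $$\eta_j=(\tilde M^{-1})_{j,0},\qquad \theta_j(\gamma)=\sum_{i=0}^{n}(\tilde M^{-1})_{j,i+1}\Big(\beta_i+\sum_k\alpha_{i,k}\gamma_k+1\Big)$$ (lines of $\tilde M$ numbered from $0$), so that $[m_jm^\gamma\mu\,dx]=(\eta_ja+\theta_j(\gamma)b)[m^\gamma\mu\,dx]$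 in $E_f$. Write $m^\delta=m_{j_d}\cdots m_{j_1}$ as a product of factors in any order, let $\gamma^{(s)}$ be the exponent of $m_{j_s}\cdots m_{j_1}$, and let $$P_d=P_d(\mu)=\Big(\prod_{s=1}^d\eta_{j_s}\Big)^{-1}\big(\eta_{j_d}a+\theta_{j_d}(\gamma^{(d-1)})b\big)\cdots\big(\eta_{j_1}a+\theta_{j_1}(\gamma^{(0)})b\big)\in\mathcal A ,$$ which is homogeneous of degree $d$ and monic in $a$. *Regularity and Bernstein element.* For an $a$-stable $\mathbb C[[b]]$-submodule $G\subset M_f$ of finite rank $q$ let $G^\sharp=\sum_{i\ge0}(b^{-1}a)^iG\subset M_f[b^{-1}]$. $G$ is regular if $G^\sharp$ is of finite type over $\mathbb C[[b]]$; its Bernstein polynomial $B$ is then the minimal polynomial of $-b^{-1}a$ acting on $G^\sharp/bG^\sharp$, and, if $\deg B=q$, its Bernstein element is the element $Q=(-b)^qB(-b^{-1}a)$ of $\mathcal A$, homogeneous of degree $q$ and monic in $a$. **Statement.** Let $W\subset M_f$ be the left $\tilde{\mathcal A}$-submodule generated by the class of $\mu\,dx$. Then $W$ is an (a,b)-module,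 and $W=W_0\oplus W_1$ with $a$-stable $\mathbb C[[b]]$-submodules $W_0,W_1$ such that $a$ is nilpotent on $W_0/bW_0$ and bijective on $W_1/bW_1$ ($W_0$ is the local part of $W$ at the origin). The module $W_0$ is regular, its Bernstein polynomial has degree equal to its rank, and $P_d$ is a left multiple of the Bernstein element $Q$ of $W_0$: there is $Z\in\mathcal A$ with $P_d=ZQ$. -/

import Mathlib

open scoped TensorProduct PowerSeries

noncomputable section

namespace BarletAB

/-! ### The algebra `𝒜 = ℂ⟨a, b⟩`, `ab - ba = b²`, and its `b`-adic completion -/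

/-- The defining relation `a b = b a + b²`; the generator `true` is `a`, `false` is `b`. -/
inductive ABRel : FreeAlgebra ℂ Bool → FreeAlgebra ℂ Bool → Prop
  | comm : ABRel (FreeAlgebra.ι ℂ true * FreeAlgebra.ι ℂ false)
      (FreeAlgebra.ι ℂ false * FreeAlgebra.ι ℂ true +
        FreeAlgebra.ι ℂ false * FreeAlgebra.ι ℂ false)

/-- The unital algebra `𝒜` generated by `a, b` with the single relation `ab - ba = b²`. -/
abbrev ABAlg : Type := RingQuot ABRel

/-- The generator `a` of `𝒜`. -/
def genA : ABAlg := RingQuot.mkAlgHom ℂ ABRel (FreeAlgebra.ι ℂ true)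

/-- The generator `b` of `𝒜`. -/
def genB : ABAlg := RingQuot.mkAlgHom ℂ ABRel (FreeAlgebra.ι ℂ false)

theorem genA_mul_genB : genA * genB = genB * genA + genB * genB := by
  have h := RingQuot.mkAlgHom_rel ℂ ABRel.comm
  simpa [genA, genB] using h

theorem genA_mul_genB_pow (m : ℕ) :
    genA * genB ^ m = genB ^ m * genA + (m : ABAlg) * genB ^ (m + 1) := by
  induction m with
  | zero => simp
  | succ m ih =>
    have hc : ∀ k : ℕ, (m : ABAlg) * genB ^ k = genB ^ k * m := fun k => Nat.cast_commute _ _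
    calc genA * genB ^ (m + 1) = (genA * genB ^ m) * genB := by rw [pow_succ, mul_assoc]
      _ = genB ^ m * (genA * genB) + (m : ABAlg) * genB ^ (m + 1) * genB := by
          rw [ih, add_mul, mul_assoc]
      _ = _ := by
          rw [genA_mul_genB]
          push_cast
          simp only [mul_add, add_mul, one_mul, pow_succ, mul_assoc]
          abel

/-- A pair of operators `x, y` on a complex vector space with `xy = yx + y²` defines an action
of `𝒜`, where `a` acts by `x` and `b` acts by `y`. -/
def actionOf {N : Type*} [AddCommGroup N] [Module ℂ N] (x y : Module.End ℂ N)
    (h : x * y = y * x + y * y) : ABAlg →ₐ[ℂ] Module.End ℂ N :=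
  RingQuot.liftAlgHom ℂ (s := ABRel)
    ⟨FreeAlgebra.lift ℂ (fun t : Bool => if t then x else y), by
      intro u v huv
      cases huv
      simpa using h⟩

/-- The ideal `b^ν 𝒜 = 𝒜 b^ν`. -/
def bIdeal (m : ℕ) : Ideal ABAlg := Ideal.span {genB ^ m}

theorem exists_pow_mul_eq (m : ℕ) (P : ABAlg) : ∃ P' : ABAlg, genB ^ m * P = P' * genB ^ m := by
  obtain ⟨p, rfl⟩ := RingQuot.mkAlgHom_surjective ℂ ABRel P
  induction p using FreeAlgebra.induction with
  | grade0 r =>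
    refine ⟨RingQuot.mkAlgHom ℂ ABRel (algebraMap ℂ _ r), ?_⟩
    rw [AlgHom.commutes]
    exact (Algebra.commutes _ _).symm
  | grade1 t =>
    cases t with
    | false => exact ⟨genB, by
        change genB ^ m * genB = genB * genB ^ m
        rw [← pow_succ, ← pow_succ']⟩
    | true =>
      refine ⟨genA - (m : ABAlg) * genB, ?_⟩
      change genB ^ m * genA = _
      rw [sub_mul, genA_mul_genB_pow, mul_assoc, ← pow_succ']
      abel
  | mul p q hp hq =>
    obtain ⟨p', hp⟩ := hp
    obtain ⟨q', hq⟩ := hq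
    refine ⟨p' * q', ?_⟩
    rw [map_mul, ← mul_assoc, hp, mul_assoc, hq, mul_assoc]
  | add p q hp hq =>
    obtain ⟨p', hp⟩ := hp
    obtain ⟨q', hq⟩ := hq
    exact ⟨p' + q', by rw [map_add, mul_add, hp, hq, add_mul]⟩

instance bIdeal_isTwoSided (m : ℕ) : (bIdeal m).IsTwoSided := by
  refine ⟨fun {x} P hx => ?_⟩
  obtain ⟨y, rfl⟩ := Ideal.mem_span_singleton'.1 hx
  obtain ⟨P', hP⟩ := exists_pow_mul_eq m P
  rw [mul_assoc, hP, ← mul_assoc]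
  exact Ideal.mem_span_singleton'.2 ⟨_, rfl⟩

theorem bIdeal_succ_le (m : ℕ) : bIdeal (m + 1) ≤ bIdeal m := by
  refine Ideal.span_le.2 ?_
  rintro _ rfl
  exact Ideal.mem_span_singleton'.2 ⟨genB, by rw [pow_succ']⟩

/-- The `b`-adic completion `𝒜̃` of `𝒜`, i.e. the inverse limit of the rings `𝒜 / b^ν 𝒜`. -/
def ATilde : Subring (∀ m : ℕ, ABAlg ⧸ bIdeal m) where
  carrier := {t | ∀ m, Ideal.Quotient.factor (bIdeal_succ_le m) (t (m + 1)) = t m}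
  mul_mem' hs ht m := by simp only [Pi.mul_apply, map_mul, hs m, ht m]
  one_mem' m := by simp only [Pi.one_apply, map_one]
  add_mem' hs ht m := by simp only [Pi.add_apply, map_add, hs m, ht m]
  zero_mem' m := by simp only [Pi.zero_apply, map_zero]
  neg_mem' hs m := by simp only [Pi.neg_apply, map_neg, hs m]

/-! ### The derivation `b² d/db` and operators `a` satisfying the Leibniz rule -/

/-- `b² d/db` on `ℂ[b]`. -/
def dPoly : Derivation ℂ (Polynomial ℂ) (Polynomial ℂ) :=
  (Polynomial.X ^ 2 : Polynomial ℂ) • Polynomial.derivative'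

/-- `b² d/db` on `ℂ[[b]]`. -/
def dPow : Derivation ℂ ℂ⟦X⟧ ℂ⟦X⟧ := (PowerSeries.X ^ 2 : ℂ⟦X⟧) • PowerSeries.derivative (R := ℂ)

/-- The field `ℂ((b))` of formal Laurent series, as the fraction field of `ℂ[[b]]`. -/
abbrev Laur : Type := FractionRing ℂ⟦X⟧

/-- The quotient rule for `b² d/db` on `ℂ((b))`. -/
def dLaurFun (x : Laur) : Laur :=
  (algebraMap ℂ⟦X⟧ Laur (dPow (IsLocalization.sec (nonZeroDivisors ℂ⟦X⟧) x).1) -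
    x * algebraMap ℂ⟦X⟧ Laur (dPow (IsLocalization.sec (nonZeroDivisors ℂ⟦X⟧) x).2)) /
    algebraMap ℂ⟦X⟧ Laur (IsLocalization.sec (nonZeroDivisors ℂ⟦X⟧) x).2

theorem dLaurFun_spec (x : Laur) (p q : ℂ⟦X⟧) (hq : q ≠ 0)
    (h : x * algebraMap ℂ⟦X⟧ Laur q = algebraMap ℂ⟦X⟧ Laur p) :
    dLaurFun x = (algebraMap ℂ⟦X⟧ Laur (dPow p) - x * algebraMap ℂ⟦X⟧ Laur (dPow q)) /
      algebraMap ℂ⟦X⟧ Laur q := by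
  have h0 := IsLocalization.sec_spec (nonZeroDivisors ℂ⟦X⟧) x
  have hne := nonZeroDivisors.ne_zero (IsLocalization.sec (nonZeroDivisors ℂ⟦X⟧) x).2.2
  unfold dLaurFun
  generalize (IsLocalization.sec (nonZeroDivisors ℂ⟦X⟧) x).1 = p0 at *
  generalize ((IsLocalization.sec (nonZeroDivisors ℂ⟦X⟧) x).2 : ℂ⟦X⟧) = q0 at *
  have hinj := IsFractionRing.injective ℂ⟦X⟧ Laur
  have e : p * q0 = p0 * q := by
    apply hinj
    rw [map_mul, map_mul, ← h, ← h0]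
    ring
  have e' := congrArg (fun t => algebraMap ℂ⟦X⟧ Laur (dPow t)) e
  simp only [Derivation.leibniz, smul_eq_mul, map_add, map_mul] at e'
  rw [← h, ← h0] at e'
  have hq' : algebraMap ℂ⟦X⟧ Laur q ≠ 0 := fun hh => hq (hinj (by rw [hh, map_zero]))
  have hq0' : algebraMap ℂ⟦X⟧ Laur q0 ≠ 0 := fun hh => hne (hinj (by rw [hh, map_zero]))
  rw [div_eq_div_iff hq0' hq']
  linear_combination -e'

theorem exists_laur_frac (x : Laur) : ∃ p q : ℂ⟦X⟧, q ≠ 0 ∧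
    x * algebraMap ℂ⟦X⟧ Laur q = algebraMap ℂ⟦X⟧ Laur p :=
  ⟨_, _, nonZeroDivisors.ne_zero (IsLocalization.sec (nonZeroDivisors ℂ⟦X⟧) x).2.2,
    IsLocalization.sec_spec (nonZeroDivisors ℂ⟦X⟧) x⟩

theorem algebraMap_laur_ne_zero {q : ℂ⟦X⟧} (hq : q ≠ 0) : algebraMap ℂ⟦X⟧ Laur q ≠ 0 := fun hh =>
  hq (IsFractionRing.injective ℂ⟦X⟧ Laur (by rw [hh, map_zero]))

theorem dLaurFun_coe (p : ℂ⟦X⟧) :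
    dLaurFun (algebraMap ℂ⟦X⟧ Laur p) = algebraMap ℂ⟦X⟧ Laur (dPow p) := by
  rw [dLaurFun_spec _ p 1 one_ne_zero (by simp)]
  simp

/-- `b² d/db` on `ℂ((b))`. -/
def dLaur : Derivation ℂ Laur Laur :=
  Derivation.mk'
    { toFun := dLaurFun
      map_add' := by
        intro x y
        obtain ⟨p, q, hq, h⟩ := exists_laur_frac x
        obtain ⟨p', q', hq', h'⟩ := exists_laur_frac y
        rw [dLaurFun_spec x p q hq h, dLaurFun_spec y p' q' hq' h',
          dLaurFun_spec (x + y) (p * q' + p' * q) (q * q') (mul_ne_zero hq hq')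
            (by simp only [map_add, map_mul, ← h, ← h']; ring)]
        have h1 := algebraMap_laur_ne_zero hq
        have h2 := algebraMap_laur_ne_zero hq'
        simp only [Derivation.leibniz, smul_eq_mul, map_add, map_mul, ← h, ← h']
        field_simp
        ring
      map_smul' := by
        intro c x
        obtain ⟨p, q, hq, h⟩ := exists_laur_frac x
        have hl : ∀ r : ℂ⟦X⟧, algebraMap ℂ⟦X⟧ Laur (c • r) = c • algebraMap ℂ⟦X⟧ Laur r :=
          fun r => map_smul (IsScalarTower.toAlgHom ℂ ℂ⟦X⟧ Laur) c r
        rw [dLaurFun_spec x p q hq h, dLaurFun_spec (c • x) (c • p) q hq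
          (by rw [smul_mul_assoc, h, hl]), Derivation.map_smul, hl, smul_mul_assoc, ← smul_sub,
          div_eq_mul_inv, div_eq_mul_inv, smul_mul_assoc]
        rfl }
    (by
      intro x y
      obtain ⟨p, q, hq, h⟩ := exists_laur_frac x
      obtain ⟨p', q', hq', h'⟩ := exists_laur_frac y
      change dLaurFun (x * y) = x • dLaurFun y + y • dLaurFun x
      rw [dLaurFun_spec x p q hq h, dLaurFun_spec y p' q' hq' h',
        dLaurFun_spec (x * y) (p * p') (q * q') (mul_ne_zero hq hq')
          (by simp only [map_mul, ← h, ← h']; ring)]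
      have h1 := algebraMap_laur_ne_zero hq
      have h2 := algebraMap_laur_ne_zero hq'
      simp only [Derivation.leibniz, smul_eq_mul, map_add, map_mul, ← h, ← h']
      field_simp
      ring)

theorem dLaur_coe (p : ℂ⟦X⟧) :
    dLaur (algebraMap ℂ⟦X⟧ Laur p) = algebraMap ℂ⟦X⟧ Laur (dPow p) := dLaurFun_coe p

theorem dPow_coe (p : Polynomial ℂ) :
    dPow (algebraMap (Polynomial ℂ) ℂ⟦X⟧ p) = algebraMap (Polynomial ℂ) ℂ⟦X⟧ (dPoly p) := by
  have h : ∀ q : Polynomial ℂ, algebraMap (Polynomial ℂ) ℂ⟦X⟧ q = (q : ℂ⟦X⟧) := fun _ => rfl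
  simp [dPow, dPoly, Derivation.smul_apply, h, PowerSeries.derivative_coe]

/-- A `ℂ`-linear operator `a` on an `R`-module `N` with `a (r x) = r (a x) + δ(r) x`. For `R` one of
`ℂ[b]`, `ℂ[[b]]`, `ℂ((b))` and `δ = b² d/db` this is the commutation rule `ab - ba = b²`, extended
to polynomials (respectively series) in `b`. -/
structure ConnOp {R : Type} [CommRing R] [Algebra ℂ R] (δ : Derivation ℂ R R)
    (N : Type*) [AddCommGroup N] [Module ℂ N] [Module R N] where
  op : Module.End ℂ N
  leibniz : ∀ (r : R) (x : N), op (r • x) = r • op x + δ r • x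

namespace ConnOp

section BaseChange

variable {R R' : Type} [CommRing R] [CommRing R'] [Algebra ℂ R] [Algebra ℂ R'] [Algebra R R']
  [IsScalarTower ℂ R R'] {δ : Derivation ℂ R R} {δ' : Derivation ℂ R' R'}
  {N : Type*} [AddCommGroup N] [Module ℂ N] [Module R N]

/-- Extension of scalars: `a (s ⊗ x) = s ⊗ a x + δ'(s) ⊗ x`. -/
def baseChange (hδ : ∀ r, δ' (algebraMap R R' r) = algebraMap R R' (δ r)) (c : ConnOp δ N) :
    ConnOp δ' (R' ⊗[R] N) where
  op :=
    { toFun := TensorProduct.liftAddHom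
        (AddMonoidHom.mk' (fun s : R' => AddMonoidHom.mk' (fun x : N => s ⊗ₜ[R] c.op x + δ' s ⊗ₜ[R] x)
            (by intro x y; simp only [map_add, TensorProduct.tmul_add]; abel))
          (by
            intro s t
            ext x
            simp only [AddMonoidHom.mk'_apply, AddMonoidHom.add_apply, map_add,
              TensorProduct.add_tmul]
            abel))
        (by
          intro r s x
          simp only [AddMonoidHom.mk'_apply, c.leibniz, TensorProduct.tmul_add]
          rw [Algebra.smul_def r s, Derivation.leibniz, hδ, smul_eq_mul, smul_eq_mul,
            TensorProduct.add_tmul, ← Algebra.smul_def, ← Algebra.smul_def, mul_comm s,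
            ← Algebra.smul_def, TensorProduct.smul_tmul, TensorProduct.smul_tmul,
            TensorProduct.smul_tmul]
          abel)
      map_add' := fun x y => map_add _ x y
      map_smul' := by
        intro z t
        induction t using TensorProduct.induction_on with
        | zero => simp only [smul_zero, map_zero]
        | tmul s x =>
          simp only [RingHom.id_apply, TensorProduct.smul_tmul', TensorProduct.liftAddHom_tmul,
            AddMonoidHom.mk'_apply, Derivation.map_smul, smul_add]
        | add x y hx hy => simp only [smul_add, map_add, hx, hy] }
  leibniz := by
    intro r t
    induction t using TensorProduct.induction_on with
    | zero => simp only [smul_zero, map_zero, add_zero]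
    | tmul s x =>
      simp only [LinearMap.coe_mk, AddHom.coe_mk, TensorProduct.smul_tmul',
        TensorProduct.liftAddHom_tmul, AddMonoidHom.mk'_apply, smul_eq_mul, smul_add,
        Derivation.leibniz, TensorProduct.add_tmul]
      rw [mul_comm s]
      abel
    | add x y hx hy =>
      simp only [smul_add, map_add, hx, hy]
      abel

end BaseChange

/-- The operator induced on the quotient by the `b`-torsion. -/
def modTorsion {T : Type} [AddCommGroup T] [Module ℂ T] [Module ℂ⟦X⟧ T] [IsScalarTower ℂ ℂ⟦X⟧ T]
    (c : ConnOp dPow T) :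
    ConnOp dPow (T ⧸ Submodule.torsion' ℂ⟦X⟧ T (Submonoid.powers (PowerSeries.X : ℂ⟦X⟧))) where
  op :=
    { toFun := QuotientAddGroup.map _ _ c.op.toAddMonoidHom (by
        rintro x ⟨s, hx⟩
        have hx' : (s : ℂ⟦X⟧) • x = 0 := hx
        refine ⟨s * s, ?_⟩
        change ((s : ℂ⟦X⟧) * (s : ℂ⟦X⟧)) • c.op x = 0
        have h := c.leibniz s x
        rw [hx', map_zero] at h
        rw [mul_smul, eq_neg_of_add_eq_zero_left h.symm, smul_neg, smul_comm, hx', smul_zero,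
          neg_zero])
      map_add' := fun x y => map_add _ x y
      map_smul' := by
        intro z t
        obtain ⟨t, rfl⟩ := Submodule.Quotient.mk_surjective _ t
        exact congrArg (Submodule.Quotient.mk) (c.op.map_smul z t) }
  leibniz := by
    intro r t
    obtain ⟨t, rfl⟩ := Submodule.Quotient.mk_surjective _ t
    exact congrArg (Submodule.Quotient.mk) (c.leibniz r t)

variable {M : Type} [AddCommGroup M] [Module ℂ M] [Module ℂ⟦X⟧ M] [IsScalarTower ℂ ℂ⟦X⟧ M]

/-- The action of `𝒜` on a `ℂ[[b]]`-module with an operator `a` as above. -/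
def action (c : ConnOp dPow M) : ABAlg →ₐ[ℂ] Module.End ℂ M :=
  actionOf c.op ((LinearMap.lsmul ℂ⟦X⟧ M PowerSeries.X).restrictScalars ℂ) (by
    ext x
    have h := c.leibniz PowerSeries.X x
    have hX : dPow PowerSeries.X = PowerSeries.X ^ 2 := by
      simp [dPow, Derivation.smul_apply]
    rw [hX, pow_two, mul_smul] at h
    exact h)

end ConnOp


/-! ### (a,b)-modules, local part at `0`, regularity, Bernstein element

Throughout, `M` is a `ℂ[[b]]`-module with an operator `a` such that `ab - ba = b²`. -/

namespace ConnOp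

variable {M : Type} [AddCommGroup M] [Module ℂ M] [Module ℂ⟦X⟧ M] [IsScalarTower ℂ ℂ⟦X⟧ M]

/-- `c.Acts t x y` : `y` is the result `t x` of letting `t ∈ 𝒜̃` act on `x`, as the `b`-adic limit of
the `P x`, `P ∈ 𝒜` approximating `t`. The limit is taken in a finitely generated
`ℂ[[b]]`-submodule `L ∋ x` stable by `a`, on which the `b`-adic topology is separated and complete
(the limit does not depend on `L`). -/
def Acts (c : ConnOp dPow M) (t : ATilde) (x y : M) : Prop :=
  ∃ L : Submodule ℂ⟦X⟧ M, L.FG ∧ (∀ z ∈ L, c.op z ∈ L) ∧ x ∈ L ∧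
    ∀ (m : ℕ) (P : ABAlg), Ideal.Quotient.mk (bIdeal m) P = t.1 m →
      ∃ z ∈ L, y - c.action P x = (PowerSeries.X : ℂ⟦X⟧) ^ m • z

/-- The left `𝒜̃`-submodule of `M` generated by `e`: the smallest submodule containing `e` and
stable by the action of `𝒜̃`. -/
def atildeSpan (c : ConnOp dPow M) (e : M) : Submodule ℂ⟦X⟧ M :=
  sInf {N | e ∈ N ∧ ∀ (t : ATilde) (x y : M), x ∈ N → c.Acts t x y → y ∈ N}

/-- The submodule `W` is an (a,b)-module: a left `𝒜̃`-module that is free of finite rank over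
`ℂ[[b]]`. -/
structure IsABModule (c : ConnOp dPow M) (W : Submodule ℂ⟦X⟧ M) : Prop where
  finite : Module.Finite ℂ⟦X⟧ W
  free : Module.Free ℂ⟦X⟧ W
  acts : ∀ (t : ATilde), ∀ x ∈ W, ∃ y ∈ W, c.Acts t x y ∧ ∀ y', c.Acts t x y' → y' = y

/-- `W = W₀ ⊕ W₁` with `W₀, W₁` stable by `a`, where `a` is nilpotent on `W₀ / b W₀` and bijective
on `W₁ / b W₁`. So `W₀` is the local part of `W` at `0`, i.e. the summand of the (a,b)-module `W`
that corresponds to the spectral subspace of `a` on `W / b W` for the eigenvalue `0`, and `W₁` is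
the sum of the summands for the non-zero eigenvalues. -/
structure IsLocalDecomposition (c : ConnOp dPow M) (W W₀ W₁ : Submodule ℂ⟦X⟧ M) : Prop where
  stable₀ : ∀ x ∈ W₀, c.op x ∈ W₀
  stable₁ : ∀ x ∈ W₁, c.op x ∈ W₁
  inf_eq : W₀ ⊓ W₁ = ⊥
  sup_eq : W₀ ⊔ W₁ = W
  nilpotent₀ : ∃ k : ℕ, ∀ x ∈ W₀, ∃ z ∈ W₀, (c.op ^ k) x = (PowerSeries.X : ℂ⟦X⟧) • z
  injective₁ : ∀ x ∈ W₁, (∃ z ∈ W₁, c.op x = (PowerSeries.X : ℂ⟦X⟧) • z) →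
    ∃ z ∈ W₁, x = (PowerSeries.X : ℂ⟦X⟧) • z
  surjective₁ : ∀ y ∈ W₁, ∃ x ∈ W₁, ∃ z ∈ W₁, y = c.op x + (PowerSeries.X : ℂ⟦X⟧) • z

/-- The operator `b⁻¹ a` on `M[b⁻¹] = ℂ((b)) ⊗ M`. -/
def theta (c : ConnOp dPow M) : Module.End ℂ (Laur ⊗[ℂ⟦X⟧] M) :=
  ((LinearMap.lsmul Laur (Laur ⊗[ℂ⟦X⟧] M)
    (algebraMap ℂ⟦X⟧ Laur PowerSeries.X)⁻¹).restrictScalars ℂ) ∘ₗ (c.baseChange dLaur_coe).op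

/-- The saturation `G^♯ = ∑ₖ (b⁻¹ a)ᵏ G ⊆ M[b⁻¹]` of `G` by `b⁻¹ a`. -/
def saturation (c : ConnOp dPow M) (G : Submodule ℂ⟦X⟧ M) : Submodule ℂ⟦X⟧ (Laur ⊗[ℂ⟦X⟧] M) :=
  Submodule.span ℂ⟦X⟧ {v | ∃ k : ℕ, ∃ x ∈ G, v = (c.theta ^ k) ((1 : Laur) ⊗ₜ[ℂ⟦X⟧] x)}

/-- `G` is regular: its saturation is of finite type over `ℂ[[b]]`; equivalently, `G` is contained
in a simple pole (a,b)-module. -/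
def IsRegular (c : ConnOp dPow M) (G : Submodule ℂ⟦X⟧ M) : Prop := (c.saturation G).FG

/-- `B` is the Bernstein polynomial of `G`, i.e. the minimal polynomial of the endomorphism induced
by `-b⁻¹ a` on `G^♯ / b G^♯`. -/
structure IsBernsteinPolynomial (c : ConnOp dPow M) (G : Submodule ℂ⟦X⟧ M) (B : Polynomial ℂ) :
    Prop where
  monic : B.Monic
  kills : ∀ x ∈ c.saturation G, ∃ y ∈ c.saturation G,
    Polynomial.aeval (-c.theta) B x = (PowerSeries.X : ℂ⟦X⟧) • y
  minimal : ∀ p : Polynomial ℂ, (∀ x ∈ c.saturation G, ∃ y ∈ c.saturation G,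
    Polynomial.aeval (-c.theta) p x = (PowerSeries.X : ℂ⟦X⟧) • y) → B ∣ p

end ConnOp

/-- The element `bⁱ (b⁻¹ a)ⁱ = (a - (i-1) b) ⋯ (a - b) a` of `𝒜`. -/
def fallingA : ℕ → ABAlg
  | 0 => 1
  | i + 1 => (genA - (i : ABAlg) * genB) * fallingA i

/-- The homogeneous element `(-b)^q B(-b⁻¹ a)` of `𝒜`, for a polynomial `B` of degree at most `q`. -/
def homogElt (q : ℕ) (B : Polynomial ℂ) : ABAlg :=
  B.sum fun i r => (r * (-1) ^ (q + i)) • (genB ^ (q - i) * fallingA i)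

theorem map_fallingA {S : Type*} [Ring S] [Algebra ℂ S] (φ : ABAlg →ₐ[ℂ] S) (u : S)
    (hu : φ genB * u = 1) (i : ℕ) :
    φ (fallingA i) = φ genB ^ i * (u * φ genA) ^ i := by
  induction i with
  | zero => simp [fallingA]
  | succ i ih =>
    have h := congrArg φ (genA_mul_genB_pow i)
    simp only [map_add, map_mul, map_pow, map_natCast] at h
    have h' : φ (genA - (i : ABAlg) * genB) * φ genB ^ i = φ genB ^ i * φ genA := by
      rw [map_sub, map_mul, map_natCast, sub_mul, h, mul_assoc, ← pow_succ', add_sub_cancel_right]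
    have h'' : φ genA = φ genB * (u * φ genA) := by rw [← mul_assoc, hu, one_mul]
    rw [fallingA, map_mul, ih, ← mul_assoc, h', pow_succ, pow_succ' (u * φ genA), mul_assoc,
      mul_assoc]
    congr 1
    rw [← mul_assoc (φ genB), ← h'']

/-- `homogElt q B` is indeed `(-b)^q B(-b⁻¹ a)` in every algebra in which `b` becomes invertible. -/
theorem map_homogElt {S : Type*} [Ring S] [Algebra ℂ S] (φ : ABAlg →ₐ[ℂ] S) (u : S)
    (hu : φ genB * u = 1) (q : ℕ) (B : Polynomial ℂ) (hB : B.natDegree ≤ q) :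
    φ (homogElt q B) = (-φ genB) ^ q * Polynomial.aeval (-(u * φ genA)) B := by
  rw [Polynomial.aeval_eq_sum_range, homogElt, Polynomial.sum_over_range _ (by simp), map_sum,
    Finset.mul_sum]
  refine Finset.sum_congr rfl fun i hi => ?_
  have hi' : i ≤ q := (Nat.lt_succ_iff.1 (Finset.mem_range.1 hi)).trans hB
  rw [map_smul, map_mul, map_pow, map_fallingA φ u hu, ← mul_assoc, ← pow_add,
    Nat.sub_add_cancel hi', neg_pow (φ genB), neg_pow (u * φ genA), mul_smul_comm, mul_smul,
    pow_add]
  congr 1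
  have hc : ∀ (k : ℕ) (s : S), ((-1 : ℂ) ^ k) • s = (-1 : S) ^ k * s := by
    intro k s
    rw [Algebra.smul_def, map_pow, map_neg, map_one]
  rw [mul_smul, hc, hc, mul_assoc]
  congr 1
  rw [← mul_assoc, ← mul_assoc, ((Commute.neg_one_left (φ genB ^ q)).pow_left i).eq]

/-- `Q ∈ 𝒜` is the Bernstein element of `G`: the homogeneous element `(-b)^q B(-b⁻¹ a)`, monic in
`a` of degree `q`, where `q` is the rank of `G` and `B` its Bernstein polynomial. -/
def ConnOp.IsBernsteinElement {M : Type} [AddCommGroup M] [Module ℂ M] [Module ℂ⟦X⟧ M]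
    [IsScalarTower ℂ ℂ⟦X⟧ M] (c : ConnOp dPow M) (G : Submodule ℂ⟦X⟧ M) (Q : ABAlg) : Prop :=
  ∃ B : Polynomial ℂ, c.IsBernsteinPolynomial G B ∧ B.natDegree = Module.finrank ℂ⟦X⟧ G ∧
    Q = homogElt (Module.finrank ℂ⟦X⟧ G) B

/-! ### Polynomials, partial primitives, and the module `E_f` -/

/-- Polynomials in `x₀, …, xₙ`. -/
abbrev Pol (n : ℕ) : Type := MvPolynomial (Fin (n + 1)) ℂ

section Primitive

variable {n : ℕ}

/-- The partial primitive `P ↦ ∫₀^{x_i} P dt` with respect to the variable `x_i`. -/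
def prim (i : Fin (n + 1)) : Pol n →ₗ[ℂ] Pol n :=
  (MvPolynomial.basisMonomials (Fin (n + 1)) ℂ).constr ℂ
    (fun s => MvPolynomial.monomial (s + Finsupp.single i 1) ((s i : ℂ) + 1)⁻¹)

/-- Substitution of `0` for the variable `x_i`. -/
def evalZero (i : Fin (n + 1)) : Pol n →ₐ[ℂ] Pol n :=
  MvPolynomial.aeval (fun k => if k = i then 0 else MvPolynomial.X k)

theorem prim_monomial (i : Fin (n + 1)) (s : Fin (n + 1) →₀ ℕ) (c : ℂ) :
    prim i (MvPolynomial.monomial s c) =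
      MvPolynomial.monomial (s + Finsupp.single i 1) (c * ((s i : ℂ) + 1)⁻¹) := by
  have h := (MvPolynomial.basisMonomials (Fin (n + 1)) ℂ).constr_basis ℂ
    (fun s => MvPolynomial.monomial (s + Finsupp.single i 1) ((s i : ℂ) + 1)⁻¹) s
  rw [MvPolynomial.coe_basisMonomials] at h
  have hm : MvPolynomial.monomial s c = c • MvPolynomial.monomial s (1 : ℂ) := by
    rw [MvPolynomial.smul_monomial, smul_eq_mul, mul_one]
  rw [hm, map_smul]
  unfold prim
  rw [h, MvPolynomial.smul_monomial, smul_eq_mul]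

theorem evalZero_monomial (i : Fin (n + 1)) (s : Fin (n + 1) →₀ ℕ) (c : ℂ) :
    evalZero i (MvPolynomial.monomial s c) = if s i = 0 then MvPolynomial.monomial s c else 0 := by
  unfold evalZero
  rw [MvPolynomial.aeval_monomial]
  split_ifs with h
  · rw [MvPolynomial.monomial_eq, MvPolynomial.algebraMap_eq]
    congr 1
    refine Finset.prod_congr rfl fun k hk => ?_
    have : k ≠ i := by
      rintro rfl
      exact (Finsupp.mem_support_iff.1 hk) h
    simp only [this, if_false]
  · have : (s.prod fun k e => (if k = i then (0 : Pol n) else MvPolynomial.X k) ^ e) = 0 :=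
      Finset.prod_eq_zero (Finsupp.mem_support_iff.2 h) (by simp [h])
    rw [this, mul_zero]

theorem pol_ext {u v : Pol n →ₗ[ℂ] Pol n}
    (h : ∀ s c, u (MvPolynomial.monomial s c) = v (MvPolynomial.monomial s c)) (P : Pol n) :
    u P = v P := by
  induction P using MvPolynomial.induction_on' with
  | monomial s c => exact h s c
  | add p q hp hq => rw [map_add, map_add, hp, hq]

theorem pderiv_prim (i : Fin (n + 1)) (P : Pol n) : MvPolynomial.pderiv i (prim i P) = P := by
  refine pol_ext (u := (MvPolynomial.pderiv i).toLinearMap ∘ₗ prim i) (v := LinearMap.id) ?_ P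
  intro s c
  have hne : (s i : ℂ) + 1 ≠ 0 := by exact_mod_cast Nat.succ_ne_zero (s i)
  simp only [LinearMap.comp_apply, prim_monomial, Derivation.coeFn_coe,
    MvPolynomial.pderiv_monomial, LinearMap.id_apply, add_tsub_cancel_right]
  congr 1
  simp [hne]

theorem prim_pderiv (i : Fin (n + 1)) (P : Pol n) :
    prim i (MvPolynomial.pderiv i P) = P - evalZero i P := by
  refine pol_ext (u := prim i ∘ₗ (MvPolynomial.pderiv i).toLinearMap)
    (v := LinearMap.id - (evalZero i).toLinearMap) ?_ P
  intro s c
  simp only [LinearMap.comp_apply, prim_monomial, Derivation.coeFn_coe,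
    MvPolynomial.pderiv_monomial, LinearMap.id_apply, LinearMap.sub_apply,
    AlgHom.toLinearMap_apply, evalZero_monomial]
  split_ifs with h
  · simp [h]
  · have h1 : s - Finsupp.single i 1 + Finsupp.single i 1 = s :=
      tsub_add_cancel_of_le (Finsupp.single_le_iff.2 (Nat.one_le_iff_ne_zero.2 h))
    have h2 : (((s - Finsupp.single i 1 : Fin (n + 1) →₀ ℕ) i : ℕ) : ℂ) + 1 = s i := by
      have : (s - Finsupp.single i 1 : Fin (n + 1) →₀ ℕ) i + 1 = s i := by
        simp only [Finsupp.coe_tsub, Pi.sub_apply, Finsupp.single_eq_same]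
        omega
      exact_mod_cast this
    have h3 : (s i : ℂ) ≠ 0 := by exact_mod_cast h
    rw [h1, h2, mul_assoc, mul_inv_cancel₀ h3, mul_one, sub_zero]

theorem pderiv_comm (i j : Fin (n + 1)) (P : Pol n) :
    MvPolynomial.pderiv i (MvPolynomial.pderiv j P) =
      MvPolynomial.pderiv j (MvPolynomial.pderiv i P) := by
  have h : ⁅(MvPolynomial.pderiv i : Derivation ℂ (Pol n) (Pol n)),
      (MvPolynomial.pderiv j : Derivation ℂ (Pol n) (Pol n))⁆ = 0 := by
    refine MvPolynomial.derivation_ext fun k => ?_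
    rw [Derivation.commutator_apply]
    simp [MvPolynomial.pderiv_X, Pi.single_apply, apply_ite]
  have h' := congrArg (fun D => D P) h
  simpa [Derivation.commutator_apply, sub_eq_zero] using h'

theorem pderiv_prim_comm {i j : Fin (n + 1)} (hij : j ≠ i) (P : Pol n) :
    MvPolynomial.pderiv j (prim i P) = prim i (MvPolynomial.pderiv j P) := by
  refine pol_ext (u := (MvPolynomial.pderiv j).toLinearMap ∘ₗ prim i)
    (v := prim i ∘ₗ (MvPolynomial.pderiv j).toLinearMap) ?_ P
  intro s c
  simp only [LinearMap.comp_apply, prim_monomial, Derivation.coeFn_coe,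
    MvPolynomial.pderiv_monomial]
  have h1 : (Finsupp.single i 1 : Fin (n + 1) →₀ ℕ) j = 0 := Finsupp.single_eq_of_ne hij
  have h2 : (Finsupp.single j 1 : Fin (n + 1) →₀ ℕ) i = 0 := Finsupp.single_eq_of_ne hij.symm
  have h3 : s + Finsupp.single i 1 - Finsupp.single j 1 =
      s - Finsupp.single j 1 + Finsupp.single i 1 := by
    ext k
    simp only [Finsupp.coe_tsub, Finsupp.coe_add, Pi.sub_apply, Pi.add_apply]
    by_cases hk : k = j
    · subst hk
      rw [h1]
      omega
    · rw [Finsupp.single_eq_of_ne hk]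
      omega
  rw [h3]
  congr 1
  simp only [Finsupp.coe_tsub, Finsupp.coe_add, Pi.sub_apply, Pi.add_apply, h1, h2, add_zero,
    tsub_zero]
  ring

theorem evalZero_prim (i : Fin (n + 1)) (P : Pol n) : evalZero i (prim i P) = 0 := by
  refine pol_ext (u := (evalZero i).toLinearMap ∘ₗ prim i) (v := 0) ?_ P
  intro s c
  simp [prim_monomial, evalZero_monomial]

theorem pderiv_evalZero (i : Fin (n + 1)) (P : Pol n) :
    MvPolynomial.pderiv i (evalZero i P) = 0 := by
  have h := pderiv_prim i (MvPolynomial.pderiv i P)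
  rw [prim_pderiv, map_sub] at h
  exact sub_eq_self.1 h

end Primitive

section GaussManin

variable {n : ℕ} (f : Pol n)

/-- The subspace `df ∧ dΩⁿ⁻¹` of `Ωⁿ⁺¹ = ℂ[x₀, …, xₙ] dx`, where a form `P dx` is identified with
its coefficient `P`. The space `Ωⁿ⁻¹` is spanned by the forms `g η`, where `g` is a polynomial and
`η` is the wedge product of all the `dx_k` except `dx_i` and `dx_j` (`i ≠ j`); up to sign
`df ∧ d(g η)` is `(∂_i f ∂_j g - ∂_j f ∂_i g) dx`. -/
def dfdOmega : Submodule ℂ (Pol n) :=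
  Submodule.span ℂ {P | ∃ (g : Pol n) (i j : Fin (n + 1)),
    P = MvPolynomial.pderiv i f * MvPolynomial.pderiv j g -
      MvPolynomial.pderiv j f * MvPolynomial.pderiv i g}

/-- `E_f = Ωⁿ⁺¹ / df ∧ dΩⁿ⁻¹`. -/
abbrev GM : Type := Pol n ⧸ dfdOmega f

/-- The operator `P ↦ ∂₀f · ∫₀^{x₀} P dt` on polynomials. -/
def bPol : Pol n →ₗ[ℂ] Pol n := LinearMap.mulLeft ℂ (MvPolynomial.pderiv 0 f) ∘ₗ prim 0

variable {f}

theorem jac_mem (g : Pol n) (i j : Fin (n + 1)) :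
    MvPolynomial.pderiv i f * MvPolynomial.pderiv j g -
      MvPolynomial.pderiv j f * MvPolynomial.pderiv i g ∈ dfdOmega f :=
  Submodule.subset_span ⟨g, i, j, rfl⟩

/-- `bPol` is `df ∧ d⁻¹` modulo `df ∧ dΩⁿ⁻¹` when `n ≥ 1`: the form `∂_i v dx` is, up to sign, the
differential of `v` times the product of the `dx_k`, `k ≠ i`, whose product with `df` is, with the
same sign, `∂_i f v dx`. -/
theorem bPol_pderiv (hn : n ≠ 0) (v : Pol n) (i : Fin (n + 1)) :
    bPol f (MvPolynomial.pderiv i v) - MvPolynomial.pderiv i f * v ∈ dfdOmega f := by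
  by_cases hi : i = 0
  · subst hi
    obtain ⟨m, rfl⟩ := Nat.exists_eq_succ_of_ne_zero hn
    have hj : (1 : Fin (m + 1 + 1)) ≠ 0 := by simp
    have h := jac_mem (f := f) (prim 1 (evalZero 0 v)) 1 0
    rw [pderiv_prim_comm hj.symm, pderiv_evalZero, pderiv_prim, map_zero, mul_zero, zero_sub] at h
    have e : bPol f (MvPolynomial.pderiv 0 v) - MvPolynomial.pderiv 0 f * v =
        -(MvPolynomial.pderiv 0 f * evalZero 0 v) := by
      simp only [bPol, LinearMap.comp_apply, LinearMap.mulLeft_apply, prim_pderiv]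
      ring
    rw [e]
    exact h
  · have h := jac_mem (f := f) (prim 0 v) 0 i
    rw [pderiv_prim, pderiv_prim_comm hi] at h
    exact h

theorem bPol_mem {P : Pol n} (hP : P ∈ dfdOmega f) : bPol f P ∈ dfdOmega f := by
  refine Submodule.span_induction ?_ ?_ ?_ ?_ hP
  · rintro _ ⟨g, i, j, rfl⟩
    by_cases hn : n = 0
    · subst hn
      have : i = j := Fin.ext (by omega)
      rw [this, sub_self, map_zero]
      exact Submodule.zero_mem _
    have e : MvPolynomial.pderiv i f * MvPolynomial.pderiv j g -
        MvPolynomial.pderiv j f * MvPolynomial.pderiv i g =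
        MvPolynomial.pderiv j (MvPolynomial.pderiv i f * g) -
          MvPolynomial.pderiv i (MvPolynomial.pderiv j f * g) := by
      rw [Derivation.leibniz, Derivation.leibniz]
      have hc : MvPolynomial.pderiv j (MvPolynomial.pderiv i f) =
          MvPolynomial.pderiv i (MvPolynomial.pderiv j f) := pderiv_comm j i f
      rw [hc]
      simp only [smul_eq_mul]
      ring
    rw [e, map_sub]
    have h := Submodule.sub_mem _ (bPol_pderiv (f := f) hn (MvPolynomial.pderiv i f * g) j)
      (bPol_pderiv (f := f) hn (MvPolynomial.pderiv j f * g) i)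
    convert h using 1
    ring
  · rw [map_zero]
    exact Submodule.zero_mem _
  · intro x y _ _ hx hy
    rw [map_add]
    exact Submodule.add_mem _ hx hy
  · intro c x _ hx
    rw [map_smul]
    exact Submodule.smul_mem _ c hx

theorem mul_mem_dfdOmega {P : Pol n} (hP : P ∈ dfdOmega f) : f * P ∈ dfdOmega f := by
  refine Submodule.span_induction ?_ ?_ ?_ ?_ hP
  · rintro _ ⟨g, i, j, rfl⟩
    have h := jac_mem (f := f) (f * g) i j
    convert h using 1
    simp only [Derivation.leibniz, smul_eq_mul]
    ring
  · rw [mul_zero]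
    exact Submodule.zero_mem _
  · intro x y _ _ hx hy
    rw [mul_add]
    exact Submodule.add_mem _ hx hy
  · intro c x _ hx
    rw [mul_smul_comm]
    exact Submodule.smul_mem _ c hx

theorem mul_bPol (P : Pol n) : f * bPol f P = bPol f (f * P) + bPol f (bPol f P) := by
  have h := prim_pderiv 0 (f * prim 0 P)
  rw [Derivation.leibniz, pderiv_prim, map_mul, evalZero_prim, mul_zero, sub_zero, map_add,
    smul_eq_mul, smul_eq_mul] at h
  simp only [bPol, LinearMap.comp_apply, LinearMap.mulLeft_apply]
  rw [mul_left_comm, ← h, mul_comm (prim 0 P)]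
  ring

variable (f)

/-- The action of `a` on `E_f`: multiplication by `f`. -/
def aGM : Module.End ℂ (GM f) :=
  (dfdOmega f).mapQ (dfdOmega f) (LinearMap.mulLeft ℂ f) fun _ hP => mul_mem_dfdOmega hP

/-- The action of `b = df ∧ d⁻¹` on `E_f`. The choice of the variable `x₀` in `bPol` is irrelevant by
`bPol_pderiv` for `n ≥ 1`; for `n = 0`, `d⁻¹` is the primitive vanishing at the origin. -/
def bGM : Module.End ℂ (GM f) :=
  (dfdOmega f).mapQ (dfdOmega f) (bPol f) fun _ hP => bPol_mem hP

theorem aGM_mul_bGM : aGM f * bGM f = bGM f * aGM f + bGM f * bGM f := by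
  ext P
  exact congrArg (dfdOmega f).mkQ (mul_bPol (f := f) _)

/-- `E_f` as a module over `ℂ[b]`. -/
abbrev GMb : Type := Module.AEval' (bGM f)

/-- The operator `a` on the `ℂ[b]`-module `E_f`. -/
def connGM : ConnOp dPoly (GMb f) where
  op := (Module.AEval'.of (bGM f)).toLinearMap ∘ₗ aGM f ∘ₗ (Module.AEval'.of (bGM f)).symm.toLinearMap
  leibniz := by
    have hX : ∀ y : GMb f, (Polynomial.X : Polynomial ℂ) • y =
        Module.AEval'.of (bGM f) (bGM f ((Module.AEval'.of (bGM f)).symm y)) := by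
      intro y
      obtain ⟨x, rfl⟩ := (Module.AEval'.of (bGM f)).surjective y
      rw [Module.AEval'.X_smul_of, LinearEquiv.symm_apply_apply]
    have hab : ∀ z, aGM f (bGM f z) = bGM f (aGM f z) + bGM f (bGM f z) := fun z =>
      LinearMap.congr_fun (aGM_mul_bGM f) z
    have hXo : ∀ y : GMb f,
        Module.AEval'.of (bGM f) (aGM f ((Module.AEval'.of (bGM f)).symm
          ((Polynomial.X : Polynomial ℂ) • y))) =
        (Polynomial.X : Polynomial ℂ) • Module.AEval'.of (bGM f) (aGM f
          ((Module.AEval'.of (bGM f)).symm y)) + (Polynomial.X : Polynomial ℂ) ^ 2 • y := by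
      intro y
      simp only [pow_two, mul_smul, hX, LinearEquiv.symm_apply_apply, hab, map_add]
    intro r y
    simp only [LinearMap.comp_apply, LinearEquiv.coe_coe]
    induction r using Polynomial.induction_on' generalizing y with
    | add p q hp hq =>
      rw [add_smul, map_add, map_add, map_add, hp, hq, map_add, add_smul, add_smul]
      abel
    | monomial k c =>
      induction k generalizing y with
      | zero =>
        have hC : ∀ z : GMb f, Polynomial.monomial 0 c • z = c • z := fun z => by
          rw [Polynomial.monomial_zero_left, ← Polynomial.algebraMap_eq, algebraMap_smul]
        have hd : dPoly (Polynomial.monomial 0 c) = 0 := by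
          simp [dPoly, Derivation.smul_apply]
        rw [hC, hC, hd, zero_smul, add_zero, map_smul, map_smul, map_smul]
      | succ k ih =>
        have hm : (Polynomial.monomial (k + 1) c : Polynomial ℂ) =
            Polynomial.monomial k c * Polynomial.X := (Polynomial.monomial_mul_X k c).symm
        have hd : dPoly Polynomial.X = Polynomial.X ^ 2 := by
          simp [dPoly, Derivation.smul_apply]
        rw [hm, mul_smul, ih, hXo, Derivation.leibniz, hd, smul_eq_mul, smul_eq_mul, add_smul,
          smul_add, mul_smul, mul_smul, mul_comm Polynomial.X, mul_smul]
        abel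

/-- `E_f ⊗_{ℂ[b]} ℂ[[b]]`. -/
abbrev GMhat : Type := ℂ⟦X⟧ ⊗[Polynomial ℂ] GMb f

/-- `E_f ⊗_{ℂ[b]} ℂ[[b]]` modulo its `b`-torsion. -/
abbrev GMfree : Type :=
  GMhat f ⧸ Submodule.torsion' ℂ⟦X⟧ (GMhat f) (Submonoid.powers (PowerSeries.X : ℂ⟦X⟧))

/-- The operator `a` on `E_f ⊗_{ℂ[b]} ℂ[[b]]` modulo its `b`-torsion. -/
def connGMfree : ConnOp dPow (GMfree f) := ((connGM f).baseChange dPow_coe).modTorsion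

/-- The class of `P dx` in `E_f ⊗_{ℂ[b]} ℂ[[b]]` modulo its `b`-torsion. -/
def cls (P : Pol n) : GMfree f :=
  Submodule.Quotient.mk (1 ⊗ₜ[Polynomial ℂ] Module.AEval'.of (bGM f) ((dfdOmega f).mkQ P))

/-- The left `𝒜̃`-module generated by the class of `P dx` in `E_f ⊗_{ℂ[b]} ℂ[[b]]` modulo its
`b`-torsion. -/
def cyclicModule (P : Pol n) : Submodule ℂ⟦X⟧ (GMfree f) := (connGMfree f).atildeSpan (cls f P)

end GaussManin


/-! ### Polynomials with `n + 2` monomials and the element `P_d` -/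

section Monomials

variable {n : ℕ}

/-- The polynomial `f = ∑ⱼ σⱼ x^{αⱼ}`. -/
def polyOf (α : Fin (n + 2) → (Fin (n + 1) →₀ ℕ)) (σ : Fin (n + 2) → ℂ) : Pol n :=
  ∑ j, MvPolynomial.monomial (α j) (σ j)

/-- The square matrix `M̃`: the matrix with columns `αⱼ`, below a first line `(1, …, 1)`. -/
def Mtilde (α : Fin (n + 2) → (Fin (n + 1) →₀ ℕ)) : Matrix (Fin (n + 2)) (Fin (n + 2)) ℚ :=
  Matrix.of fun i j => Fin.cons (α := fun _ => ℚ) 1 (fun i' => (α j i' : ℚ)) i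

/-- The coefficient `ηⱼ` of `a` in `m_j m^γ μ = (ηⱼ a + θⱼ b) (m^γ μ)`. -/
def etaCoeff (α : Fin (n + 2) → (Fin (n + 1) →₀ ℕ)) (j : Fin (n + 2)) : ℚ := (Mtilde α)⁻¹ j 0

/-- The coefficient `θⱼ` of `b` in `m_j m^γ μ = (ηⱼ a + θⱼ b) (m^γ μ)`, where `μ = x^β`. These
coefficients solve the linear system `a (m^γ μ) = ∑ⱼ m_j m^γ μ`,
`(Γᵢ + 1) b (m^γ μ) = ∑ⱼ α_{i,j} m_j m^γ μ` with `Γᵢ = βᵢ + ∑ₖ α_{i,k} γₖ`. -/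
def thetaCoeff (α : Fin (n + 2) → (Fin (n + 1) →₀ ℕ)) (β : Fin (n + 1) →₀ ℕ) (γ : Fin (n + 2) → ℕ)
    (j : Fin (n + 2)) : ℚ :=
  ∑ i : Fin (n + 1), (Mtilde α)⁻¹ j i.succ * ((β i + ∑ k, α k i * γ k + 1 : ℕ) : ℚ)

/-- The element `χ(m^γ) ∈ 𝒜` with `m^γ μ = χ(m^γ) μ`, where the monomial `m^γ` is given as a
list of factors `m_j`, multiplied successively from the right to the left. -/
def chi (α : Fin (n + 2) → (Fin (n + 1) →₀ ℕ)) (β : Fin (n + 1) →₀ ℕ) :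
    List (Fin (n + 2)) → ABAlg
  | [] => 1
  | j :: l => ((etaCoeff α j : ℂ) • genA + (thetaCoeff α β (fun k => l.count k) j : ℂ) • genB) *
      chi α β l

/-- `χ(m^γ)` divided by its coefficient of `a^{|γ|}`, so that it becomes monic in `a`. -/
def monicChi (α : Fin (n + 2) → (Fin (n + 1) →₀ ℕ)) (β : Fin (n + 1) →₀ ℕ)
    (l : List (Fin (n + 2))) : ABAlg :=
  ((((l.map (etaCoeff α)).prod)⁻¹ : ℚ) : ℂ) • chi α β l

end Monomials

end BarletAB

end

set_option linter.unusedSectionVars false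

noncomputable section

namespace BarletAB

open scoped Pointwise

/-! Put e = [μ dx], h = ∑ k_j > 0 and S = -b⁻¹a. The monomials m^Δ and m^δ are proportional, so [m^Δ
μ dx] = const·[m^δ μ dx]. Each factor m_j acts as η_j a + θ_j b, and η_j ≠ 0 whenever k_j ≠ 0. This
gives one relation P' e = κ P e with κ ≠ 0, where P = P_d and P' are homogeneous, monic in a, of
degrees d and d + h. Everything else follows from it in any b-torsion-free module
(`ConnOp.atildeSpan_structure`).

Modulo b the relation reads a^(d+h) e = κ a^d e. Hence W is spanned over ℂ[[b]] by e, …, a^(d+h-1)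
e, and T^d (T^h - κ) evaluated at a kills W/bW. The two factors are coprime. Bézout identities for
their powers give approximate projectors that converge b-adically and split W = W₀ ⊕ W₁
(`ConnOp.nilPart_sup`). The component e₀ of e in W₀ generates W₀ and satisfies the same relation.

In W₀[b⁻¹] the relation becomes (-b)^h p'(S) e₀ = κ p(S) e₀, with P = (-b)^d p(S). Consider the
lattice Λ spanned by f_k = b^max(k-d,0) S^k e₀ for k < d + h, and its sublattice F spanned by the
f_k with k < d. The operator a preserves Λ and is surjective on Λ/(F + bΛ). On W₀, which is
commensurable with Λ, it is topologically nilpotent. This forces Λ ⊂ F + bΛ, so Λ = F by Nakayama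
(`ConnOp.slopeLattice_le`). Hence F is stable by S and is the saturation of W₀, which proves
regularity.

Since h > 0, the relation also puts p(S) e₀ in b W₀^♯. The quotient W₀^♯/bW₀^♯ is a cyclic
ℂ[S]-module, so its minimal polynomial B has degree equal to its dimension, the rank of W₀, and B
divides p (`ConnOp.exists_bernstein`). Over ℂ the cofactor splits into linear factors, each of which
lifts to a left factor a + tb in 𝒜 (`homogElt_eq_mul_of_dvd`). -/

/-! ### Homogeneous elements of 𝒜 as polynomials in -b⁻¹a. -/

theorem homogElt_eq_sum (d : ℕ) (p : Polynomial ℂ) (hp : p.natDegree ≤ d) :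
    homogElt d p = ∑ i ∈ Finset.range (d + 1),
      (p.coeff i * (-1) ^ (d + i)) • (genB ^ (d - i) * fallingA i) :=
  Polynomial.sum_over_range' _ (by simp) _ (Nat.lt_succ_of_le hp)

theorem homogElt_add (d : ℕ) (p q : Polynomial ℂ) :
    homogElt d (p + q) = homogElt d p + homogElt d q :=
  Polynomial.sum_add_index _ _ _ (by simp) (by intros; rw [add_mul, add_smul])

theorem homogElt_monomial (d i : ℕ) (r : ℂ) :
    homogElt d (Polynomial.monomial i r) =
      (r * (-1) ^ (d + i)) • (genB ^ (d - i) * fallingA i) :=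
  Polynomial.sum_monomial_index _ _ (by simp)

/-- Since a bᵈ = bᵈ (a + d b), moving a + t b to the right past (-b)ᵈ turns it into a + (d + t) b =
-b (S - (d + t)) with S = -b⁻¹a. This is where the root d + t comes from. -/
theorem linear_mul_homogElt_monomial (t : ℂ) {d i : ℕ} (hi : i ≤ d) (r : ℂ) :
    (genA + t • genB) * homogElt d (Polynomial.monomial i r) =
      homogElt (d + 1) ((Polynomial.X - Polynomial.C (d + t)) * Polynomial.monomial i r) := by
  have e : (Polynomial.X - Polynomial.C (d + t)) * Polynomial.monomial i r =
      Polynomial.monomial (i + 1) r + Polynomial.monomial i (-((d + t) * r)) := by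
    rw [sub_mul, Polynomial.X_mul_monomial, Polynomial.C_mul_monomial, sub_eq_add_neg,
      ← Polynomial.monomial_neg]
  obtain ⟨k, rfl⟩ := Nat.exists_eq_add_of_le hi
  rw [e, homogElt_add, homogElt_monomial, homogElt_monomial, homogElt_monomial, mul_smul_comm]
  have h1 : i + k - i = k := by omega
  have h2 : i + k + 1 - (i + 1) = k := by omega
  have h3 : i + k + 1 - i = k + 1 := by omega
  have hc : ∀ (m : ℕ) (y : ABAlg), (m : ABAlg) * y = (m : ℂ) • y := fun m y => by
    rw [Algebra.smul_def, map_natCast]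
  rw [h1, h2, h3, fallingA, ← mul_assoc, add_mul, genA_mul_genB_pow, smul_mul_assoc, ← pow_succ',
    hc, hc]
  simp only [add_mul, sub_mul, mul_sub, mul_smul_comm, smul_mul_assoc, ← mul_assoc, ← pow_succ]
  simp only [Nat.cast_add]
  match_scalars <;> ring

theorem linear_mul_homogElt (t : ℂ) {d : ℕ} (p : Polynomial ℂ) (hp : p.natDegree ≤ d) :
    (genA + t • genB) * homogElt d p =
      homogElt (d + 1) ((Polynomial.X - Polynomial.C (d + t)) * p) := by
  let L : Polynomial ℂ →+ ABAlg := AddMonoidHom.mk' (homogElt d) (homogElt_add d)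
  let L' : Polynomial ℂ →+ ABAlg := AddMonoidHom.mk' (homogElt (d + 1)) (homogElt_add (d + 1))
  change _ * L p = L' _
  rw [p.as_sum_range' (d + 1) (Nat.lt_succ_of_le hp), map_sum, Finset.mul_sum, Finset.mul_sum,
    map_sum]
  exact Finset.sum_congr rfl fun i hi =>
    linear_mul_homogElt_monomial t (Nat.lt_succ_iff.1 (Finset.mem_range.1 hi)) _

theorem exists_mul_homogElt (s : Multiset ℂ) (q : ℕ) (B : Polynomial ℂ) (hB : B.natDegree ≤ q) :
    ∃ Z : ABAlg, homogElt (q + s.card) ((s.map fun r => Polynomial.X - Polynomial.C r).prod * B) =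
      Z * homogElt q B := by
  induction s using Multiset.induction with
  | empty => exact ⟨1, by simp⟩
  | cons r s ih =>
    obtain ⟨Z, hZ⟩ := ih
    -- The coefficient of b compensates the shift by the current degree q + |s|, so that the new
    -- root is exactly r.
    refine ⟨(genA + (r - ((q + s.card : ℕ) : ℂ)) • genB) * Z, ?_⟩
    rw [mul_assoc, ← hZ, linear_mul_homogElt]
    · rw [Multiset.map_cons, Multiset.prod_cons, Multiset.card_cons, ← mul_assoc, add_sub_cancel,
        add_assoc]
    · refine Polynomial.natDegree_mul_le.trans ?_
      rw [Polynomial.natDegree_multiset_prod_X_sub_C_eq_card]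
      omega

/-- Divisibility of polynomials implies right divisibility of the homogeneous elements. -/
theorem homogElt_eq_mul_of_dvd {p B : Polynomial ℂ} (hp : p.Monic) (hB : B.Monic) (h : B ∣ p) :
    ∃ Z : ABAlg, homogElt p.natDegree p = Z * homogElt B.natDegree B := by
  obtain ⟨r, rfl⟩ := h
  have hr : r.Monic := hB.of_mul_monic_left hp
  -- The cofactor is a product of linear factors, which can be peeled off one at a time on the left.
  have hs := IsAlgClosed.splits r
  have e := hs.eq_prod_roots_of_monic hr
  have hcard : r.natDegree = r.roots.card := hs.natDegree_eq_card_roots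
  obtain ⟨Z, hZ⟩ := exists_mul_homogElt r.roots B.natDegree B le_rfl
  refine ⟨Z, ?_⟩
  rw [← hZ, ← e, hB.natDegree_mul hr, hcard, mul_comm]

/-- Every product of `d` factors `η a + θ b` with `η ≠ 0` is, up to a constant, of the form
`(-b)^d p(-b⁻¹ a)` with `p` monic of degree `d`. -/
theorem exists_chi_eq_homogElt {n : ℕ} (α : Fin (n + 2) → (Fin (n + 1) →₀ ℕ))
    (β : Fin (n + 1) →₀ ℕ) (l : List (Fin (n + 2))) (hl : ∀ j ∈ l, etaCoeff α j ≠ 0) :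
    ∃ p : Polynomial ℂ, p.Monic ∧ p.natDegree = l.length ∧
      chi α β l = (((l.map (etaCoeff α)).prod : ℚ) : ℂ) • homogElt l.length p := by
  induction l with
  | nil =>
    refine ⟨1, Polynomial.monic_one, by simp, ?_⟩
    rw [← Polynomial.C_1, ← Polynomial.monomial_zero_left, homogElt_monomial]
    simp [chi, fallingA]
  | cons j l ih =>
    obtain ⟨p, hp, hd, h⟩ := ih fun i hi => hl i (List.mem_cons_of_mem _ hi)
    have hj : (etaCoeff α j : ℂ) ≠ 0 := by exact_mod_cast hl j List.mem_cons_self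
    set t : ℂ := (etaCoeff α j : ℂ)⁻¹ * (thetaCoeff α β (fun k => l.count k) j : ℂ) with ht
    refine ⟨(Polynomial.X - Polynomial.C (l.length + t)) * p,
      (Polynomial.monic_X_sub_C _).mul hp, ?_, ?_⟩
    · rw [(Polynomial.monic_X_sub_C _).natDegree_mul hp, Polynomial.natDegree_X_sub_C, hd,
        List.length_cons, add_comm]
    · have e : (etaCoeff α j : ℂ) • genA + (thetaCoeff α β (fun k => l.count k) j : ℂ) • genB =
          (etaCoeff α j : ℂ) • (genA + t • genB) := by
        rw [smul_add, smul_smul, ht, mul_inv_cancel_left₀ hj]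
      rw [chi, e, h, List.length_cons, ← linear_mul_homogElt t p hd.le, smul_mul_smul_comm,
        List.map_cons, List.prod_cons, Rat.cast_mul]

/-! ### The b-adic topology on finitely generated ℂ[[b]]-modules. -/

section FiniteModules

variable {M : Type*} [AddCommGroup M] [Module ℂ⟦X⟧ M]

theorem mem_X_pow_smul {m : ℕ} {W : Submodule ℂ⟦X⟧ M} {y : M} :
    y ∈ (PowerSeries.X : ℂ⟦X⟧) ^ m • W ↔ ∃ z ∈ W, y = (PowerSeries.X : ℂ⟦X⟧) ^ m • z := by
  rw [Submodule.mem_smul_pointwise_iff_exists]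
  exact exists_congr fun z => and_congr_right fun _ => eq_comm

theorem mem_of_mem_sup {A B C : Submodule ℂ⟦X⟧ M} (hA : A ≤ C) (hB : B ≤ C) {y : M}
    (h : y ∈ A ⊔ B) : y ∈ C := (sup_le hA hB : A ⊔ B ≤ C) h

theorem X_pow_smul_le (m : ℕ) (W : Submodule ℂ⟦X⟧ M) :
    (PowerSeries.X : ℂ⟦X⟧) ^ m • W ≤ W := by
  intro y hy
  obtain ⟨z, hz, rfl⟩ := mem_X_pow_smul.1 hy
  exact W.smul_mem _ hz

theorem X_pow_smul_anti {m k : ℕ} (h : m ≤ k) (W : Submodule ℂ⟦X⟧ M) :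
    (PowerSeries.X : ℂ⟦X⟧) ^ k • W ≤ (PowerSeries.X : ℂ⟦X⟧) ^ m • W := by
  obtain ⟨r, rfl⟩ := Nat.exists_eq_add_of_le h
  rw [pow_add, mul_smul]
  intro y hy
  obtain ⟨z, hz, rfl⟩ := Submodule.mem_smul_pointwise_iff_exists _ _ _ |>.1 hy
  exact Submodule.smul_mem_pointwise_smul _ _ _ (X_pow_smul_le r W hz)

theorem X_pow_smul_mono (m : ℕ) {W W' : Submodule ℂ⟦X⟧ M} (h : W ≤ W') :
    (PowerSeries.X : ℂ⟦X⟧) ^ m • W ≤ (PowerSeries.X : ℂ⟦X⟧) ^ m • W' := by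
  intro y hy
  obtain ⟨z, hz, rfl⟩ := mem_X_pow_smul.1 hy
  exact mem_X_pow_smul.2 ⟨z, h hz, rfl⟩

/-- Krull: submodules of a finitely generated `ℂ[[b]]`-module are `b`-adically closed. -/
theorem mem_of_forall_mem_sup {N W : Submodule ℂ⟦X⟧ M} (hW : W.FG) {y : M} (hy : y ∈ W)
    (h : ∀ m : ℕ, y ∈ N ⊔ (PowerSeries.X : ℂ⟦X⟧) ^ m • W) : y ∈ N := by
  have : Module.Finite ℂ⟦X⟧ W := Module.Finite.iff_fg.2 hW
  set N' := N.comap W.subtype with hN'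
  have hz : N'.mkQ ⟨y, hy⟩ = 0 := by
    -- Krull's intersection theorem in the finitely generated quotient W/(N ∩ W): the class of y
    -- lies in every power of the maximal ideal.
    refine IsHausdorff.haus (I := IsLocalRing.maximalIdeal ℂ⟦X⟧) inferInstance _ fun m => ?_
    rw [SModEq.zero, PowerSeries.maximalIdeal_eq_span_X, Ideal.span_singleton_pow]
    obtain ⟨u, hu, v, hv, huv⟩ := Submodule.mem_sup.1 (h m)
    obtain ⟨z, hz, rfl⟩ := mem_X_pow_smul.1 hv
    have huW : u ∈ W := by
      have : u = y - (PowerSeries.X : ℂ⟦X⟧) ^ m • z := by rw [← huv, add_sub_cancel_right]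
      rw [this]
      exact W.sub_mem hy (W.smul_mem _ hz)
    have e : N'.mkQ ⟨y, hy⟩ = (PowerSeries.X : ℂ⟦X⟧) ^ m • N'.mkQ ⟨z, hz⟩ := by
      rw [← map_smul, ← sub_eq_zero, ← map_sub]
      refine (Submodule.Quotient.mk_eq_zero N').2 ?_
      change y - (PowerSeries.X : ℂ⟦X⟧) ^ m • z ∈ N
      rw [← huv, add_sub_cancel_right]
      exact hu
    rw [e]
    exact Submodule.smul_mem_smul (Ideal.mem_span_singleton_self _) trivial
  exact (Submodule.Quotient.mk_eq_zero N').1 hz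

theorem eq_zero_of_forall_mem_X_pow_smul {W : Submodule ℂ⟦X⟧ M} (hW : W.FG) {y : M}
    (h : ∀ m : ℕ, y ∈ (PowerSeries.X : ℂ⟦X⟧) ^ m • W) : y = 0 := by
  refine (Submodule.mem_bot ℂ⟦X⟧).1 (mem_of_forall_mem_sup hW (X_pow_smul_le 0 W (h 0)) fun m => ?_)
  rw [bot_sup_eq]
  exact h m

/-- A sequence of power series can be summed against `b^m`. -/
theorem exists_series_sum (c : ℕ → ℂ⟦X⟧) : ∃ s : ℂ⟦X⟧, ∀ m : ℕ,
    (PowerSeries.X : ℂ⟦X⟧) ^ m ∣ s - ∑ i ∈ Finset.range m, PowerSeries.X ^ i * c i := by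
  -- Only the terms with i ≤ k contribute to the coefficient of b^k, so the infinite sum is defined
  -- coefficientwise.
  refine ⟨PowerSeries.mk fun k => ∑ i ∈ Finset.range (k + 1), PowerSeries.coeff (k - i) (c i),
    fun m => PowerSeries.X_pow_dvd_iff.2 fun k hk => ?_⟩
  rw [map_sub, map_sum, PowerSeries.coeff_mk, sub_eq_zero,
    ← Finset.sum_subset (Finset.range_subset_range.2 (Nat.succ_le_of_lt hk))]
  · refine Finset.sum_congr rfl fun i hi => ?_
    rw [PowerSeries.coeff_X_pow_mul', if_pos (Nat.lt_succ_iff.1 (Finset.mem_range.1 hi))]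
  · intro i _ hi
    rw [PowerSeries.coeff_X_pow_mul', if_neg]
    intro h
    exact hi (Finset.mem_range.2 (Nat.lt_succ_of_le h))

/-- Finitely generated `ℂ[[b]]`-modules are `b`-adically complete. -/
theorem exists_limit {W : Submodule ℂ⟦X⟧ M} (hW : W.FG) (x : ℕ → M) (hx : ∀ m, x m ∈ W)
    (h : ∀ m, x (m + 1) - x m ∈ (PowerSeries.X : ℂ⟦X⟧) ^ m • W) :
    ∃ y ∈ W, ∀ m, y - x m ∈ (PowerSeries.X : ℂ⟦X⟧) ^ m • W := by
  obtain ⟨N, g, rfl⟩ := Submodule.fg_iff_exists_fin_generating_family.1 hW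
  have hg : ∀ i, g i ∈ Submodule.span ℂ⟦X⟧ (Set.range g) := fun i =>
    Submodule.subset_span ⟨i, rfl⟩
  have h' : ∀ m, ∃ c : Fin N → ℂ⟦X⟧,
      x (m + 1) - x m = (PowerSeries.X : ℂ⟦X⟧) ^ m • ∑ i, c i • g i := by
    intro m
    obtain ⟨z, hz, hz'⟩ := mem_X_pow_smul.1 (h m)
    obtain ⟨c, rfl⟩ := (Submodule.mem_span_range_iff_exists_fun _).1 hz
    exact ⟨c, hz'⟩
  -- The limit is taken on coefficients: each increment is expanded on the generators, and the
  -- coefficients are summed as power series.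
  choose c hc using h'
  choose s hs using fun i => exists_series_sum fun m => c m i
  have hxm : ∀ m, x m = x 0 + ∑ i, (∑ j ∈ Finset.range m, PowerSeries.X ^ j * c j i) • g i := by
    intro m
    induction m with
    | zero => simp
    | succ m ih =>
      rw [← sub_add_cancel (x (m + 1)) (x m), hc, ih]
      simp only [Finset.sum_range_succ, add_smul, Finset.sum_add_distrib, Finset.smul_sum, mul_smul]
      abel
  refine ⟨x 0 + ∑ i, s i • g i, Submodule.add_mem _ (hx 0)
    (Submodule.sum_mem _ fun i _ => Submodule.smul_mem _ _ (hg i)), fun m => ?_⟩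
  rw [hxm m, add_sub_add_left_eq_sub, ← Finset.sum_sub_distrib]
  refine Submodule.sum_mem _ fun i _ => ?_
  rw [← sub_smul]
  obtain ⟨r, hr⟩ := hs i m
  rw [hr, mul_smul]
  exact mem_X_pow_smul.2 ⟨_, Submodule.smul_mem _ _ (hg i), rfl⟩

end FiniteModules

/-! ### The action of the completed algebra on a-stable submodules. -/

theorem dPow_X_pow (m : ℕ) : dPow ((PowerSeries.X : ℂ⟦X⟧) ^ m) =
    PowerSeries.X ^ m * ((m : ℂ⟦X⟧) * PowerSeries.X) := by
  have hX : dPow PowerSeries.X = PowerSeries.X ^ 2 := by simp [dPow, Derivation.smul_apply]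
  induction m with
  | zero => simp
  | succ m ih =>
    rw [pow_succ, Derivation.leibniz, ih, hX]
    push_cast
    simp only [smul_eq_mul]
    ring

/-- The derivation b² d/db raises the b-order by one. Hence a commutes with a power series up to an
error of higher order. -/
theorem X_pow_succ_dvd_dPow {m : ℕ} {r : ℂ⟦X⟧} (h : PowerSeries.X ^ m ∣ r) :
    PowerSeries.X ^ (m + 1) ∣ dPow r := by
  obtain ⟨s, rfl⟩ := h
  refine ⟨(m : ℂ⟦X⟧) * s + PowerSeries.X * PowerSeries.derivative (R := ℂ) s, ?_⟩
  rw [Derivation.leibniz, dPow_X_pow]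
  simp only [dPow, Derivation.smul_apply, smul_eq_mul]
  ring

namespace ConnOp

variable {M : Type} [AddCommGroup M] [Module ℂ M] [Module ℂ⟦X⟧ M] [IsScalarTower ℂ ℂ⟦X⟧ M]
  (c : ConnOp dPow M)

/-- A submodule stable by `a`. -/
def Stable (W : Submodule ℂ⟦X⟧ M) : Prop := ∀ z ∈ W, c.op z ∈ W

variable {c}

theorem Stable.X_pow_smul {W : Submodule ℂ⟦X⟧ M} (h : c.Stable W) (m : ℕ) :
    c.Stable ((PowerSeries.X : ℂ⟦X⟧) ^ m • W) := by
  intro y hy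
  obtain ⟨z, hz, rfl⟩ := mem_X_pow_smul.1 hy
  rw [c.leibniz, dPow_X_pow, mul_smul, ← smul_add]
  exact mem_X_pow_smul.2 ⟨_, W.add_mem (h z hz) (W.smul_mem _ hz), rfl⟩

theorem Stable.sup {W W' : Submodule ℂ⟦X⟧ M} (h : c.Stable W) (h' : c.Stable W') :
    c.Stable (W ⊔ W') := by
  intro y hy
  obtain ⟨u, hu, v, hv, rfl⟩ := Submodule.mem_sup.1 hy
  rw [map_add]
  exact Submodule.add_mem_sup (h u hu) (h' v hv)

theorem action_genA (x : M) : c.action genA x = c.op x := by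
  simp [action, actionOf, genA]

theorem action_genB (x : M) : c.action genB x = (PowerSeries.X : ℂ⟦X⟧) • x := by
  simp [action, actionOf, genB]

theorem action_genB_pow (m : ℕ) (x : M) :
    c.action (genB ^ m) x = (PowerSeries.X : ℂ⟦X⟧) ^ m • x := by
  induction m with
  | zero => simp
  | succ m ih => rw [pow_succ', map_mul, Module.End.mul_apply, ih, action_genB, smul_smul, pow_succ']

theorem Stable.action_mem {W : Submodule ℂ⟦X⟧ M} (h : c.Stable W) (P : ABAlg) {x : M}
    (hx : x ∈ W) : c.action P x ∈ W := by
  obtain ⟨p, rfl⟩ := RingQuot.mkAlgHom_surjective ℂ ABRel P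
  induction p using FreeAlgebra.induction generalizing x with
  | grade0 r =>
    rw [AlgHom.commutes, AlgHom.commutes]
    change r • x ∈ W
    rw [← algebraMap_smul ℂ⟦X⟧ r x]
    exact W.smul_mem _ hx
  | grade1 t =>
    cases t with
    | false =>
      change c.action genB x ∈ W
      rw [action_genB]
      exact W.smul_mem _ hx
    | true =>
      change c.action genA x ∈ W
      rw [action_genA]
      exact h x hx
  | mul p q hp hq =>
    rw [map_mul, map_mul]
    exact hp (hq hx)
  | add p q hp hq =>
    rw [map_add, map_add]
    exact W.add_mem (hp hx) (hq hx)

/-- An element of the ideal is P' bᵐ, with bᵐ acting first, and P' preserves bᵐ W. This is the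
continuity that makes b-adic limits of the action meaningful. -/
theorem Stable.action_mem_of_mem_bIdeal {W : Submodule ℂ⟦X⟧ M} (h : c.Stable W) {m : ℕ}
    {P : ABAlg} (hP : P ∈ bIdeal m) {x : M} (hx : x ∈ W) :
    c.action P x ∈ (PowerSeries.X : ℂ⟦X⟧) ^ m • W := by
  obtain ⟨P', rfl⟩ := Ideal.mem_span_singleton'.1 hP
  rw [map_mul, Module.End.mul_apply, action_genB_pow]
  exact (h.X_pow_smul m).action_mem P' (mem_X_pow_smul.2 ⟨x, hx, rfl⟩)

theorem acts_iff {t : ATilde} {x y : M} : c.Acts t x y ↔ ∃ W : Submodule ℂ⟦X⟧ M, W.FG ∧ c.Stable W ∧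
    x ∈ W ∧ ∀ (m : ℕ) (P : ABAlg), Ideal.Quotient.mk (bIdeal m) P = t.1 m →
      y - c.action P x ∈ (PowerSeries.X : ℂ⟦X⟧) ^ m • W := by
  simp only [mem_X_pow_smul]
  rfl

/-- The submodule L witnessing the limit may be unrelated to W. The approximants stay in W, so y
lies in W + bᵐ L for all m, and W is closed in W + L. -/
theorem Acts.mem {t : ATilde} {x y : M} (h : c.Acts t x y) {W : Submodule ℂ⟦X⟧ M} (hW : W.FG)
    (hs : c.Stable W) (hx : x ∈ W) : y ∈ W := by
  obtain ⟨L, hL, hsL, hxL, h⟩ := acts_iff.1 h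
  have key : ∀ m : ℕ, y ∈ W ⊔ (PowerSeries.X : ℂ⟦X⟧) ^ m • L := by
    intro m
    obtain ⟨P, hP⟩ := Ideal.Quotient.mk_surjective (t.1 m)
    rw [← add_sub_cancel (c.action P x) y]
    exact Submodule.add_mem_sup (hs.action_mem P hx) (h m P hP)
  refine mem_of_forall_mem_sup (hW.sup hL) ?_ fun m =>
    mem_of_mem_sup le_sup_left ((X_pow_smul_mono m le_sup_right).trans le_sup_right) (key m)
  exact mem_of_mem_sup le_sup_left ((X_pow_smul_le 0 L).trans le_sup_right) (key 0)

/-- Two limits computed in L and L' are compared in L + L', which is finitely generated and hence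
separated. -/
theorem Acts.unique {t : ATilde} {x y y' : M} (h : c.Acts t x y) (h' : c.Acts t x y') :
    y' = y := by
  obtain ⟨L, hL, hsL, hxL, h⟩ := acts_iff.1 h
  obtain ⟨L', hL', hsL', hxL', h'⟩ := acts_iff.1 h'
  rw [← sub_eq_zero]
  refine eq_zero_of_forall_mem_X_pow_smul (hL.sup hL') fun m => ?_
  obtain ⟨P, hP⟩ := Ideal.Quotient.mk_surjective (t.1 m)
  rw [← sub_sub_sub_cancel_right y' y (c.action P x)]
  exact Submodule.sub_mem _
    (X_pow_smul_mono m le_sup_right (h' m P hP))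
    (X_pow_smul_mono m le_sup_left (h m P hP))

/-- Lifts P_m of the components of t differ successively by elements of the ideal bᵐ𝒜, so the P_m x
form a Cauchy sequence. -/
theorem Stable.exists_acts {W : Submodule ℂ⟦X⟧ M} (hs : c.Stable W) (hW : W.FG) (t : ATilde) {x : M}
    (hx : x ∈ W) : ∃ y ∈ W, c.Acts t x y := by
  choose P hP using fun m => Ideal.Quotient.mk_surjective (t.1 m)
  obtain ⟨y, hy, h⟩ := exists_limit hW (fun m => c.action (P m) x)
    (fun m => hs.action_mem _ hx) (fun m => by
      have e := t.2 m
      rw [← hP, ← hP m, Ideal.Quotient.factor_mk, Ideal.Quotient.eq] at e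
      have h' := hs.action_mem_of_mem_bIdeal e hx
      rwa [map_sub] at h')
  refine ⟨y, hy, acts_iff.2 ⟨W, hW, hs, hx, fun m Q hQ => ?_⟩⟩
  rw [← hP m, Ideal.Quotient.eq] at hQ
  rw [← sub_sub_sub_cancel_right y _ (c.action (P m) x), ← LinearMap.sub_apply, ← map_sub]
  exact Submodule.sub_mem _ (h m) (hs.action_mem_of_mem_bIdeal hQ hx)

theorem Stable.acts_genA {W : Submodule ℂ⟦X⟧ M} (hs : c.Stable W) (hW : W.FG) {x : M}
    (hx : x ∈ W) : c.Acts ⟨fun m => Ideal.Quotient.mk (bIdeal m) genA, fun _ => rfl⟩ x (c.op x) := by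
  refine acts_iff.2 ⟨W, hW, hs, hx, fun m P hP => ?_⟩
  rw [← action_genA, ← LinearMap.sub_apply, ← map_sub]
  exact hs.action_mem_of_mem_bIdeal (Ideal.Quotient.eq.1 hP.symm) hx

/-- The `ℂ[[b]]`-module generated by the `aⁱ e`. -/
def krylov (c : ConnOp dPow M) (e : M) : Submodule ℂ⟦X⟧ M :=
  Submodule.span ℂ⟦X⟧ (Set.range fun i : ℕ => (c.op ^ i) e)

theorem stable_krylov (e : M) : c.Stable (c.krylov e) := by
  intro z hz
  induction hz using Submodule.span_induction with
  | mem x hx =>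
    obtain ⟨i, rfl⟩ := hx
    exact Submodule.subset_span ⟨i + 1, by simp only [pow_succ', Module.End.mul_apply]⟩
  | zero => rw [map_zero]; exact Submodule.zero_mem _
  | add x y _ _ hx hy => rw [map_add]; exact Submodule.add_mem _ hx hy
  | smul r x hx' hx =>
    rw [c.leibniz]
    exact Submodule.add_mem _ (Submodule.smul_mem _ _ hx) (Submodule.smul_mem _ _ hx')

theorem mem_krylov (e : M) : e ∈ c.krylov e := Submodule.subset_span ⟨0, by simp⟩

theorem krylov_le {e : M} {W : Submodule ℂ⟦X⟧ M} (hs : c.Stable W) (he : e ∈ W) :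
    c.krylov e ≤ W := by
  refine Submodule.span_le.2 ?_
  rintro _ ⟨i, rfl⟩
  simp only
  induction i with
  | zero => simpa using he
  | succ i ih =>
    rw [pow_succ']
    exact hs _ ih

/-- One inclusion holds because limits stay in a finitely generated stable module. For the other, N
is intersected with the Krylov module: the action of a as an element of 𝒜̃ is only known on points
of a finitely generated stable submodule. -/
theorem atildeSpan_eq_krylov {e : M} (hfg : (c.krylov e).FG) : c.atildeSpan e = c.krylov e := by
  refine le_antisymm (sInf_le ⟨mem_krylov e, fun t x y hx h => h.mem hfg (stable_krylov e) hx⟩)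
    (le_sInf ?_)
  rintro N ⟨he, hN⟩
  refine (krylov_le (W := N ⊓ c.krylov e) ?_ ⟨he, mem_krylov e⟩).trans inf_le_left
  rintro z ⟨hz, hz'⟩
  exact ⟨hN _ _ _ hz ((stable_krylov e).acts_genA hfg hz'), stable_krylov e _ hz'⟩

theorem Stable.isABModule {W : Submodule ℂ⟦X⟧ M} (hs : c.Stable W) (hW : W.FG)
    [Module.IsTorsionFree ℂ⟦X⟧ M] : c.IsABModule W := by
  have : Module.Finite ℂ⟦X⟧ W := Module.Finite.iff_fg.2 hW
  -- Freeness: a finitely generated torsion-free module over a principal ideal domain is free.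
  refine ⟨this, inferInstance, fun t x hx => ?_⟩
  obtain ⟨y, hy, h⟩ := hs.exists_acts hW t hx
  exact ⟨y, hy, h, fun y' h' => h.unique h'⟩

end ConnOp

/-! ### Splitting a stable module along a coprime factorization modulo b. -/

namespace ConnOp

variable {M : Type} [AddCommGroup M] [Module ℂ M] [Module ℂ⟦X⟧ M] [IsScalarTower ℂ ℂ⟦X⟧ M]
  {c : ConnOp dPow M}

theorem complex_smul_mem {W : Submodule ℂ⟦X⟧ M} (r : ℂ) {x : M} (hx : x ∈ W) : r • x ∈ W := by
  rw [← algebraMap_smul ℂ⟦X⟧ r x]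
  exact W.smul_mem _ hx

theorem Stable.pow_mem {W : Submodule ℂ⟦X⟧ M} (h : c.Stable W) (i : ℕ) {x : M} (hx : x ∈ W) :
    (c.op ^ i) x ∈ W := by
  induction i with
  | zero => simpa using hx
  | succ i ih => rw [pow_succ']; exact h _ ih

theorem Stable.aeval_mem {W : Submodule ℂ⟦X⟧ M} (h : c.Stable W) (g : Polynomial ℂ) {x : M}
    (hx : x ∈ W) : Polynomial.aeval c.op g x ∈ W := by
  rw [Polynomial.aeval_eq_sum_range, LinearMap.sum_apply]
  exact W.sum_mem fun i _ => complex_smul_mem _ (h.pow_mem i hx)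

theorem krylov_mono {x : M} {W : Submodule ℂ⟦X⟧ M} (hx : c.krylov x ≤ W) (i : ℕ) :
    c.krylov ((c.op ^ i) x) ≤ W :=
  (krylov_le (stable_krylov x) ((stable_krylov x).pow_mem i (mem_krylov x))).trans hx

/-- Commuting a polynomial in `a` with a power series divisible by `b^j` gives an error term
divisible by `b^(j+1)`. -/
theorem aeval_smul_sub_mem (g : Polynomial ℂ) {j : ℕ} {s : ℂ⟦X⟧} (hs : PowerSeries.X ^ j ∣ s)
    (x : M) : Polynomial.aeval c.op g (s • x) - s • Polynomial.aeval c.op g x ∈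
      (PowerSeries.X : ℂ⟦X⟧) ^ (j + 1) • c.krylov x := by
  induction g using Polynomial.induction_on with
  | C r =>
    rw [Polynomial.aeval_C]
    change r • s • x - s • r • x ∈ _
    rw [← algebraMap_smul ℂ⟦X⟧ r x, ← algebraMap_smul ℂ⟦X⟧ r (s • x), smul_comm, sub_self]
    exact Submodule.zero_mem _
  | add p q hp hq =>
    rw [map_add, LinearMap.add_apply, LinearMap.add_apply, smul_add, add_sub_add_comm]
    exact Submodule.add_mem _ hp hq
  | monomial n r ih =>
    have e : (Polynomial.C r * Polynomial.X ^ (n + 1) : Polynomial ℂ) =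
        Polynomial.X * (Polynomial.C r * Polynomial.X ^ n) := by ring
    rw [e, map_mul, Polynomial.aeval_X, Module.End.mul_apply, Module.End.mul_apply]
    set g := (Polynomial.C r * Polynomial.X ^ n : Polynomial ℂ)
    have h := c.leibniz s (Polynomial.aeval c.op g x)
    have e2 : c.op (Polynomial.aeval c.op g (s • x)) - s • c.op (Polynomial.aeval c.op g x) =
        c.op (Polynomial.aeval c.op g (s • x) - s • Polynomial.aeval c.op g x) +
          dPow s • Polynomial.aeval c.op g x := by
      rw [map_sub, h]; abel
    rw [e2]
    refine Submodule.add_mem _ ((stable_krylov x).X_pow_smul _ _ ih) ?_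
    obtain ⟨t, ht⟩ := X_pow_succ_dvd_dPow hs
    rw [ht, mul_smul]
    exact mem_X_pow_smul.2 ⟨_, Submodule.smul_mem _ _ ((stable_krylov x).aeval_mem g
      (mem_krylov x)), rfl⟩

/-- On a generator, g(a) aⁱ x = aⁱ g(a) x stays in bᵐ W, and moving g(a) past the coefficient costs
a term with one more power of b. This replaces the ℂ[[b]]-linearity that g(a) lacks. -/
theorem aeval_mem_of_mem_krylov {W : Submodule ℂ⟦X⟧ M} (hW : c.Stable W) {g : Polynomial ℂ} {m : ℕ}
    {x : M} (hx : Polynomial.aeval c.op g x ∈ (PowerSeries.X : ℂ⟦X⟧) ^ m • W) {j : ℕ} {z : M}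
    (hz : z ∈ c.krylov x) {r : ℂ⟦X⟧} (hr : PowerSeries.X ^ j ∣ r) :
    Polynomial.aeval c.op g (r • z) ∈ (PowerSeries.X : ℂ⟦X⟧) ^ (j + 1) • c.krylov x ⊔
      (PowerSeries.X : ℂ⟦X⟧) ^ m • W := by
  induction hz using Submodule.span_induction generalizing r with
  | mem z hz =>
    obtain ⟨i, rfl⟩ := hz
    simp only
    rw [← sub_add_cancel (Polynomial.aeval c.op g (r • (c.op ^ i) x))
      (r • Polynomial.aeval c.op g ((c.op ^ i) x))]
    refine Submodule.add_mem_sup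
      (X_pow_smul_mono _ (krylov_mono le_rfl i) (aeval_smul_sub_mem g hr _)) ?_
    have e : Polynomial.aeval c.op g ((c.op ^ i) x) =
        (c.op ^ i) (Polynomial.aeval c.op g x) := by
      rw [← Module.End.mul_apply, ← Module.End.mul_apply]
      congr 1
      have := Polynomial.aeval_X_pow (R := ℂ) (A := Module.End ℂ M) c.op (n := i)
      rw [← this, ← map_mul, ← map_mul, mul_comm]
    rw [e]
    exact Submodule.smul_mem _ _ ((hW.X_pow_smul m).pow_mem i hx)
  | zero => rw [smul_zero, map_zero]; exact Submodule.zero_mem _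
  | add u v _ _ hu hv => rw [smul_add, map_add]; exact Submodule.add_mem _ (hu hr) (hv hr)
  | smul s u _ hu => rw [smul_smul]; exact hu (hr.mul_right s)

theorem aeval_mem_X_pow_succ_smul {W : Submodule ℂ⟦X⟧ M} (hW : c.Stable W) {g : Polynomial ℂ}
    (hg : ∀ x ∈ W, Polynomial.aeval c.op g x ∈ (PowerSeries.X : ℂ⟦X⟧) ^ 1 • W) {j : ℕ} {y : M}
    (hy : y ∈ (PowerSeries.X : ℂ⟦X⟧) ^ j • W) :
    Polynomial.aeval c.op g y ∈ (PowerSeries.X : ℂ⟦X⟧) ^ (j + 1) • W := by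
  obtain ⟨z, hz, rfl⟩ := mem_X_pow_smul.1 hy
  rw [← sub_add_cancel (Polynomial.aeval c.op g ((PowerSeries.X : ℂ⟦X⟧) ^ j • z))
    ((PowerSeries.X : ℂ⟦X⟧) ^ j • Polynomial.aeval c.op g z)]
  refine Submodule.add_mem _
    (X_pow_smul_mono _ (krylov_le hW hz) (aeval_smul_sub_mem g dvd_rfl z)) ?_
  obtain ⟨w, hw, e⟩ := mem_X_pow_smul.1 (hg z hz)
  rw [e, smul_smul, ← pow_add]
  exact mem_X_pow_smul.2 ⟨w, hw, rfl⟩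

theorem aeval_pow_mem {W : Submodule ℂ⟦X⟧ M} (hW : c.Stable W) {g : Polynomial ℂ}
    (hg : ∀ x ∈ W, Polynomial.aeval c.op g x ∈ (PowerSeries.X : ℂ⟦X⟧) ^ 1 • W) (m : ℕ) {x : M}
    (hx : x ∈ W) : Polynomial.aeval c.op (g ^ m) x ∈ (PowerSeries.X : ℂ⟦X⟧) ^ m • W := by
  induction m with
  | zero => simpa using hx
  | succ m ih =>
    rw [pow_succ' g, map_mul]
    exact aeval_mem_X_pow_succ_smul hW hg ih

/-- Each application of g(a) raises by one the b-order of the part in the Krylov module, modulo bᵐ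
W. After m applications everything is in bᵐ W. -/
theorem aeval_pow_mem_of_mem_krylov {W : Submodule ℂ⟦X⟧ M} (hW : c.Stable W) {g : Polynomial ℂ}
    {m : ℕ} {x : M} (hx : x ∈ W)
    (hg : Polynomial.aeval c.op g x ∈ (PowerSeries.X : ℂ⟦X⟧) ^ m • W) {z : M}
    (hz : z ∈ c.krylov x) :
    Polynomial.aeval c.op (g ^ m) z ∈ (PowerSeries.X : ℂ⟦X⟧) ^ m • W := by
  have key : ∀ j : ℕ, Polynomial.aeval c.op (g ^ j) z ∈
      (PowerSeries.X : ℂ⟦X⟧) ^ j • c.krylov x ⊔ (PowerSeries.X : ℂ⟦X⟧) ^ m • W := by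
    intro j
    induction j with
    | zero => exact Submodule.mem_sup_left (by simpa using hz)
    | succ j ih =>
      obtain ⟨u, hu, v, hv, huv⟩ := Submodule.mem_sup.1 ih
      obtain ⟨w, hw, rfl⟩ := mem_X_pow_smul.1 hu
      rw [pow_succ' g, map_mul, Module.End.mul_apply, ← huv, map_add]
      exact Submodule.add_mem _ (aeval_mem_of_mem_krylov hW hg hw dvd_rfl)
        (Submodule.mem_sup_right ((hW.X_pow_smul m).aeval_mem g hv))
  exact mem_of_mem_sup (X_pow_smul_mono m (krylov_le hW hx)) le_rfl (key m)

/-- The part of `W` on which `g(a)` is topologically nilpotent. -/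
def nilPart (W : Submodule ℂ⟦X⟧ M) (hW : c.Stable W) (g : Polynomial ℂ) : Submodule ℂ⟦X⟧ M where
  carrier := {x | x ∈ W ∧ ∀ m : ℕ, ∃ k : ℕ,
    Polynomial.aeval c.op (g ^ k) x ∈ (PowerSeries.X : ℂ⟦X⟧) ^ m • W}
  zero_mem' := ⟨W.zero_mem, fun m => ⟨0, by rw [map_zero]; exact Submodule.zero_mem _⟩⟩
  add_mem' := by
    rintro x y ⟨hx, hx'⟩ ⟨hy, hy'⟩
    refine ⟨W.add_mem hx hy, fun m => ?_⟩
    obtain ⟨k, hk⟩ := hx' m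
    obtain ⟨l, hl⟩ := hy' m
    refine ⟨k + l, ?_⟩
    rw [map_add]
    refine Submodule.add_mem _ ?_ ?_
    · rw [add_comm, pow_add, map_mul]
      exact (hW.X_pow_smul m).aeval_mem _ hk
    · rw [pow_add, map_mul]
      exact (hW.X_pow_smul m).aeval_mem _ hl
  smul_mem' := by
    rintro s x ⟨hx, hx'⟩
    refine ⟨W.smul_mem s hx, fun m => ?_⟩
    obtain ⟨k, hk⟩ := hx' m
    -- The power g^k already sends x into bᵐ W. Iterating it m times does the same for every element
    -- of the ℂ[[b]]-module generated by the aⁱ x.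
    refine ⟨k * m, ?_⟩
    rw [pow_mul]
    exact aeval_pow_mem_of_mem_krylov hW hx hk (Submodule.smul_mem _ s (mem_krylov x))

section Decomposition

variable {W : Submodule ℂ⟦X⟧ M} {hW : c.Stable W} {g g₁ g₂ : Polynomial ℂ}

theorem nilPart_le : nilPart W hW g ≤ W := fun _ hx => hx.1

theorem stable_nilPart : c.Stable (nilPart W hW g) := by
  rintro x ⟨hx, hx'⟩
  refine ⟨hW x hx, fun m => ?_⟩
  obtain ⟨k, hk⟩ := hx' m
  refine ⟨k, ?_⟩
  have e : Polynomial.aeval c.op (g ^ k) (c.op x) = c.op (Polynomial.aeval c.op (g ^ k) x) := by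
    have h : Polynomial.aeval c.op (g ^ k * Polynomial.X) =
        Polynomial.aeval c.op (Polynomial.X * g ^ k) := by rw [mul_comm]
    rw [map_mul, map_mul, Polynomial.aeval_X] at h
    exact LinearMap.congr_fun h x
  rw [e]
  exact hW.X_pow_smul m _ hk

theorem aeval_combination (u v : Polynomial ℂ) {p q r : Polynomial ℂ} (h : u * p + v * q = r)
    {N : Submodule ℂ⟦X⟧ M} (hN : c.Stable N) {x : M} (hp : Polynomial.aeval c.op p x ∈ N)
    (hq : Polynomial.aeval c.op q x ∈ N) : Polynomial.aeval c.op r x ∈ N := by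
  rw [← h, map_add, map_mul, map_mul]
  exact N.add_mem (hN.aeval_mem u hp) (hN.aeval_mem v hq)

/-- A Bézout identity between g₁^k and g₂^l writes x as a sum of two elements of bᵐ W, for every m.
-/
theorem nilPart_inf (hfg : W.FG) (hg : IsCoprime g₁ g₂) :
    nilPart W hW g₁ ⊓ nilPart W hW g₂ = ⊥ := by
  refine (Submodule.eq_bot_iff _).2 ?_
  rintro x ⟨⟨_, h₁⟩, ⟨_, h₂⟩⟩
  refine eq_zero_of_forall_mem_X_pow_smul hfg fun m => ?_
  obtain ⟨k, hk⟩ := h₁ m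
  obtain ⟨l, hl⟩ := h₂ m
  obtain ⟨u, v, huv⟩ := hg.pow (m := k) (n := l)
  simpa using aeval_combination u v huv (hW.X_pow_smul m) hk hl

/-- If u_m g₁ᵐ + v_m g₂ᵐ = 1, then v_m g₂ᵐ is an approximate projector onto the g₁-part. Consecutive
ones differ by a multiple of (g₁g₂)ᵐ, which maps W into bᵐ W, so their values at x converge. The
limit y is the component of x. -/
theorem nilPart_sup (hfg : W.FG) (hg : IsCoprime g₁ g₂)
    (h : ∀ x ∈ W, Polynomial.aeval c.op (g₁ * g₂) x ∈ (PowerSeries.X : ℂ⟦X⟧) ^ 1 • W) :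
    nilPart W hW g₁ ⊔ nilPart W hW g₂ = W := by
  refine le_antisymm (sup_le nilPart_le nilPart_le) fun x hx => ?_
  choose u v huv using fun m : ℕ => hg.pow (m := m) (n := m)
  have hdvd : ∀ m, (g₁ * g₂) ^ m ∣ v (m + 1) * g₂ ^ (m + 1) - v m * g₂ ^ m := by
    intro m
    rw [mul_pow]
    refine (hg.pow (m := m) (n := m)).mul_dvd ?_ ?_
    · refine ⟨u m - u (m + 1) * g₁, ?_⟩
      linear_combination huv (m + 1) - huv m
    · refine ⟨v (m + 1) * g₂ - v m, ?_⟩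
      ring
  obtain ⟨y, hy, hlim⟩ := exists_limit hfg
    (fun m => Polynomial.aeval c.op (v m * g₂ ^ m) x) (fun m => hW.aeval_mem _ hx) (fun m => by
      obtain ⟨w, hw⟩ := hdvd m
      rw [← LinearMap.sub_apply, ← map_sub, hw, mul_comm, map_mul]
      exact (hW.X_pow_smul m).aeval_mem w (aeval_pow_mem hW h m hx))
  -- Modulo bᵐ W the limit y may be replaced by its m-th approximation. With p = g₁ᵐ the product p
  -- v_m g₂ᵐ is a multiple of (g₁g₂)ᵐ.
  have key : ∀ (m : ℕ) (p : Polynomial ℂ), Polynomial.aeval c.op (p * (v m * g₂ ^ m)) x ∈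
      (PowerSeries.X : ℂ⟦X⟧) ^ m • W →
      Polynomial.aeval c.op p y ∈ (PowerSeries.X : ℂ⟦X⟧) ^ m • W := by
    intro m p hp
    rw [map_mul, Module.End.mul_apply] at hp
    rw [← sub_add_cancel y (Polynomial.aeval c.op (v m * g₂ ^ m) x), map_add]
    exact Submodule.add_mem _ ((hW.X_pow_smul m).aeval_mem p (hlim m)) hp
  have hA : ∀ (m : ℕ) (q : Polynomial ℂ), Polynomial.aeval c.op (q * (g₁ * g₂) ^ m) x ∈
      (PowerSeries.X : ℂ⟦X⟧) ^ m • W := by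
    intro m q
    rw [map_mul]
    exact (hW.X_pow_smul m).aeval_mem q (aeval_pow_mem hW h m hx)
  refine Submodule.mem_sup.2 ⟨y, ⟨hy, fun m => ⟨m, key m _ ?_⟩⟩, x - y,
    ⟨W.sub_mem hx hy, fun m => ⟨m, ?_⟩⟩, add_sub_cancel y x⟩
  · convert hA m (v m) using 3
    ring
  -- The complement x - y is approximated by u_m g₁ᵐ x, which g₂ᵐ sends into bᵐ W.
  · have h1 : Polynomial.aeval c.op (g₂ ^ m * (u m * g₁ ^ m)) x ∈
        (PowerSeries.X : ℂ⟦X⟧) ^ m • W := by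
      convert hA m (u m) using 3
      ring
    have h2 : Polynomial.aeval c.op (g₂ ^ m) x =
        Polynomial.aeval c.op (g₂ ^ m * (u m * g₁ ^ m)) x +
          Polynomial.aeval c.op (g₂ ^ m) (Polynomial.aeval c.op (v m * g₂ ^ m) x) := by
      rw [← Module.End.mul_apply, ← map_mul, ← LinearMap.add_apply, ← map_add, ← mul_add, huv,
        mul_one]
    rw [map_sub, h2, add_sub_assoc, ← map_sub, ← neg_sub, map_neg]
    exact Submodule.add_mem _ h1 (Submodule.neg_mem _ ((hW.X_pow_smul m).aeval_mem _ (hlim m)))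

/-- The W₁-component of b z vanishes because it lies in both summands; thus W₀ ∩ bW = bW₀. -/
theorem mem_X_smul_of_mem_left {W₀ W₁ : Submodule ℂ⟦X⟧ M} (hinf : W₀ ⊓ W₁ = ⊥)
    (hsup : W₀ ⊔ W₁ = W) {x : M} (hx : x ∈ W₀) (hxW : x ∈ (PowerSeries.X : ℂ⟦X⟧) ^ 1 • W) :
    x ∈ (PowerSeries.X : ℂ⟦X⟧) ^ 1 • W₀ := by
  obtain ⟨z, hz, rfl⟩ := mem_X_pow_smul.1 hxW
  rw [← hsup] at hz
  obtain ⟨w₀, h₀, w₁, h₁, rfl⟩ := Submodule.mem_sup.1 hz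
  have h : (PowerSeries.X : ℂ⟦X⟧) ^ 1 • w₁ ∈ W₀ ⊓ W₁ := by
    refine ⟨?_, W₁.smul_mem _ h₁⟩
    rw [smul_add] at hx
    exact (Submodule.add_mem_iff_right W₀ (W₀.smul_mem _ h₀)).1 hx
  rw [hinf, Submodule.mem_bot] at h
  rw [smul_add, h, add_zero]
  exact mem_X_pow_smul.2 ⟨w₀, h₀, rfl⟩

/-- Some power of g₁ sends x into bW by definition. To reach the first power, multiply u g₁^k + v g₂
= 1 by g₁: g₁ becomes a combination of g₁^k and g₁g₂, both of which send x into bW. -/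
theorem aeval_mem_X_smul_nilPart (hfg : W.FG) (hg : IsCoprime g₁ g₂)
    (h : ∀ x ∈ W, Polynomial.aeval c.op (g₁ * g₂) x ∈ (PowerSeries.X : ℂ⟦X⟧) ^ 1 • W) {x : M}
    (hx : x ∈ nilPart W hW g₁) :
    Polynomial.aeval c.op g₁ x ∈ (PowerSeries.X : ℂ⟦X⟧) ^ 1 • nilPart W hW g₁ := by
  refine mem_X_smul_of_mem_left (nilPart_inf hfg hg) (nilPart_sup (hW := hW) hfg hg h)
    (stable_nilPart.aeval_mem _ hx) ?_
  obtain ⟨k, hk⟩ := hx.2 1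
  obtain ⟨u, v, huv⟩ := hg.pow_left (m := k)
  refine aeval_combination (u * g₁) v ?_ (hW.X_pow_smul 1) hk (h x hx.1)
  linear_combination g₁ * huv

/-- The decomposition of `W` according to the factorization `T^d (T^h - κ)` modulo `b`. -/
theorem isLocalDecomposition_nilPart (hfg : W.FG) {d h : ℕ} (hh : h ≠ 0) {κ : ℂ} (hκ : κ ≠ 0)
    (hmod : ∀ x ∈ W, Polynomial.aeval c.op
      (Polynomial.X ^ d * (Polynomial.X ^ h - Polynomial.C κ)) x ∈
        (PowerSeries.X : ℂ⟦X⟧) ^ 1 • W) :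
    c.IsLocalDecomposition W (nilPart W hW (Polynomial.X ^ d))
      (nilPart W hW (Polynomial.X ^ h - Polynomial.C κ)) := by
  obtain ⟨h, rfl⟩ := Nat.exists_eq_succ_of_ne_zero hh
  have hC : (Polynomial.C κ⁻¹ : Polynomial ℂ) * Polynomial.C κ = 1 := by
    rw [← Polynomial.C_mul, inv_mul_cancel₀ hκ, Polynomial.C_1]
  have hcop : IsCoprime (Polynomial.X ^ d : Polynomial ℂ)
      (Polynomial.X ^ (h + 1) - Polynomial.C κ) := by
    -- The Bézout identity is κ⁻¹Tʰ·T - κ⁻¹(Tʰ⁺¹ - κ) = 1.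
    refine IsCoprime.pow_left ⟨Polynomial.C κ⁻¹ * Polynomial.X ^ h, -Polynomial.C κ⁻¹, ?_⟩
    linear_combination hC
  have hmod' : ∀ x ∈ W, Polynomial.aeval c.op
      ((Polynomial.X ^ (h + 1) - Polynomial.C κ) * Polynomial.X ^ d) x ∈
        (PowerSeries.X : ℂ⟦X⟧) ^ 1 • W := fun x hx => by
    rw [mul_comm]
    exact hmod x hx
  -- On this summand aʰ⁺¹ is κ modulo b, so κ⁻¹aʰ inverts a modulo b. Injectivity and surjectivity
  -- both come from this.
  have hx₁ : ∀ x ∈ nilPart W hW (Polynomial.X ^ (h + 1) - Polynomial.C κ), ∃ z ∈ nilPart W hW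
      (Polynomial.X ^ (h + 1) - Polynomial.C κ), x = κ⁻¹ • (c.op ^ h) (c.op x) +
        (PowerSeries.X : ℂ⟦X⟧) • z := by
    intro x hx
    obtain ⟨z, hz, e⟩ := mem_X_pow_smul.1 (aeval_mem_X_smul_nilPart hfg hcop.symm hmod' hx)
    refine ⟨-(κ⁻¹ • z), Submodule.neg_mem _ (complex_smul_mem _ hz), ?_⟩
    rw [map_sub, map_pow, Polynomial.aeval_X, Polynomial.aeval_C, pow_one, LinearMap.sub_apply,
      Module.algebraMap_end_apply, pow_succ, Module.End.mul_apply] at e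
    rw [smul_neg, smul_comm, ← e, smul_sub, smul_smul κ⁻¹ κ, inv_mul_cancel₀ hκ, one_smul]
    abel
  refine ⟨stable_nilPart, stable_nilPart, nilPart_inf hfg hcop, nilPart_sup hfg hcop hmod,
    ⟨d, fun x hx => ?_⟩, ?_, ?_⟩
  · have h' := aeval_mem_X_smul_nilPart hfg hcop hmod hx
    rw [mem_X_pow_smul, map_pow, Polynomial.aeval_X, pow_one] at h'
    exact h'
  · rintro x hx ⟨z, hz, e⟩
    obtain ⟨w, hw, e'⟩ := hx₁ x hx
    have h1 : (c.op ^ h) (c.op x) ∈ (PowerSeries.X : ℂ⟦X⟧) ^ 1 •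
        nilPart W hW (Polynomial.X ^ (h + 1) - Polynomial.C κ) :=
      (stable_nilPart.X_pow_smul 1).pow_mem h (mem_X_pow_smul.2 ⟨z, hz, by rw [pow_one, e]⟩)
    have h2 := Submodule.add_mem _ (complex_smul_mem κ⁻¹ h1)
      (mem_X_pow_smul.2 ⟨w, hw, rfl⟩)
    rw [pow_one, ← e', ← pow_one (PowerSeries.X : ℂ⟦X⟧), mem_X_pow_smul] at h2
    simpa using h2
  · intro y hy
    obtain ⟨w, hw, e⟩ := hx₁ y hy
    refine ⟨κ⁻¹ • (c.op ^ h) y, complex_smul_mem _ (stable_nilPart.pow_mem h hy), w, hw, ?_⟩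
    rw [map_smul, ← Module.End.mul_apply, ← pow_succ', pow_succ]
    exact e

end Decomposition

/-! ### Finite generation and the relation modulo b. -/

/-- The `ℂ[[b]]`-module generated by `e, a e, …, a^(D-1) e`. -/
def krylovLT (c : ConnOp dPow M) (D : ℕ) (e : M) : Submodule ℂ⟦X⟧ M :=
  Submodule.span ℂ⟦X⟧ ((fun i : ℕ => (c.op ^ i) e) '' Set.Iio D)

theorem krylovLT_mono {D D' : ℕ} (h : D ≤ D') (e : M) : c.krylovLT D e ≤ c.krylovLT D' e :=
  Submodule.span_mono (Set.image_mono (Set.Iio_subset_Iio h))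

theorem pow_mem_krylovLT {i D : ℕ} (h : i < D) (e : M) : (c.op ^ i) e ∈ c.krylovLT D e :=
  Submodule.subset_span ⟨i, h, rfl⟩

/-- The target N is left free: it is the span with one more generator in general, and the original
span once the relation closes it up. -/
theorem op_mem_of_mem_krylovLT {D : ℕ} {e z : M} (hz : z ∈ c.krylovLT D e) {N : Submodule ℂ⟦X⟧ M}
    (hN : c.krylovLT (D + 1) e ≤ N) : c.op z ∈ N := by
  induction hz using Submodule.span_induction with
  | mem x hx =>
    obtain ⟨i, hi, rfl⟩ := hx
    simp only [← Module.End.mul_apply, ← pow_succ']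
    exact hN (pow_mem_krylovLT (Nat.succ_lt_succ hi) e)
  | zero => rw [map_zero]; exact Submodule.zero_mem _
  | add x y _ _ hx hy => rw [map_add]; exact Submodule.add_mem _ hx hy
  | smul r x hx' hx =>
    rw [c.leibniz]
    exact Submodule.add_mem _ (Submodule.smul_mem _ _ hx)
      (Submodule.smul_mem _ _ (hN (krylovLT_mono (Nat.le_succ D) e hx')))

/-- Each factor a - i b agrees with a modulo b, and the errors only involve lower powers of a
applied to e. -/
theorem action_fallingA_sub_mem (e : M) (i : ℕ) :
    c.action (fallingA i) e - (c.op ^ i) e ∈ (PowerSeries.X : ℂ⟦X⟧) ^ 1 • c.krylovLT i e := by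
  induction i with
  | zero => simp [fallingA]
  | succ i ih =>
    obtain ⟨z, hz, hz'⟩ := mem_X_pow_smul.1 ih
    have e1 : c.action (fallingA i) e = (c.op ^ i) e + (PowerSeries.X : ℂ⟦X⟧) ^ 1 • z := by
      rw [← hz']; abel
    have e2 : c.action (fallingA (i + 1)) e - (c.op ^ (i + 1)) e = (PowerSeries.X : ℂ⟦X⟧) ^ 1 •
        (c.op z + (PowerSeries.X : ℂ⟦X⟧) • z -
          (i : ℂ⟦X⟧) • ((c.op ^ i) e + (PowerSeries.X : ℂ⟦X⟧) ^ 1 • z)) := by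
      rw [fallingA, sub_mul, map_sub, map_mul, map_mul, map_mul, map_natCast, LinearMap.sub_apply,
        Module.End.mul_apply, Module.End.mul_apply, Module.End.mul_apply, action_genB, action_genA,
        e1, map_add, c.leibniz, dPow_X_pow, pow_succ' c.op, Module.End.mul_apply,
        Module.End.natCast_apply, ← Nat.cast_smul_eq_nsmul ℂ⟦X⟧, Nat.cast_one, one_mul]
      generalize (i : ℂ⟦X⟧) = k
      simp only [smul_add, smul_sub, smul_smul, pow_one, mul_comm, mul_left_comm]
      abel
    rw [e2]
    refine mem_X_pow_smul.2 ⟨_, Submodule.sub_mem _ (Submodule.add_mem _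
      (op_mem_of_mem_krylovLT hz le_rfl) (Submodule.smul_mem _ _ (krylovLT_mono (Nat.le_succ i) e hz)))
      (Submodule.smul_mem _ _ (Submodule.add_mem _ (pow_mem_krylovLT (Nat.lt_succ_self i) e)
        (Submodule.smul_mem _ _ (krylovLT_mono (Nat.le_succ i) e hz)))), rfl⟩

/-- In the expansion of a homogeneous element, monic in a, only the top term has no factor b. -/
theorem action_homogElt_sub_mem (e : M) {p : Polynomial ℂ} (hp : p.Monic) :
    c.action (homogElt p.natDegree p) e - (c.op ^ p.natDegree) e ∈
      (PowerSeries.X : ℂ⟦X⟧) ^ 1 • c.krylovLT p.natDegree e := by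
  have h1 : (1 : ℂ) * (-1) ^ (p.natDegree + p.natDegree) = 1 := by
    rw [← two_mul, pow_mul]; simp
  rw [homogElt_eq_sum _ p le_rfl, Finset.sum_range_succ, hp.coeff_natDegree, h1, Nat.sub_self,
    pow_zero, one_mul, one_smul, map_add, LinearMap.add_apply, add_sub_assoc, map_sum,
    LinearMap.sum_apply]
  refine Submodule.add_mem _ (Submodule.sum_mem _ fun i hi => ?_) (action_fallingA_sub_mem e _)
  have hi' : i < p.natDegree := Finset.mem_range.1 hi
  rw [map_smul, LinearMap.smul_apply, map_mul, Module.End.mul_apply, action_genB_pow]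
  refine complex_smul_mem _ (X_pow_smul_anti (Nat.le_sub_of_add_le (by omega)) _
    (mem_X_pow_smul.2 ⟨_, ?_, rfl⟩))
  rw [← sub_add_cancel (c.action (fallingA i) e) ((c.op ^ i) e)]
  exact Submodule.add_mem _ (krylovLT_mono hi'.le e (X_pow_smul_le _ _ (action_fallingA_sub_mem e i)))
    (pow_mem_krylovLT hi' e)

section Relation

variable {p p' : Polynomial ℂ} {κ : ℂ} {e : M}

theorem pow_sub_mem_of_relation (hp : p.Monic) (hp' : p'.Monic) (hd : p.natDegree < p'.natDegree)
    (h : c.action (homogElt p'.natDegree p') e = κ • c.action (homogElt p.natDegree p) e) :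
    (c.op ^ p'.natDegree) e - κ • (c.op ^ p.natDegree) e ∈
      (PowerSeries.X : ℂ⟦X⟧) ^ 1 • c.krylovLT p'.natDegree e := by
  have h1 := action_homogElt_sub_mem (c := c) e hp'
  have h2 := X_pow_smul_mono 1 (krylovLT_mono hd.le e) (action_homogElt_sub_mem (c := c) e hp)
  have h3 := Submodule.sub_mem _ (complex_smul_mem κ h2) h1
  convert h3 using 1
  rw [h, smul_sub]
  abel

/-- The relation expresses the first missing power of a on e by the earlier ones, so their span is
already a-stable. -/
theorem krylov_eq_krylovLT (hp : p.Monic) (hp' : p'.Monic) (hd : p.natDegree < p'.natDegree)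
    (h : c.action (homogElt p'.natDegree p') e = κ • c.action (homogElt p.natDegree p) e) :
    c.krylov e = c.krylovLT p'.natDegree e := by
  refine le_antisymm (krylov_le ?_ (by simpa using pow_mem_krylovLT (c := c) (Nat.zero_lt_of_lt hd) e))
    (Submodule.span_mono (Set.image_subset_range _ _))
  intro z hz
  refine op_mem_of_mem_krylovLT hz (Submodule.span_le.2 ?_)
  rintro _ ⟨i, hi, rfl⟩
  rcases Nat.lt_succ_iff_lt_or_eq.1 hi with hi | rfl
  · exact pow_mem_krylovLT hi e
  · have := X_pow_smul_le _ _ (pow_sub_mem_of_relation hp hp' hd h)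
    simp only [SetLike.mem_coe]
    rw [← sub_add_cancel ((c.op ^ p'.natDegree) e) (κ • (c.op ^ p.natDegree) e)]
    exact Submodule.add_mem _ this (complex_smul_mem _ (pow_mem_krylovLT hd e))

theorem krylov_fg (hp : p.Monic) (hp' : p'.Monic) (hd : p.natDegree < p'.natDegree)
    (h : c.action (homogElt p'.natDegree p') e = κ • c.action (homogElt p.natDegree p) e) :
    (c.krylov e).FG := by
  rw [krylov_eq_krylovLT hp hp' hd h]
  exact Submodule.fg_span ((Set.finite_Iio _).image _)

theorem aeval_krylov_mem (hp : p.Monic) (hp' : p'.Monic) (hd : p.natDegree < p'.natDegree)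
    (h : c.action (homogElt p'.natDegree p') e = κ • c.action (homogElt p.natDegree p) e)
    {x : M} (hx : x ∈ c.krylov e) :
    Polynomial.aeval c.op (Polynomial.X ^ p.natDegree *
      (Polynomial.X ^ (p'.natDegree - p.natDegree) - Polynomial.C κ)) x ∈
        (PowerSeries.X : ℂ⟦X⟧) ^ 1 • c.krylov e := by
  have h1 : Polynomial.aeval c.op (Polynomial.X ^ p.natDegree *
      (Polynomial.X ^ (p'.natDegree - p.natDegree) - Polynomial.C κ)) e ∈
        (PowerSeries.X : ℂ⟦X⟧) ^ 1 • c.krylov e := by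
    rw [mul_sub, ← pow_add, Nat.add_sub_cancel' hd.le, mul_comm, map_sub, map_mul, map_pow,
      map_pow, Polynomial.aeval_X, Polynomial.aeval_C, krylov_eq_krylovLT hp hp' hd h]
    exact pow_sub_mem_of_relation hp hp' hd h
  -- The congruence at e spreads to its whole Krylov module. Taking r = 1 and j = 0 makes both error
  -- terms multiples of b.
  have h2 := aeval_mem_of_mem_krylov (stable_krylov e) h1 hx (j := 0) (r := 1) (by simp)
  rw [one_smul] at h2
  exact mem_of_mem_sup le_rfl le_rfl h2

end Relation

end ConnOp

/-! ### Regularity by a lattice argument. -/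

theorem dPow_eq_X_mul (r : ℂ⟦X⟧) :
    dPow r = PowerSeries.X * (PowerSeries.X * PowerSeries.derivative (R := ℂ) r) := by
  rw [← mul_assoc, ← pow_two]; rfl

namespace ConnOp

section Regularity

variable {V : Type} [AddCommGroup V] [Module ℂ V] [Module ℂ⟦X⟧ V] [IsScalarTower ℂ ℂ⟦X⟧ V]
  [Module.IsTorsionFree ℂ⟦X⟧ V] {c : ConnOp dPow V} {S : Module.End ℂ V}

theorem X_pow_smul_cancel {m : ℕ} {u v : V}
    (h : (PowerSeries.X : ℂ⟦X⟧) ^ m • u = (PowerSeries.X : ℂ⟦X⟧) ^ m • v) : u = v :=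
  smul_right_injective V (pow_ne_zero m PowerSeries.X_ne_zero) h

theorem mem_of_X_pow_smul_mem {m : ℕ} {u : V} {N : Submodule ℂ⟦X⟧ V}
    (h : (PowerSeries.X : ℂ⟦X⟧) ^ m • u ∈ (PowerSeries.X : ℂ⟦X⟧) ^ m • N) : u ∈ N := by
  obtain ⟨z, hz, e⟩ := mem_X_pow_smul.1 h
  rwa [X_pow_smul_cancel e]

/-- The Leibniz rule for `-b⁻¹ a`. -/
theorem neg_div_leibniz (hS : ∀ v, (PowerSeries.X : ℂ⟦X⟧) • S v = -c.op v) (r : ℂ⟦X⟧) (v : V) :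
    S (r • v) = r • S v - (PowerSeries.X * PowerSeries.derivative (R := ℂ) r) • v := by
  refine X_pow_smul_cancel (m := 1) ?_
  rw [pow_one, hS, c.leibniz, dPow_eq_X_mul, smul_sub, smul_comm, hS, smul_neg, mul_smul]
  abel

/-- The `ℂ[[b]]`-module generated by the `(-b⁻¹ a)ⁱ e`. -/
def cyc (S : Module.End ℂ V) (e : V) : Submodule ℂ⟦X⟧ V :=
  Submodule.span ℂ⟦X⟧ (Set.range fun i : ℕ => (S ^ i) e)

/-- Stability under S may be tested on generators although S is not linear, since the Leibniz
correction b r'(b) v stays in the span. -/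
theorem apply_mem_of_span (hS : ∀ v, (PowerSeries.X : ℂ⟦X⟧) • S v = -c.op v) {s : Set V}
    (hs : ∀ v ∈ s, S v ∈ Submodule.span ℂ⟦X⟧ s) {v : V} (hv : v ∈ Submodule.span ℂ⟦X⟧ s) :
    S v ∈ Submodule.span ℂ⟦X⟧ s := by
  induction hv using Submodule.span_induction with
  | mem x hx => exact hs x hx
  | zero => rw [map_zero]; exact Submodule.zero_mem _
  | add x y _ _ hx hy => rw [map_add]; exact Submodule.add_mem _ hx hy
  | smul r x hx' hx =>
    rw [neg_div_leibniz hS]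
    exact Submodule.sub_mem _ (Submodule.smul_mem _ _ hx) (Submodule.smul_mem _ _ hx')

theorem apply_mem_cyc (hS : ∀ v, (PowerSeries.X : ℂ⟦X⟧) • S v = -c.op v) {e v : V}
    (hv : v ∈ cyc S e) : S v ∈ cyc S e := by
  refine apply_mem_of_span hS ?_ hv
  rintro _ ⟨i, rfl⟩
  exact Submodule.subset_span ⟨i + 1, by simp only [pow_succ', Module.End.mul_apply]⟩

theorem pow_mem_cyc (i : ℕ) (e : V) : (S ^ i) e ∈ cyc S e := Submodule.subset_span ⟨i, rfl⟩

/-- The generators `b^(k-d) (-b⁻¹ a)^k e` of a lattice adapted to the slopes `0` (for `k < d`) and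
`1` (for `k ≥ d`). -/
def slopeVec (S : Module.End ℂ V) (d : ℕ) (e : V) (k : ℕ) : V :=
  (PowerSeries.X : ℂ⟦X⟧) ^ (k - d) • (S ^ k) e

/-- The lattice spanned by the `n` first vectors `b^(k-d) (-b⁻¹ a)^k e`. -/
def slopeLattice (S : Module.End ℂ V) (d : ℕ) (e : V) (n : ℕ) : Submodule ℂ⟦X⟧ V :=
  Submodule.span ℂ⟦X⟧ (slopeVec S d e '' Set.Iio n)

theorem slopeVec_mem {d k n : ℕ} (h : k < n) (e : V) : slopeVec S d e k ∈ slopeLattice S d e n :=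
  Submodule.subset_span ⟨k, h, rfl⟩

theorem mem_slopeLattice {d n : ℕ} (h : 0 < n) (e : V) : e ∈ slopeLattice S d e n := by
  have := slopeVec_mem (S := S) (d := d) h e
  simpa [slopeVec] using this

theorem slopeLattice_mono {d n n' : ℕ} (h : n ≤ n') (e : V) :
    slopeLattice S d e n ≤ slopeLattice S d e n' :=
  Submodule.span_mono (Set.image_mono (Set.Iio_subset_Iio h))

theorem slopeLattice_fg (d n : ℕ) (e : V) : (slopeLattice S d e n).FG :=
  Submodule.fg_span ((Set.finite_Iio _).image _)

theorem op_slopeVec (hS : ∀ v, (PowerSeries.X : ℂ⟦X⟧) • S v = -c.op v) (d k : ℕ) (e : V) :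
    c.op (slopeVec S d e k) = -((PowerSeries.X : ℂ⟦X⟧) ^ (k - d + 1) • (S ^ (k + 1)) e) +
      (PowerSeries.X : ℂ⟦X⟧) ^ 1 • ((k - d : ℕ) : ℂ⟦X⟧) • slopeVec S d e k := by
  have h : c.op ((S ^ k) e) = -((PowerSeries.X : ℂ⟦X⟧) • (S ^ (k + 1)) e) := by
    rw [pow_succ', Module.End.mul_apply, hS, neg_neg]
  rw [slopeVec, c.leibniz, dPow_X_pow, h, smul_neg, smul_smul, ← pow_succ, smul_smul, smul_smul]
  congr 2
  ring

/-- Below index d no power of b is available, so a = -bS shifts the generators with a factor b. -/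
theorem op_slopeVec_of_lt (hS : ∀ v, (PowerSeries.X : ℂ⟦X⟧) • S v = -c.op v) {d k : ℕ} (hk : k < d)
    (e : V) : c.op (slopeVec S d e k) = (PowerSeries.X : ℂ⟦X⟧) ^ 1 • -slopeVec S d e (k + 1) := by
  have h1 : k - d = 0 := by omega
  have h2 : k + 1 - d = 0 := by omega
  rw [op_slopeVec hS, slopeVec, slopeVec, h1, h2]
  simp

/-- From index d on, the factor b produced by a is absorbed in the next generator: a is minus the
shift modulo b. -/
theorem op_slopeVec_of_le (hS : ∀ v, (PowerSeries.X : ℂ⟦X⟧) • S v = -c.op v) {d k : ℕ} (hk : d ≤ k)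
    (e : V) : c.op (slopeVec S d e k) = -slopeVec S d e (k + 1) +
      (PowerSeries.X : ℂ⟦X⟧) ^ 1 • ((k - d : ℕ) : ℂ⟦X⟧) • slopeVec S d e k := by
  have h2 : k + 1 - d = k - d + 1 := by omega
  rw [op_slopeVec hS, slopeVec, slopeVec, h2]

section SlopeRelation

variable {p p' : Polynomial ℂ} {κ : ℂ} {e : V}

theorem aeval_apply_eq_sum_add {p : Polynomial ℂ} (hp : p.Monic) (T : Module.End ℂ V) (e : V) :
    Polynomial.aeval T p e = ∑ i ∈ Finset.range p.natDegree, p.coeff i • (T ^ i) e +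
      (T ^ p.natDegree) e := by
  rw [Polynomial.aeval_eq_sum_range, LinearMap.sum_apply, Finset.sum_range_succ,
    hp.coeff_natDegree, one_smul]
  rfl

/-- The relation expresses the last generator in terms of the `d`-th one. -/
theorem slopeVec_last (hp : p.Monic) (hp' : p'.Monic) (hd : p.natDegree < p'.natDegree)
    (h : (-PowerSeries.X : ℂ⟦X⟧) ^ (p'.natDegree - p.natDegree) • Polynomial.aeval S p' e =
      κ • Polynomial.aeval S p e) :
    slopeVec S p.natDegree e p'.natDegree -
      ((-1) ^ (p'.natDegree - p.natDegree) * κ) • slopeVec S p.natDegree e p.natDegree ∈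
      slopeLattice S p.natDegree e p.natDegree ⊔
        (PowerSeries.X : ℂ⟦X⟧) ^ 1 • slopeLattice S p.natDegree e p'.natDegree := by
  set d := p.natDegree with hdd
  set n := p'.natDegree with hn
  have h0 : ∀ k, k ≤ d → slopeVec S d e k = (S ^ k) e := fun k hk => by
    rw [slopeVec, Nat.sub_eq_zero_of_le hk, pow_zero, one_smul]
  set P := ∑ i ∈ Finset.range d, p.coeff i • (S ^ i) e with hP
  set P' := ∑ i ∈ Finset.range n, p'.coeff i • (S ^ i) e with hP'
  have hPm : P ∈ slopeLattice S d e d := Submodule.sum_mem _ fun i hi => by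
    rw [← h0 i (Finset.mem_range.1 hi).le]
    exact complex_smul_mem _ (slopeVec_mem (Finset.mem_range.1 hi) e)
  have hPm' : (PowerSeries.X : ℂ⟦X⟧) ^ (n - d) • P' ∈
      (PowerSeries.X : ℂ⟦X⟧) ^ 1 • slopeLattice S d e n := by
    rw [hP', Finset.smul_sum]
    refine Submodule.sum_mem _ fun i hi => ?_
    have hi' := Finset.mem_range.1 hi
    -- As i < n and d < n, truncated subtraction gives i - d < n - d. After the power b^(i-d) in the
    -- i-th generator is accounted for, at least one b remains.
    obtain ⟨t, ht⟩ : ∃ t, n - d = (t + 1) + (i - d) := ⟨n - d - (i - d) - 1, by omega⟩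
    rw [smul_comm, ht, pow_add, mul_smul]
    exact complex_smul_mem _ (X_pow_smul_anti (Nat.le_add_left 1 t) _
      (mem_X_pow_smul.2 ⟨_, slopeVec_mem hi' e, rfl⟩))
  have hneg : ∀ v : V, (-PowerSeries.X : ℂ⟦X⟧) ^ (n - d) • v =
      ((-1 : ℂ) ^ (n - d)) • (PowerSeries.X : ℂ⟦X⟧) ^ (n - d) • v := by
    intro v
    rw [← algebraMap_smul ℂ⟦X⟧ ((-1 : ℂ) ^ (n - d)), smul_smul, neg_pow, map_pow, map_neg, map_one]
  have hsq : ((-1 : ℂ) ^ (n - d)) * ((-1 : ℂ) ^ (n - d)) = 1 := by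
    rw [← mul_pow]; simp
  rw [aeval_apply_eq_sum_add hp, aeval_apply_eq_sum_add hp', hneg, ← hdd, ← hn, ← hP, ← hP'] at h
  have h' := congrArg (fun v => ((-1 : ℂ) ^ (n - d)) • v) h
  simp only [smul_smul, hsq, one_smul, smul_add] at h'
  have key : slopeVec S d e n - ((-1) ^ (n - d) * κ) • slopeVec S d e d =
      ((-1) ^ (n - d) * κ) • P - (PowerSeries.X : ℂ⟦X⟧) ^ (n - d) • P' := by
    rw [h0 d le_rfl, slopeVec, ← sub_eq_zero, ← sub_eq_zero.2 h']
    abel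
  rw [key]
  exact Submodule.sub_mem _ (Submodule.mem_sup_left (complex_smul_mem _ hPm))
    (Submodule.mem_sup_right hPm')

theorem op_mem_slopeLattice_sup (hS : ∀ v, (PowerSeries.X : ℂ⟦X⟧) • S v = -c.op v) {d n : ℕ}
    (hd : d < n) {v : V} (hv : v ∈ slopeLattice S d e d) :
    c.op v ∈ (PowerSeries.X : ℂ⟦X⟧) ^ 1 • slopeLattice S d e n := by
  induction hv using Submodule.span_induction with
  | mem x hx =>
    obtain ⟨k, hk, rfl⟩ := hx
    have hk' : k < d := hk
    rw [op_slopeVec_of_lt hS hk]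
    exact mem_X_pow_smul.2 ⟨_, Submodule.neg_mem _ (slopeVec_mem (by omega) e), rfl⟩
  | zero => rw [map_zero]; exact Submodule.zero_mem _
  | add x y _ _ hx hy => rw [map_add]; exact Submodule.add_mem _ hx hy
  | smul r x hx' hx =>
    rw [c.leibniz, dPow_eq_X_mul, mul_smul]
    refine Submodule.add_mem _ (Submodule.smul_mem _ _ hx) ?_
    exact mem_X_pow_smul.2 ⟨_, Submodule.smul_mem _ _ (slopeLattice_mono hd.le e hx'),
      by rw [pow_one]⟩

/-- The shift leaves the lattice only at the last generator, where the relation brings it back. -/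
theorem stable_slopeLattice (hS : ∀ v, (PowerSeries.X : ℂ⟦X⟧) • S v = -c.op v) (hp : p.Monic)
    (hp' : p'.Monic) (hd : p.natDegree < p'.natDegree)
    (h : (-PowerSeries.X : ℂ⟦X⟧) ^ (p'.natDegree - p.natDegree) • Polynomial.aeval S p' e =
      κ • Polynomial.aeval S p e) :
    c.Stable (slopeLattice S p.natDegree e p'.natDegree) := by
  have hlast := slopeVec_last hp hp' hd h
  set d := p.natDegree
  set n := p'.natDegree
  intro v hv
  induction hv using Submodule.span_induction with
  | mem x hx =>
    obtain ⟨k, hk, rfl⟩ := hx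
    have hk' : k < n := hk
    rcases lt_or_ge k d with hkd | hkd
    · rw [op_slopeVec_of_lt hS hkd]
      exact Submodule.smul_mem _ _ (Submodule.neg_mem _ (slopeVec_mem (by omega) e))
    · rw [op_slopeVec_of_le hS hkd]
      refine Submodule.add_mem _ (Submodule.neg_mem _ ?_)
        (Submodule.smul_mem _ _ (Submodule.smul_mem _ _ (slopeVec_mem hk' e)))
      rcases Nat.lt_or_ge (k + 1) n with hk1 | hk1
      · exact slopeVec_mem hk1 e
      · have hkn : k + 1 = n := by omega
        rw [hkn]
        have h1 := mem_of_mem_sup (slopeLattice_mono hd.le e) (X_pow_smul_le 1 _) hlast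
        rw [← sub_add_cancel (slopeVec S d e n)
          (((-1) ^ (n - d) * κ) • slopeVec S d e d)]
        exact Submodule.add_mem _ h1 (complex_smul_mem _ (slopeVec_mem hd e))
  | zero => rw [map_zero]; exact Submodule.zero_mem _
  | add x y _ _ hx hy => rw [map_add]; exact Submodule.add_mem _ hx hy
  | smul r x hx' hx =>
    rw [c.leibniz]
    exact Submodule.add_mem _ (Submodule.smul_mem _ _ hx) (Submodule.smul_mem _ _ hx')

/-- Modulo `b` and the slope `0` part, `a` is surjective on the lattice. -/
theorem exists_sub_op_mem (hS : ∀ v, (PowerSeries.X : ℂ⟦X⟧) • S v = -c.op v) (hp : p.Monic)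
    (hp' : p'.Monic) (hd : p.natDegree < p'.natDegree) (hκ : κ ≠ 0)
    (h : (-PowerSeries.X : ℂ⟦X⟧) ^ (p'.natDegree - p.natDegree) • Polynomial.aeval S p' e =
      κ • Polynomial.aeval S p e) {x : V} (hx : x ∈ slopeLattice S p.natDegree e p'.natDegree) :
    ∃ y ∈ slopeLattice S p.natDegree e p'.natDegree,
      x - c.op y ∈ slopeLattice S p.natDegree e p.natDegree ⊔
        (PowerSeries.X : ℂ⟦X⟧) ^ 1 • slopeLattice S p.natDegree e p'.natDegree := by
  have hlast := slopeVec_last hp hp' hd h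
  set d := p.natDegree
  set n := p'.natDegree
  set ε : ℂ := (-1) ^ (n - d) * κ with hε
  have hε0 : ε ≠ 0 := mul_ne_zero (pow_ne_zero _ (by norm_num)) hκ
  have hstep : ∀ k, d ≤ k → k < n → slopeVec S d e (k + 1) - c.op (-slopeVec S d e k) ∈
      (PowerSeries.X : ℂ⟦X⟧) ^ 1 • slopeLattice S d e n := by
    intro k hk hkn
    rw [map_neg, sub_neg_eq_add, op_slopeVec_of_le hS hk, add_neg_cancel_left]
    exact mem_X_pow_smul.2 ⟨_, Submodule.smul_mem _ _ (slopeVec_mem hkn e), rfl⟩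
  induction hx using Submodule.span_induction with
  | mem x hx =>
    obtain ⟨k, hk, rfl⟩ := hx
    have hk' : k < n := hk
    rcases lt_trichotomy k d with hkd | rfl | hkd
    · refine ⟨0, Submodule.zero_mem _, ?_⟩
      rw [map_zero, sub_zero]
      exact Submodule.mem_sup_left (slopeVec_mem hkd e)
    -- Modulo the target the n-th vector is ε times the d-th one, so the preimage of the d-th
    -- generator comes from the last generator, of index n - 1. This uses κ ≠ 0.
    · obtain ⟨m, hm⟩ : ∃ m, n = m + 1 := ⟨n - 1, by omega⟩
      refine ⟨ε⁻¹ • -slopeVec S d e m, complex_smul_mem _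
        (Submodule.neg_mem _ (slopeVec_mem (by omega) e)), ?_⟩
      have h1 := hstep m (by omega) (by omega)
      rw [← hm] at h1
      have h2 := complex_smul_mem ε⁻¹ (Submodule.sub_mem _ (Submodule.mem_sup_right h1) hlast)
      convert h2 using 1
      rw [map_smul, sub_sub_sub_cancel_left, smul_sub, smul_smul, inv_mul_cancel₀ hε0, one_smul]
    · obtain ⟨m, rfl⟩ : ∃ m, k = m + 1 := ⟨k - 1, by omega⟩
      exact ⟨_, Submodule.neg_mem _ (slopeVec_mem (by omega) e),
        Submodule.mem_sup_right (hstep m (by omega) (by omega))⟩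
  | zero => exact ⟨0, Submodule.zero_mem _, by rw [map_zero, sub_zero]; exact Submodule.zero_mem _⟩
  | add x x' _ _ hx hx' =>
    obtain ⟨y, hy, hxy⟩ := hx
    obtain ⟨y', hy', hxy'⟩ := hx'
    refine ⟨y + y', Submodule.add_mem _ hy hy', ?_⟩
    rw [map_add, add_sub_add_comm]
    exact Submodule.add_mem _ hxy hxy'
  | smul r x _ hx =>
    obtain ⟨y, hy, hxy⟩ := hx
    refine ⟨r • y, Submodule.smul_mem _ _ hy, ?_⟩
    rw [c.leibniz, ← sub_sub, ← smul_sub, dPow_eq_X_mul, mul_smul]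
    refine Submodule.sub_mem _ (Submodule.smul_mem _ _ hxy) (Submodule.mem_sup_right ?_)
    exact mem_X_pow_smul.2 ⟨_, Submodule.smul_mem _ _ hy, by rw [pow_one]⟩

/-- By induction: b^(k+1) S^(k+1) e = -b^k a S^k e = -(a - k b) b^k S^k e. -/
theorem X_pow_mul_pow_mem_krylov (hS : ∀ v, (PowerSeries.X : ℂ⟦X⟧) • S v = -c.op v) (k : ℕ) (e : V) :
    (PowerSeries.X : ℂ⟦X⟧) ^ k • (S ^ k) e ∈ c.krylov e := by
  induction k with
  | zero => simpa using mem_krylov e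
  | succ k ih =>
    have h1 := stable_krylov e _ ih
    rw [c.leibniz, dPow_X_pow] at h1
    have h2 := Submodule.sub_mem _ h1 (Submodule.smul_mem _ ((k : ℂ⟦X⟧) * PowerSeries.X) ih)
    rw [smul_smul, mul_comm (_ * _) (_ ^ k), add_sub_cancel_right] at h2
    rw [pow_succ, pow_succ', mul_smul, Module.End.mul_apply, hS, smul_neg]
    exact Submodule.neg_mem _ h2

theorem X_pow_smul_slopeLattice_le (hS : ∀ v, (PowerSeries.X : ℂ⟦X⟧) • S v = -c.op v) (d n : ℕ)
    (e : V) : (PowerSeries.X : ℂ⟦X⟧) ^ n • slopeLattice S d e n ≤ c.krylov e := by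
  intro v hv
  obtain ⟨z, hz, rfl⟩ := mem_X_pow_smul.1 hv
  clear hv
  induction hz using Submodule.span_induction with
  | mem x hx =>
    obtain ⟨k, hk, rfl⟩ := hx
    obtain ⟨t, ht⟩ := Nat.exists_eq_add_of_lt (Set.mem_Iio.1 hk)
    have e1 : (PowerSeries.X : ℂ⟦X⟧) ^ n • slopeVec S d e k =
        (PowerSeries.X : ℂ⟦X⟧) ^ (t + 1 + (k - d)) • (PowerSeries.X : ℂ⟦X⟧) ^ k • (S ^ k) e := by
      rw [slopeVec, smul_smul, smul_smul, ← pow_add, ← pow_add]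
      congr 2
      omega
    rw [e1]
    exact Submodule.smul_mem _ _ (X_pow_mul_pow_mem_krylov hS k e)
  | zero => rw [smul_zero]; exact Submodule.zero_mem _
  | add x y _ _ hx hy => rw [smul_add]; exact Submodule.add_mem _ hx hy
  | smul r x _ hx => rw [smul_comm]; exact Submodule.smul_mem _ _ hx

/-- If `a` is topologically nilpotent, the slope `1` part vanishes. -/
theorem slopeLattice_le (hS : ∀ v, (PowerSeries.X : ℂ⟦X⟧) • S v = -c.op v) (hp : p.Monic)
    (hp' : p'.Monic) (hd : p.natDegree < p'.natDegree) (hκ : κ ≠ 0)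
    (h : (-PowerSeries.X : ℂ⟦X⟧) ^ (p'.natDegree - p.natDegree) • Polynomial.aeval S p' e =
      κ • Polynomial.aeval S p e)
    (hnil : ∀ m : ℕ, ∃ k : ℕ, ∀ x ∈ c.krylov e,
      (c.op ^ k) x ∈ (PowerSeries.X : ℂ⟦X⟧) ^ m • c.krylov e) :
    slopeLattice S p.natDegree e p'.natDegree ≤ slopeLattice S p.natDegree e p.natDegree := by
  have hst := stable_slopeLattice hS hp hp' hd h
  have hsurj := fun x hx => exists_sub_op_mem hS hp hp' hd hκ h (x := x) hx
  have hUL : c.krylov e ≤ slopeLattice S p.natDegree e p'.natDegree :=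
    krylov_le hst (mem_slopeLattice (Nat.zero_lt_of_lt hd) e)
  have hLU := X_pow_smul_slopeLattice_le hS p.natDegree p'.natDegree e
  have hFL := slopeLattice_mono (S := S) (d := p.natDegree) hd.le e
  have hFop := fun v hv => op_mem_slopeLattice_sup (e := e) hS hd (v := v) hv
  set F := slopeLattice S p.natDegree e p.natDegree
  set Λ := slopeLattice S p.natDegree e p'.natDegree
  set s := p'.natDegree
  set H := F ⊔ (PowerSeries.X : ℂ⟦X⟧) ^ 1 • Λ with hH
  have hHst : c.Stable H := by
    intro y hy
    obtain ⟨u, hu, v, hv, rfl⟩ := Submodule.mem_sup.1 hy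
    rw [map_add]
    exact Submodule.mem_sup_right (Submodule.add_mem _ (hFop u hu) (hst.X_pow_smul 1 v hv))
  -- Surjectivity modulo H = F + bΛ is iterated k times. The factor b^s moves y into the Krylov
  -- module, where the nilpotency hypothesis applies.
  have hiter : ∀ k : ℕ, ∀ x ∈ Λ, ∃ y ∈ Λ, (PowerSeries.X : ℂ⟦X⟧) ^ s • x -
      (c.op ^ k) ((PowerSeries.X : ℂ⟦X⟧) ^ s • y) ∈ (PowerSeries.X : ℂ⟦X⟧) ^ s • H := by
    intro k x hx
    induction k with
    | zero => exact ⟨x, hx, by simp⟩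
    | succ k ih =>
      obtain ⟨y, hy, hxy⟩ := ih
      obtain ⟨y', hy', hyy'⟩ := hsurj y hy
      refine ⟨y', hy', ?_⟩
      have h1 : (PowerSeries.X : ℂ⟦X⟧) ^ s • y - c.op ((PowerSeries.X : ℂ⟦X⟧) ^ s • y') ∈
          (PowerSeries.X : ℂ⟦X⟧) ^ s • H := by
        rw [c.leibniz, dPow_X_pow, mul_smul, ← smul_add, ← smul_sub, ← sub_sub]
        refine mem_X_pow_smul.2 ⟨_, Submodule.sub_mem _ hyy' (Submodule.mem_sup_right ?_), rfl⟩
        rw [mul_comm, mul_smul]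
        exact mem_X_pow_smul.2 ⟨_, Submodule.smul_mem _ _ hy', by rw [pow_one]⟩
      have h2 := Submodule.add_mem _ hxy ((hHst.X_pow_smul s).pow_mem k h1)
      rw [map_sub, sub_add_sub_cancel, ← Module.End.mul_apply, ← pow_succ] at h2
      exact h2
  have hle : Λ ≤ F ⊔ IsLocalRing.maximalIdeal ℂ⟦X⟧ • Λ := by
    intro x hx
    obtain ⟨k, hk⟩ := hnil (s + 1)
    obtain ⟨y, hy, hxy⟩ := hiter k x hx
    -- For this k, a^k sends b^s y into b^(s+1) Λ ⊂ b^s H. Hence b^s x lies in b^s H, and b^s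
    -- cancels.
    have h1 := X_pow_smul_mono (s + 1) hUL (hk _ (hLU (mem_X_pow_smul.2 ⟨y, hy, rfl⟩)))
    have h2 : (PowerSeries.X : ℂ⟦X⟧) ^ (s + 1) • Λ ≤ (PowerSeries.X : ℂ⟦X⟧) ^ s • H := by
      rw [pow_add, mul_smul]
      exact X_pow_smul_mono s le_sup_right
    have h3 := Submodule.add_mem _ hxy (h2 h1)
    rw [sub_add_cancel] at h3
    refine mem_of_mem_sup le_sup_left (le_trans ?_ le_sup_right) (mem_of_X_pow_smul_mem h3)
    intro z hz
    obtain ⟨w, hw, rfl⟩ := mem_X_pow_smul.1 hz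
    rw [pow_one, PowerSeries.maximalIdeal_eq_span_X]
    exact Submodule.smul_mem_smul (Ideal.mem_span_singleton_self _) hw
  -- Nakayama: Λ ⊂ F + 𝔪Λ with Λ finitely generated.
  exact Submodule.le_of_le_smul_of_le_jacobson_bot (slopeLattice_fg _ _ _)
    (IsLocalRing.maximalIdeal_le_jacobson _) hle

/-- Once the lattice is spanned by the S^k e with k < d, it also contains S^d e as its d-th
generator, so it is stable by S. -/
theorem cyc_eq_slopeLattice (hS : ∀ v, (PowerSeries.X : ℂ⟦X⟧) • S v = -c.op v) (hp : p.Monic)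
    (hp' : p'.Monic) (hd : p.natDegree < p'.natDegree) (hκ : κ ≠ 0)
    (h : (-PowerSeries.X : ℂ⟦X⟧) ^ (p'.natDegree - p.natDegree) • Polynomial.aeval S p' e =
      κ • Polynomial.aeval S p e)
    (hnil : ∀ m : ℕ, ∃ k : ℕ, ∀ x ∈ c.krylov e,
      (c.op ^ k) x ∈ (PowerSeries.X : ℂ⟦X⟧) ^ m • c.krylov e) :
    cyc S e = slopeLattice S p.natDegree e p'.natDegree := by
  have hle := slopeLattice_le hS hp hp' hd hκ h hnil
  have h0 : ∀ k, k ≤ p.natDegree → slopeVec S p.natDegree e k = (S ^ k) e := fun k hk => by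
    rw [slopeVec, Nat.sub_eq_zero_of_le hk, pow_zero, one_smul]
  refine le_antisymm (Submodule.span_le.2 ?_) (Submodule.span_le.2 ?_)
  · rintro _ ⟨k, rfl⟩
    simp only [SetLike.mem_coe]
    refine slopeLattice_mono hd.le e ?_
    induction k with
    | zero =>
      -- Going through the large lattice covers d = 0 as well, where the small one is zero and e
      -- vanishes.
      have := hle (slopeVec_mem (Nat.zero_lt_of_lt hd) e)
      rwa [h0 0 (Nat.zero_le _)] at this
    | succ k ih =>
      rw [pow_succ', Module.End.mul_apply]
      refine apply_mem_of_span hS ?_ ih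
      rintro _ ⟨i, hi, rfl⟩
      have hi' : i < p.natDegree := hi
      rw [h0 i hi'.le, ← Module.End.mul_apply, ← pow_succ', ← h0 (i + 1) hi']
      exact hle (slopeVec_mem (by omega) e)
  · rintro _ ⟨k, -, rfl⟩
    exact Submodule.smul_mem _ _ (pow_mem_cyc k e)

/-- Regularity of the part on which `a` is topologically nilpotent. -/
theorem regularity (hS : ∀ v, (PowerSeries.X : ℂ⟦X⟧) • S v = -c.op v) (hp : p.Monic)
    (hp' : p'.Monic) (hd : p.natDegree < p'.natDegree) (hκ : κ ≠ 0)
    (h : (-PowerSeries.X : ℂ⟦X⟧) ^ (p'.natDegree - p.natDegree) • Polynomial.aeval S p' e =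
      κ • Polynomial.aeval S p e)
    (hnil : ∀ m : ℕ, ∃ k : ℕ, ∀ x ∈ c.krylov e,
      (c.op ^ k) x ∈ (PowerSeries.X : ℂ⟦X⟧) ^ m • c.krylov e) :
    (cyc S e).FG ∧ c.krylov e ≤ cyc S e ∧
      (PowerSeries.X : ℂ⟦X⟧) ^ p'.natDegree • cyc S e ≤ c.krylov e ∧
      Polynomial.aeval S p e ∈ (PowerSeries.X : ℂ⟦X⟧) ^ 1 • cyc S e := by
  have hc := cyc_eq_slopeLattice hS hp hp' hd hκ h hnil
  refine ⟨hc ▸ slopeLattice_fg _ _ _, ?_, hc ▸ X_pow_smul_slopeLattice_le hS _ _ e, ?_⟩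
  · rw [hc]
    exact krylov_le (stable_slopeLattice hS hp hp' hd h)
      (mem_slopeLattice (Nat.zero_lt_of_lt hd) e)
  -- Dividing by κ shows p(S) e to be a multiple of (-b)^(d'-d), whose exponent is positive.
  · have h1 : Polynomial.aeval S p e =
        κ⁻¹ • (-PowerSeries.X : ℂ⟦X⟧) ^ (p'.natDegree - p.natDegree) • Polynomial.aeval S p' e := by
      rw [h, smul_smul, inv_mul_cancel₀ hκ, one_smul]
    have h2 : Polynomial.aeval S p' e ∈ cyc S e := by
      rw [Polynomial.aeval_eq_sum_range, LinearMap.sum_apply]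
      exact Submodule.sum_mem _ fun i _ => complex_smul_mem _ (pow_mem_cyc i e)
    rw [h1, neg_pow, mul_smul]
    refine complex_smul_mem _ (Submodule.smul_mem _ _ ?_)
    exact X_pow_smul_anti (by omega) _ (mem_X_pow_smul.2 ⟨_, h2, rfl⟩)

end SlopeRelation

end Regularity

end ConnOp

/-! ### The Bernstein polynomial of a cyclic saturated module. -/

namespace ConnOp

section Bernstein

variable {V : Type} [AddCommGroup V] [Module ℂ V] [Module ℂ⟦X⟧ V] [IsScalarTower ℂ ℂ⟦X⟧ V]
  [Module.IsTorsionFree ℂ⟦X⟧ V] {c : ConnOp dPow V} {S : Module.End ℂ V} {e : V}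

/-- Multiplication by b^s embeds N' in N, so the two ranks bound each other. -/
theorem finrank_eq_of_X_pow_smul_le {N N' : Submodule ℂ⟦X⟧ V} (h : N ≤ N') (hfg : N'.FG) {s : ℕ}
    (hs : (PowerSeries.X : ℂ⟦X⟧) ^ s • N' ≤ N) :
    Module.finrank ℂ⟦X⟧ N = Module.finrank ℂ⟦X⟧ N' := by
  have : Module.Finite ℂ⟦X⟧ N' := Module.Finite.iff_fg.2 hfg
  have hfgN : N.FG := by
    have := isNoetherian_submodule.1 (isNoetherian_of_fg_of_noetherian N' hfg) N h
    exact this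
  have : Module.Finite ℂ⟦X⟧ N := Module.Finite.iff_fg.2 hfgN
  refine le_antisymm
    (LinearMap.finrank_le_finrank_of_injective (Submodule.inclusion_injective h)) ?_
  let φ : N' →ₗ[ℂ⟦X⟧] N := LinearMap.codRestrict N
    (LinearMap.lsmul ℂ⟦X⟧ V (PowerSeries.X ^ s) ∘ₗ N'.subtype)
    fun z => hs (mem_X_pow_smul.2 ⟨z, z.2, rfl⟩)
  refine LinearMap.finrank_le_finrank_of_injective (f := φ) fun u v huv => Subtype.ext ?_
  exact X_pow_smul_cancel (congrArg Subtype.val huv)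

theorem aeval_mem_cyc (hS : ∀ v, (PowerSeries.X : ℂ⟦X⟧) • S v = -c.op v) (q : Polynomial ℂ) {v : V}
    (hv : v ∈ cyc S e) : Polynomial.aeval S q v ∈ cyc S e := by
  have key : ∀ i : ℕ, (S ^ i) v ∈ cyc S e := by
    intro i
    induction i with
    | zero => simpa using hv
    | succ i ih => rw [pow_succ']; exact apply_mem_cyc hS ih
  rw [Polynomial.aeval_eq_sum_range, LinearMap.sum_apply]
  exact Submodule.sum_mem _ fun i _ => complex_smul_mem _ (key i)

/-- The operator S descends to the quotient by b because S(b z) = b (S z - z). -/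
theorem aeval_mem_X_smul_cyc (hS : ∀ v, (PowerSeries.X : ℂ⟦X⟧) • S v = -c.op v) (q : Polynomial ℂ)
    {v : V} (hv : v ∈ (PowerSeries.X : ℂ⟦X⟧) ^ 1 • cyc S e) :
    Polynomial.aeval S q v ∈ (PowerSeries.X : ℂ⟦X⟧) ^ 1 • cyc S e := by
  have key : ∀ i : ℕ, (S ^ i) v ∈ (PowerSeries.X : ℂ⟦X⟧) ^ 1 • cyc S e := by
    intro i
    induction i with
    | zero => simpa using hv
    | succ i ih =>
      rw [pow_succ' S, Module.End.mul_apply]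
      obtain ⟨z, hz, hz'⟩ := mem_X_pow_smul.1 ih
      rw [hz', pow_one (PowerSeries.X : ℂ⟦X⟧), neg_div_leibniz hS, PowerSeries.derivative_X, mul_one, ← smul_sub]
      rw [← pow_one (PowerSeries.X : ℂ⟦X⟧)]
      exact mem_X_pow_smul.2 ⟨_, Submodule.sub_mem _ (apply_mem_cyc hS hz) hz, by rw [pow_one]⟩
  rw [Polynomial.aeval_eq_sum_range, LinearMap.sum_apply]
  exact Submodule.sum_mem _ fun i _ => complex_smul_mem _ (key i)

/-- Modulo b, power series coefficients reduce to their constant terms. Hence the quotient is a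
cyclic ℂ[T]-module generated by e. -/
theorem exists_sub_aeval_mem {z : V} (hz : z ∈ cyc S e) : ∃ q : Polynomial ℂ,
    z - Polynomial.aeval S q e ∈ (PowerSeries.X : ℂ⟦X⟧) ^ 1 • cyc S e := by
  induction hz using Submodule.span_induction with
  | mem x hx =>
    obtain ⟨i, rfl⟩ := hx
    refine ⟨Polynomial.X ^ i, ?_⟩
    rw [map_pow, Polynomial.aeval_X, sub_self]
    exact Submodule.zero_mem _
  | zero => exact ⟨0, by rw [map_zero, LinearMap.zero_apply, sub_zero]; exact Submodule.zero_mem _⟩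
  | add x y _ _ hx hy =>
    obtain ⟨q, hq⟩ := hx
    obtain ⟨q', hq'⟩ := hy
    refine ⟨q + q', ?_⟩
    rw [map_add, LinearMap.add_apply, add_sub_add_comm]
    exact Submodule.add_mem _ hq hq'
  | smul r x hx' hx =>
    obtain ⟨q, hq⟩ := hx
    refine ⟨PowerSeries.constantCoeff r • q, ?_⟩
    obtain ⟨t, ht⟩ : (PowerSeries.X : ℂ⟦X⟧) ∣ r - PowerSeries.C (PowerSeries.constantCoeff r) :=
      PowerSeries.X_dvd_iff.2 (by simp)
    have e1 : ∀ v : V, PowerSeries.constantCoeff r • v =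
        PowerSeries.C (PowerSeries.constantCoeff r) • v := fun v =>
      (algebraMap_smul ℂ⟦X⟧ (PowerSeries.constantCoeff r) v).symm
    have e2 : r • x - Polynomial.aeval S (PowerSeries.constantCoeff r • q) e =
        (PowerSeries.X : ℂ⟦X⟧) ^ 1 • t • x +
          PowerSeries.C (PowerSeries.constantCoeff r) • (x - Polynomial.aeval S q e) := by
      rw [map_smul, LinearMap.smul_apply, e1, smul_smul, pow_one, ← ht, sub_smul, smul_sub]
      abel
    rw [e2]
    exact Submodule.add_mem _ (mem_X_pow_smul.2 ⟨_, Submodule.smul_mem _ _ hx', rfl⟩)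
      (Submodule.smul_mem _ _ hq)

/-- The polynomials `q` with `q(-b⁻¹ a) e ∈ b G`, where `G` is generated by the `(-b⁻¹ a)ⁱ e`. -/
def annIdeal (hS : ∀ v, (PowerSeries.X : ℂ⟦X⟧) • S v = -c.op v) (e : V) : Ideal (Polynomial ℂ) where
  carrier := {q | Polynomial.aeval S q e ∈ (PowerSeries.X : ℂ⟦X⟧) ^ 1 • cyc S e}
  zero_mem' := by
    simp only [Set.mem_ofPred_eq, map_zero, LinearMap.zero_apply]
    exact Submodule.zero_mem _
  add_mem' := by
    intro q q' hq hq'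
    simp only [Set.mem_ofPred_eq, map_add, LinearMap.add_apply]
    exact Submodule.add_mem _ hq hq'
  smul_mem' := by
    intro r q hq
    simp only [Set.mem_ofPred_eq, smul_eq_mul, map_mul, Module.End.mul_apply]
    exact aeval_mem_X_smul_cyc hS r hq

theorem mem_annIdeal {hS : ∀ v, (PowerSeries.X : ℂ⟦X⟧) • S v = -c.op v} {q : Polynomial ℂ} :
    q ∈ annIdeal hS e ↔ Polynomial.aeval S q e ∈ (PowerSeries.X : ℂ⟦X⟧) ^ 1 • cyc S e := Iff.rfl

/-- Evaluation at e identifies ℂ[T]/I with the quotient by b, and the complex dimension of the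
latter is the rank of the free ℂ[[b]]-module. -/
theorem finrank_quotient_annIdeal (hS : ∀ v, (PowerSeries.X : ℂ⟦X⟧) • S v = -c.op v)
    (hfg : (cyc S e).FG) :
    Module.finrank ℂ (Polynomial ℂ ⧸ annIdeal hS e) = Module.finrank ℂ⟦X⟧ (cyc S e) := by
  have : Module.Finite ℂ⟦X⟧ (cyc S e) := Module.Finite.iff_fg.2 hfg
  set b := Module.finBasis ℂ⟦X⟧ (cyc S e)
  have hmem : ∀ q : Polynomial ℂ, Polynomial.aeval S q e ∈ cyc S e := fun q =>
    aeval_mem_cyc hS q (by simpa using pow_mem_cyc (S := S) 0 e)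
  -- Being a multiple of b is read off the constant terms of the coordinates in a basis.
  have hX : ∀ z : cyc S e, (∀ i, PowerSeries.constantCoeff (b.equivFun z i) = 0) ↔
      (z : V) ∈ (PowerSeries.X : ℂ⟦X⟧) ^ 1 • cyc S e := by
    intro z
    constructor
    · intro h
      choose t ht using fun i => PowerSeries.X_dvd_iff.2 (h i)
      refine mem_X_pow_smul.2 ⟨(b.equivFun.symm t : cyc S e), Subtype.coe_prop _, ?_⟩
      rw [← Submodule.coe_smul, ← map_smul]
      congr 1
      rw [LinearEquiv.eq_symm_apply]
      ext1 i
      rw [ht i, pow_one, Pi.smul_apply, smul_eq_mul]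
    · intro h i
      obtain ⟨w, hw, hzw⟩ := mem_X_pow_smul.1 h
      have : z = (PowerSeries.X : ℂ⟦X⟧) ^ 1 • (⟨w, hw⟩ : cyc S e) := Subtype.ext hzw
      rw [this, map_smul, Pi.smul_apply, smul_eq_mul, pow_one]
      simp
  let ψ : Polynomial ℂ →ₗ[ℂ] (Fin (Module.finrank ℂ⟦X⟧ (cyc S e)) → ℂ) :=
    { toFun := fun q i => PowerSeries.constantCoeff (b.equivFun ⟨_, hmem q⟩ i)
      map_add' := by
        intro q q'
        ext1 i
        have : (⟨_, hmem (q + q')⟩ : cyc S e) = ⟨_, hmem q⟩ + ⟨_, hmem q'⟩ :=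
          Subtype.ext (by simp)
        rw [this, map_add, Pi.add_apply, map_add, Pi.add_apply]
      map_smul' := by
        intro r q
        ext1 i
        have : (⟨_, hmem (r • q)⟩ : cyc S e) = (PowerSeries.C r) • ⟨_, hmem q⟩ :=
          Subtype.ext (show Polynomial.aeval S (r • q) e = PowerSeries.C r • _ by
            rw [map_smul, LinearMap.smul_apply]
            exact (algebraMap_smul ℂ⟦X⟧ r _).symm)
        rw [this, map_smul, Pi.smul_apply, smul_eq_mul, map_mul, PowerSeries.constantCoeff_C,
          RingHom.id_apply, Pi.smul_apply, smul_eq_mul] }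
  have hker : LinearMap.ker ψ = (annIdeal hS e).restrictScalars ℂ := by
    ext q
    rw [LinearMap.mem_ker, Submodule.restrictScalars_mem, mem_annIdeal,
      ← hX ⟨_, hmem q⟩, funext_iff]
    rfl
  have hsurj : Function.Surjective ψ := by
    intro y
    set z := b.equivFun.symm fun i => PowerSeries.C (y i) with hz
    obtain ⟨q, hq⟩ := exists_sub_aeval_mem z.2
    refine ⟨q, ?_⟩
    ext1 i
    have h := (hX (z - ⟨_, hmem q⟩)).2 hq i
    rw [map_sub, Pi.sub_apply, map_sub, hz, LinearEquiv.apply_symm_apply,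
      PowerSeries.constantCoeff_C, sub_eq_zero] at h
    exact h.symm
  have e1 := (Submodule.Quotient.restrictScalarsEquiv ℂ (annIdeal hS e)).symm.finrank_eq
  have e2 := (Submodule.quotEquivOfEq _ _ hker.symm).finrank_eq
  have e3 := (LinearMap.quotKerEquivOfSurjective ψ hsurj).finrank_eq
  rw [Module.finrank_fin_fun] at e3
  exact e1.trans (e2.trans e3)

/-- The Bernstein polynomial of a regular module generated by `e` under `ℂ[[b]]` and `b⁻¹ a`. -/
theorem exists_bernstein (hS : ∀ v, (PowerSeries.X : ℂ⟦X⟧) • S v = -c.op v) (hfg : (cyc S e).FG)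
    {p : Polynomial ℂ} (hp : p.Monic)
    (hpe : Polynomial.aeval S p e ∈ (PowerSeries.X : ℂ⟦X⟧) ^ 1 • cyc S e) :
    ∃ B : Polynomial ℂ, B.Monic ∧ B.natDegree = Module.finrank ℂ⟦X⟧ (cyc S e) ∧
      (∀ x ∈ cyc S e, Polynomial.aeval S B x ∈ (PowerSeries.X : ℂ⟦X⟧) ^ 1 • cyc S e) ∧
      ∀ q : Polynomial ℂ, Polynomial.aeval S q e ∈ (PowerSeries.X : ℂ⟦X⟧) ^ 1 • cyc S e →
        B ∣ q := by
  set I := annIdeal hS e with hI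
  set g := Submodule.IsPrincipal.generator I
  have hspan : Ideal.span {normalize g} = I := by
    rw [Ideal.span_singleton_eq_span_singleton.2 (normalize_associated g)]
    exact Ideal.span_singleton_generator I
  have hmem : ∀ q, q ∈ I ↔ normalize g ∣ q := fun q => by
    rw [← Ideal.mem_span_singleton, hspan]
  have hg : g ≠ 0 := by
    intro h0
    have h := (hmem p).1 (mem_annIdeal.2 hpe)
    rw [h0, normalize_zero, zero_dvd_iff] at h
    exact hp.ne_zero h
  have hBe : Polynomial.aeval S (normalize g) e ∈ (PowerSeries.X : ℂ⟦X⟧) ^ 1 • cyc S e :=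
    mem_annIdeal.1 ((hmem _).2 dvd_rfl)
  refine ⟨normalize g, Polynomial.monic_normalize hg, ?_, fun x hx => ?_, fun q hq => (hmem q).1 hq⟩
  · rw [← finrank_quotient_annIdeal hS hfg, ← hI, ← hspan]
    exact finrank_quotient_span_eq_natDegree.symm
  -- It suffices to kill q(S) e, and B(S) commutes with q(S).
  · obtain ⟨q, hq⟩ := exists_sub_aeval_mem hx
    have h1 := aeval_mem_X_smul_cyc hS (normalize g) hq
    have h2 := aeval_mem_X_smul_cyc hS q hBe
    rw [map_sub, ← Module.End.mul_apply, ← map_mul] at h1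
    rw [← Module.End.mul_apply, ← map_mul, mul_comm] at h2
    have h3 := Submodule.add_mem _ h1 h2
    rwa [sub_add_cancel] at h3

end Bernstein

/-! ### Transfer between M and M[b⁻¹]. -/

section Localization

variable {M : Type} [AddCommGroup M] [Module ℂ M] [Module ℂ⟦X⟧ M] [IsScalarTower ℂ ℂ⟦X⟧ M]
  (c : ConnOp dPow M)

/-- The operator `a` on `M[b⁻¹]`, over `ℂ[[b]]`. -/
def laur : ConnOp dPow (Laur ⊗[ℂ⟦X⟧] M) where
  op := (c.baseChange dLaur_coe).op
  leibniz r v := by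
    rw [← algebraMap_smul Laur r v, (c.baseChange dLaur_coe).leibniz, dLaur_coe, algebraMap_smul,
      algebraMap_smul]

theorem laur_op_tmul (x : M) : c.laur.op ((1 : Laur) ⊗ₜ[ℂ⟦X⟧] x) = 1 ⊗ₜ c.op x := by
  change (1 : Laur) ⊗ₜ[ℂ⟦X⟧] c.op x + dLaur 1 ⊗ₜ[ℂ⟦X⟧] x = _
  rw [Derivation.map_one_eq_zero, TensorProduct.zero_tmul, add_zero]

theorem algebraMap_X_ne_zero : algebraMap ℂ⟦X⟧ Laur PowerSeries.X ≠ 0 :=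
  algebraMap_laur_ne_zero PowerSeries.X_ne_zero

theorem X_smul_neg_theta (v : Laur ⊗[ℂ⟦X⟧] M) :
    (PowerSeries.X : ℂ⟦X⟧) • (-c.theta) v = -c.laur.op v := by
  rw [LinearMap.neg_apply, smul_neg, ← algebraMap_smul Laur (PowerSeries.X : ℂ⟦X⟧)]
  change -((algebraMap ℂ⟦X⟧ Laur PowerSeries.X) • (algebraMap ℂ⟦X⟧ Laur PowerSeries.X)⁻¹ •
    c.laur.op v) = _
  rw [smul_smul, mul_inv_cancel₀ algebraMap_X_ne_zero, one_smul]

theorem tmul_injective [Module.IsTorsionFree ℂ⟦X⟧ M] :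
    Function.Injective (TensorProduct.mk ℂ⟦X⟧ Laur M 1) := by
  have : IsLocalizedModule (nonZeroDivisors ℂ⟦X⟧) (TensorProduct.mk ℂ⟦X⟧ Laur M 1) := inferInstance
  refine (injective_iff_map_eq_zero _).2 fun x hx => ?_
  obtain ⟨s, hs⟩ := (IsLocalizedModule.eq_zero_iff (nonZeroDivisors ℂ⟦X⟧) _).1 hx
  exact (smul_eq_zero.1 (show (s : ℂ⟦X⟧) • x = 0 from hs)).resolve_left
    (nonZeroDivisors.ne_zero s.2)

instance isTorsionFree_laur : Module.IsTorsionFree ℂ⟦X⟧ (Laur ⊗[ℂ⟦X⟧] M) :=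
  Module.IsTorsionFree.trans_faithfulSMul ℂ⟦X⟧ Laur _

theorem laur_action_tmul (P : ABAlg) (x : M) :
    c.laur.action P ((1 : Laur) ⊗ₜ[ℂ⟦X⟧] x) = 1 ⊗ₜ c.action P x := by
  obtain ⟨p, rfl⟩ := RingQuot.mkAlgHom_surjective ℂ ABRel P
  induction p using FreeAlgebra.induction generalizing x with
  | grade0 r =>
    rw [AlgHom.commutes, AlgHom.commutes, AlgHom.commutes]
    simp only [Module.algebraMap_end_apply]
    rw [← algebraMap_smul ℂ⟦X⟧ r x, TensorProduct.tmul_smul, algebraMap_smul]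
  | grade1 t =>
    cases t with
    | false =>
      change c.laur.action genB _ = _ ⊗ₜ c.action genB x
      rw [action_genB, action_genB, TensorProduct.tmul_smul]
    | true =>
      change c.laur.action genA _ = _ ⊗ₜ c.action genA x
      rw [action_genA, action_genA, laur_op_tmul]
  | mul p q hp hq => rw [map_mul, map_mul, map_mul, Module.End.mul_apply, hq, hp]; rfl
  | add p q hp hq =>
    rw [map_add, map_add, map_add, LinearMap.add_apply, hp, hq, ← TensorProduct.tmul_add]; rfl

/-- On M[b⁻¹] the operator b has an honest inverse u, so the formula for algebras with invertible b
applies. -/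
theorem laur_action_homogElt {q : ℕ} {B : Polynomial ℂ} (hB : B.natDegree ≤ q)
    (v : Laur ⊗[ℂ⟦X⟧] M) : c.laur.action (homogElt q B) v =
      (-PowerSeries.X : ℂ⟦X⟧) ^ q • Polynomial.aeval (-c.theta) B v := by
  let u : Module.End ℂ (Laur ⊗[ℂ⟦X⟧] M) := (LinearMap.lsmul Laur (Laur ⊗[ℂ⟦X⟧] M)
    (algebraMap ℂ⟦X⟧ Laur PowerSeries.X)⁻¹).restrictScalars ℂ
  have hu : c.laur.action genB * u = 1 := by
    ext1 v
    rw [Module.End.mul_apply, action_genB, ← algebraMap_smul Laur (PowerSeries.X : ℂ⟦X⟧)]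
    change (algebraMap ℂ⟦X⟧ Laur PowerSeries.X) • (algebraMap ℂ⟦X⟧ Laur PowerSeries.X)⁻¹ • v = _
    rw [smul_smul, mul_inv_cancel₀ algebraMap_X_ne_zero, one_smul]
    rfl
  have hθ : u * c.laur.action genA = c.theta := by
    ext1 v
    rw [Module.End.mul_apply, action_genA]
    rfl
  have hpow : ∀ (k : ℕ) (w : Laur ⊗[ℂ⟦X⟧] M), ((-c.laur.action genB) ^ k) w =
      (-PowerSeries.X : ℂ⟦X⟧) ^ k • w := by
    intro k w
    induction k with
    | zero => simp
    | succ k ih =>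
      rw [pow_succ', Module.End.mul_apply, ih, LinearMap.neg_apply, action_genB, pow_succ', mul_smul,
        neg_smul]
  rw [map_homogElt _ u hu q B hB, hθ, Module.End.mul_apply, hpow]

theorem laur_krylov_tmul (x : M) : c.laur.krylov ((1 : Laur) ⊗ₜ[ℂ⟦X⟧] x) =
    (c.krylov x).map (TensorProduct.mk ℂ⟦X⟧ Laur M 1) := by
  rw [krylov, krylov, Submodule.map_span, ← Set.range_comp]
  congr 2
  ext1 i
  simp only [Function.comp_apply, TensorProduct.mk_apply]
  induction i with
  | zero => simp
  | succ i ih => rw [pow_succ', Module.End.mul_apply, ih, laur_op_tmul, pow_succ']; rfl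

/-- A priori the saturation applies powers of b⁻¹a to the whole Krylov module. The hypothesis places
that module inside an S-stable one, and the signs (-1)^k do not affect spans. -/
theorem saturation_krylov_eq_cyc {x : M}
    (h : c.laur.krylov ((1 : Laur) ⊗ₜ[ℂ⟦X⟧] x) ≤ cyc (-c.theta) ((1 : Laur) ⊗ₜ[ℂ⟦X⟧] x)) :
    c.saturation (c.krylov x) = cyc (-c.theta) ((1 : Laur) ⊗ₜ[ℂ⟦X⟧] x) := by
  have hpow : ∀ (k : ℕ) (w : Laur ⊗[ℂ⟦X⟧] M),
      ((-c.theta) ^ k) w = ((-1 : ℂ) ^ k) • (c.theta ^ k) w := by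
    intro k w
    rw [← neg_one_smul ℂ c.theta, smul_pow, LinearMap.smul_apply]
  refine le_antisymm (Submodule.span_le.2 ?_) (Submodule.span_le.2 ?_)
  · rintro _ ⟨k, y, hy, rfl⟩
    have hy' : (1 : Laur) ⊗ₜ[ℂ⟦X⟧] y ∈ cyc (-c.theta) ((1 : Laur) ⊗ₜ[ℂ⟦X⟧] x) := by
      refine h ?_
      rw [laur_krylov_tmul]
      exact ⟨y, hy, rfl⟩
    have h1 := complex_smul_mem ((-1 : ℂ) ^ k)
      (aeval_mem_cyc (c.X_smul_neg_theta) (Polynomial.X ^ k) hy')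
    rwa [map_pow, Polynomial.aeval_X, hpow, smul_smul, ← mul_pow, neg_one_mul, neg_neg, one_pow,
      one_smul] at h1
  · rintro _ ⟨k, rfl⟩
    simp only [SetLike.mem_coe]
    rw [hpow]
    exact complex_smul_mem _ (Submodule.subset_span ⟨k, x, mem_krylov x, rfl⟩)

end Localization

/-! ### Structure of a cyclic module with a relation P' e = κ P e. -/

section Main

variable {M : Type} [AddCommGroup M] [Module ℂ M] [Module ℂ⟦X⟧ M] [IsScalarTower ℂ ℂ⟦X⟧ M]
  [Module.IsTorsionFree ℂ⟦X⟧ M] {c : ConnOp dPow M} {p p' : Polynomial ℂ} {κ : ℂ} {e : M}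

theorem krylov_regular_bernstein (hp : p.Monic) (hp' : p'.Monic)
    (hd : p.natDegree < p'.natDegree) (hκ : κ ≠ 0)
    (h : c.action (homogElt p'.natDegree p') e = κ • c.action (homogElt p.natDegree p) e)
    (hnil : ∃ k : ℕ, ∀ x ∈ c.krylov e, ∃ z ∈ c.krylov e,
      (c.op ^ k) x = (PowerSeries.X : ℂ⟦X⟧) • z) :
    c.IsRegular (c.krylov e) ∧ ∃ Q : ABAlg, c.IsBernsteinElement (c.krylov e) Q ∧
      ∃ Z : ABAlg, homogElt p.natDegree p = Z * Q := by
  set v : Laur ⊗[ℂ⟦X⟧] M := (1 : Laur) ⊗ₜ[ℂ⟦X⟧] e with hv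
  have hS := c.X_smul_neg_theta
  have hrel : (-PowerSeries.X : ℂ⟦X⟧) ^ (p'.natDegree - p.natDegree) •
      Polynomial.aeval (-c.theta) p' v = κ • Polynomial.aeval (-c.theta) p v := by
    have h1 := congrArg (fun y => (1 : Laur) ⊗ₜ[ℂ⟦X⟧] y) h
    rw [← algebraMap_smul ℂ⟦X⟧ κ (c.action _ e), TensorProduct.tmul_smul, algebraMap_smul,
      ← laur_action_tmul, ← laur_action_tmul, laur_action_homogElt c le_rfl,
      laur_action_homogElt c le_rfl, ← Nat.add_sub_cancel' hd.le, pow_add, mul_smul, ← hv,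
      smul_comm κ] at h1
    have hX : (-PowerSeries.X : ℂ⟦X⟧) ^ p.natDegree ≠ 0 :=
      pow_ne_zero _ (neg_ne_zero.2 PowerSeries.X_ne_zero)
    -- The common factor (-b)^d cancels in the torsion-free module M[b⁻¹].
    exact smul_right_injective _ hX h1
  have hnil' : ∀ m : ℕ, ∃ k : ℕ, ∀ x ∈ c.laur.krylov v,
      (c.laur.op ^ k) x ∈ (PowerSeries.X : ℂ⟦X⟧) ^ m • c.laur.krylov v := by
    obtain ⟨k, hk⟩ := hnil
    have hk' : ∀ x ∈ c.krylov e, Polynomial.aeval c.op (Polynomial.X ^ k : Polynomial ℂ) x ∈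
        (PowerSeries.X : ℂ⟦X⟧) ^ 1 • c.krylov e := by
      intro x hx
      rw [map_pow, Polynomial.aeval_X, mem_X_pow_smul, pow_one]
      exact hk x hx
    intro m
    -- Nilpotency modulo b, iterated m times, gives divisibility by bᵐ.
    refine ⟨k * m, ?_⟩
    rw [hv, laur_krylov_tmul]
    rintro _ ⟨x, hx, rfl⟩
    have h1 := aeval_pow_mem (stable_krylov e) hk' m hx
    rw [← pow_mul, map_pow, Polynomial.aeval_X] at h1
    obtain ⟨z, hz, hz'⟩ := mem_X_pow_smul.1 h1
    have h2 : ∀ i : ℕ, (c.laur.op ^ i) ((1 : Laur) ⊗ₜ[ℂ⟦X⟧] x) = 1 ⊗ₜ (c.op ^ i) x := by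
      intro i
      induction i with
      | zero => simp
      | succ i ih => rw [pow_succ', Module.End.mul_apply, ih, laur_op_tmul, pow_succ']; rfl
    rw [TensorProduct.mk_apply, h2, hz', TensorProduct.tmul_smul]
    exact mem_X_pow_smul.2 ⟨_, ⟨z, hz, rfl⟩, rfl⟩
  obtain ⟨hfg, hle, hge, hpe⟩ := regularity hS hp hp' hd hκ hrel hnil'
  have hsat : c.saturation (c.krylov e) = cyc (-c.theta) v := saturation_krylov_eq_cyc c hle
  obtain ⟨B, hBm, hBd, hBk, hBmin⟩ := exists_bernstein hS hfg hp hpe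
  have hrank : Module.finrank ℂ⟦X⟧ (c.krylov e) = B.natDegree := by
    rw [hBd, ← finrank_eq_of_X_pow_smul_le hle hfg hge, hv, laur_krylov_tmul]
    exact (Submodule.equivMapOfInjective _ tmul_injective _).finrank_eq
  refine ⟨by rw [IsRegular, hsat]; exact hfg, homogElt (Module.finrank ℂ⟦X⟧ (c.krylov e)) B, ⟨B, ⟨hBm, ?_, ?_⟩,
    hrank.symm, rfl⟩, ?_⟩
  · rw [hsat]
    intro x hx
    obtain ⟨y, hy, hxy⟩ := mem_X_pow_smul.1 (hBk x hx)
    exact ⟨y, hy, by rw [hxy, pow_one]⟩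
  · rw [hsat]
    intro q hq
    obtain ⟨y, hy, hxy⟩ := hq v (by simpa using pow_mem_cyc (S := -c.theta) 0 v)
    exact hBmin q (mem_X_pow_smul.2 ⟨y, hy, by rw [hxy, pow_one]⟩)
  · rw [hrank]
    exact homogElt_eq_mul_of_dvd hp hBm (hBmin p hpe)

/-- The module generated by e₀ + e₁ lies in the one generated by e₀ plus W₁; intersecting with W₀
removes the second part. -/
theorem krylov_eq_of_decomposition {W₀ W₁ : Submodule ℂ⟦X⟧ M} {e₀ e₁ : M}
    (h : c.IsLocalDecomposition (c.krylov (e₀ + e₁)) W₀ W₁) (h₀ : e₀ ∈ W₀) (h₁ : e₁ ∈ W₁) :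
    W₀ = c.krylov e₀ := by
  refine le_antisymm (fun x hx => ?_) (krylov_le h.stable₀ h₀)
  have hle : c.krylov (e₀ + e₁) ≤ c.krylov e₀ ⊔ W₁ :=
    krylov_le ((stable_krylov e₀).sup h.stable₁) (Submodule.add_mem_sup (mem_krylov e₀) h₁)
  have hxW : x ∈ c.krylov (e₀ + e₁) := h.sup_eq ▸ Submodule.mem_sup_left hx
  obtain ⟨u, hu, w, hw, rfl⟩ := Submodule.mem_sup.1 (hle hxW)
  have hw0 : w ∈ W₀ ⊓ W₁ :=
    ⟨(Submodule.add_mem_iff_right W₀ (krylov_le h.stable₀ h₀ hu)).1 hx, hw⟩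
  rw [h.inf_eq, Submodule.mem_bot] at hw0
  rw [hw0, add_zero]
  exact hu

/-- The structure of the module generated by `e`, when `P' e = κ P e` for homogeneous `P, P'`, monic in
`a`, of degrees `d < d'`, and `κ ≠ 0`. -/
theorem atildeSpan_structure (hp : p.Monic) (hp' : p'.Monic)
    (hd : p.natDegree < p'.natDegree) (hκ : κ ≠ 0)
    (h : c.action (homogElt p'.natDegree p') e = κ • c.action (homogElt p.natDegree p) e) :
    c.IsABModule (c.atildeSpan e) ∧ ∃ W₀ W₁ : Submodule ℂ⟦X⟧ M,
      c.IsLocalDecomposition (c.atildeSpan e) W₀ W₁ ∧ c.IsRegular W₀ ∧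
        ∃ Q : ABAlg, c.IsBernsteinElement W₀ Q ∧ ∃ Z : ABAlg, homogElt p.natDegree p = Z * Q := by
  have hfg := krylov_fg hp hp' hd h
  rw [atildeSpan_eq_krylov hfg]
  refine ⟨(stable_krylov e).isABModule hfg, ?_⟩
  have hdec := isLocalDecomposition_nilPart (hW := stable_krylov e) hfg (Nat.sub_ne_zero_of_lt hd)
    hκ (fun x hx => aeval_krylov_mem hp hp' hd h hx)
  generalize nilPart (c.krylov e) _ _ = W₀ at hdec
  generalize nilPart (c.krylov e) _ _ = W₁ at hdec
  have he := mem_krylov (c := c) e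
  rw [← hdec.sup_eq] at he
  obtain ⟨e₀, h₀, e₁, h₁, rfl⟩ := Submodule.mem_sup.1 he
  obtain rfl := krylov_eq_of_decomposition hdec h₀ h₁
  refine ⟨_, W₁, hdec, krylov_regular_bernstein hp hp' hd hκ ?_ hdec.nilpotent₀⟩
  rw [map_add, map_add, smul_add] at h
  rw [← sub_eq_zero]
  have h2 : c.action (homogElt p'.natDegree p') e₀ - κ • c.action (homogElt p.natDegree p) e₀ =
      κ • c.action (homogElt p.natDegree p) e₁ - c.action (homogElt p'.natDegree p') e₁ := by
    rw [sub_eq_sub_iff_add_eq_add, h]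
    abel
  -- The defect of the relation at e₀ is minus that at e₁, so it lies in both summands and vanishes.
  have h3 : c.action (homogElt p'.natDegree p') e₀ - κ • c.action (homogElt p.natDegree p) e₀ ∈
      c.krylov e₀ ⊓ W₁ := by
    refine ⟨Submodule.sub_mem _ (Stable.action_mem hdec.stable₀ _ h₀)
      (complex_smul_mem _ (Stable.action_mem hdec.stable₀ _ h₀)), ?_⟩
    rw [h2]
    exact Submodule.sub_mem _ (complex_smul_mem _ (Stable.action_mem hdec.stable₁ _ h₁))
      (Stable.action_mem hdec.stable₁ _ h₁)
  rwa [hdec.inf_eq, Submodule.mem_bot] at h3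

end Main

end ConnOp

/-! ### Monomials in E_f and the relation between them. -/

section GaussManinFree

variable {n : ℕ} (f : Pol n)

/-- Every nonzero power series is a unit times a power of b, so killing the b-torsion kills all
torsion. -/
instance isTorsionFree_GMfree : Module.IsTorsionFree ℂ⟦X⟧ (GMfree f) := by
  refine Module.IsTorsionFree.of_smul_eq_zero fun r x hrx => ?_
  by_cases hr : r = 0
  · exact Or.inl hr
  right
  obtain ⟨k, u, rfl⟩ := IsDiscreteValuationRing.eq_unit_mul_pow_irreducible hr
    (PowerSeries.X_irreducible (R := ℂ))
  rw [mul_smul, ← Units.smul_def, smul_eq_zero_iff_eq] at hrx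
  obtain ⟨t, rfl⟩ := Submodule.Quotient.mk_surjective _ x
  rw [← Submodule.Quotient.mk_smul, Submodule.Quotient.mk_eq_zero] at hrx
  rw [Submodule.Quotient.mk_eq_zero]
  obtain ⟨s, hs⟩ := hrx
  refine ⟨s * ⟨PowerSeries.X ^ k, k, rfl⟩, ?_⟩
  rw [mul_smul]
  exact hs

variable {f}

theorem cls_add (P Q : Pol n) : cls f (P + Q) = cls f P + cls f Q := by
  rw [cls, map_add, map_add, TensorProduct.tmul_add]
  rfl

theorem cls_smul (r : ℂ) (P : Pol n) : cls f (r • P) = r • cls f P := by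
  rw [cls, map_smul, map_smul, TensorProduct.tmul_smul]
  rfl

theorem cls_sum {ι : Type*} (s : Finset ι) (P : ι → Pol n) :
    cls f (∑ i ∈ s, P i) = ∑ i ∈ s, cls f (P i) :=
  map_sum (AddMonoidHom.mk' (cls f) cls_add) P s

theorem cls_eq_of_sub_mem {P Q : Pol n} (h : P - Q ∈ dfdOmega f) : cls f P = cls f Q := by
  have e : (dfdOmega f).mkQ P = (dfdOmega f).mkQ Q := (Submodule.Quotient.eq _).2 h
  rw [cls, e, cls]

theorem op_cls (P : Pol n) : (connGMfree f).op (cls f P) = cls f (f * P) := by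
  change Submodule.Quotient.mk ((1 : ℂ⟦X⟧) ⊗ₜ[Polynomial ℂ] (connGM f).op _ +
    dPow 1 ⊗ₜ[Polynomial ℂ] _) = _
  rw [Derivation.map_one_eq_zero, TensorProduct.zero_tmul, add_zero]
  rfl

theorem X_smul_cls (P : Pol n) : (PowerSeries.X : ℂ⟦X⟧) • cls f P = cls f (bPol f P) := by
  have hX : (PowerSeries.X : ℂ⟦X⟧) = (Polynomial.X : Polynomial ℂ) • (1 : ℂ⟦X⟧) := by
    rw [Algebra.smul_def, mul_one]
    exact (Polynomial.coe_X).symm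
  have e : (PowerSeries.X : ℂ⟦X⟧) • ((1 : ℂ⟦X⟧) ⊗ₜ[Polynomial ℂ]
      Module.AEval'.of (bGM f) ((dfdOmega f).mkQ P)) =
      1 ⊗ₜ Module.AEval'.of (bGM f) (bGM f ((dfdOmega f).mkQ P)) := by
    rw [TensorProduct.smul_tmul', smul_eq_mul, mul_one, hX, TensorProduct.smul_tmul,
      Module.AEval'.X_smul_of]
  exact congrArg Submodule.Quotient.mk e

end GaussManinFree

section MonomialRelations

variable {n : ℕ} (α : Fin (n + 2) → (Fin (n + 1) →₀ ℕ)) (σ : Fin (n + 2) → ℂ)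

theorem op_cls_monomial (Γ : Fin (n + 1) →₀ ℕ) (s : ℂ) :
    (connGMfree (polyOf α σ)).op (cls (polyOf α σ) (MvPolynomial.monomial Γ s)) =
      ∑ j, cls (polyOf α σ) (MvPolynomial.monomial (α j + Γ) (σ j * s)) := by
  rw [op_cls, ← cls_sum]
  congr 1
  rw [polyOf, Finset.sum_mul]
  simp only [MvPolynomial.monomial_mul]

theorem pderiv_polyOf_mul (i : Fin (n + 1)) (Γ : Fin (n + 1) →₀ ℕ) (s : ℂ) :
    MvPolynomial.pderiv i (polyOf α σ) * MvPolynomial.monomial (Γ + Finsupp.single i 1) s =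
      ∑ j, (α j i : ℂ) • MvPolynomial.monomial (α j + Γ) (σ j * s) := by
  rw [polyOf, map_sum, Finset.sum_mul]
  refine Finset.sum_congr rfl fun j _ => ?_
  rw [MvPolynomial.pderiv_monomial, MvPolynomial.monomial_mul, MvPolynomial.smul_monomial]
  by_cases h : α j i = 0
  · simp [h]
  · have h1 : α j - Finsupp.single i 1 + Finsupp.single i 1 = α j :=
      tsub_add_cancel_of_le (Finsupp.single_le_iff.2 (Nat.one_le_iff_ne_zero.2 h))
    have e : α j - Finsupp.single i 1 + (Γ + Finsupp.single i 1) = α j + Γ := by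
      rw [add_comm Γ, ← add_assoc, h1]
    rw [e, smul_eq_mul]
    congr 1
    ring

/-- The left side is b applied to ∂_i(x_i x^Γ), which equals ∂_i f · x_i x^Γ because b does not
depend on the variable used for the primitive. -/
theorem X_smul_cls_monomial (i : Fin (n + 1)) (Γ : Fin (n + 1) →₀ ℕ) (s : ℂ) :
    ((Γ i : ℂ) + 1) • (PowerSeries.X : ℂ⟦X⟧) • cls (polyOf α σ) (MvPolynomial.monomial Γ s) =
      ∑ j, (α j i : ℂ) • cls (polyOf α σ) (MvPolynomial.monomial (α j + Γ) (σ j * s)) := by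
  have e1 : ((Γ i : ℂ) + 1) • (MvPolynomial.monomial Γ s : Pol n) =
      MvPolynomial.pderiv i (MvPolynomial.monomial (Γ + Finsupp.single i 1) s) := by
    rw [MvPolynomial.pderiv_monomial, add_tsub_cancel_right, MvPolynomial.smul_monomial,
      smul_eq_mul, mul_comm]
    congr 1
    simp
  simp only [← cls_smul]
  rw [smul_comm, ← cls_smul, e1, X_smul_cls, ← cls_sum, ← pderiv_polyOf_mul]
  -- For i = 0 the primitive is exact, as the monomial is divisible by x₀; this covers n = 0. For i
  -- ≠ 0 one has n ≥ 1, as independence of the variable requires.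
  by_cases hi : i = 0
  · subst hi
    congr 1
    rw [bPol, LinearMap.comp_apply, prim_pderiv, evalZero_monomial, if_neg (by simp), sub_zero]
    rfl
  · have hn : n ≠ 0 := by
      rintro rfl
      exact hi (Fin.ext (by omega))
    exact cls_eq_of_sub_mem (bPol_pderiv hn _ i)

variable {α}

theorem isUnit_Mtilde (hC : (Mtilde α).rank = n + 2) : IsUnit (Mtilde α) := by
  rw [← Matrix.linearIndependent_cols_iff_isUnit, linearIndependent_iff_card_eq_finrank_span,
    Fintype.card_fin, Set.finrank, ← Matrix.rank_eq_finrank_span_cols, hC]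

theorem inv_mul_Mtilde (hC : (Mtilde α).rank = n + 2) : (Mtilde α)⁻¹ * Mtilde α = 1 :=
  Matrix.nonsing_inv_mul _ ((Matrix.isUnit_iff_isUnit_det _).1 (isUnit_Mtilde hC))

theorem Mtilde_zero (j : Fin (n + 2)) : Mtilde α 0 j = 1 := rfl

theorem Mtilde_succ (i : Fin (n + 1)) (j : Fin (n + 2)) : Mtilde α i.succ j = (α j i : ℚ) := rfl

/-- `[m_j x^Γ] = (η_j a + θ_j b) [x^Γ]`. -/
theorem cls_monomial_mul (hC : (Mtilde α).rank = n + 2) (j : Fin (n + 2)) (Γ : Fin (n + 1) →₀ ℕ)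
    (s : ℂ) :
    cls (polyOf α σ) (MvPolynomial.monomial (α j + Γ) (σ j * s)) =
      (etaCoeff α j : ℂ) • (connGMfree (polyOf α σ)).op
          (cls (polyOf α σ) (MvPolynomial.monomial Γ s)) +
        ((∑ i : Fin (n + 1), (Mtilde α)⁻¹ j i.succ * ((Γ i + 1 : ℕ) : ℚ) : ℚ) : ℂ) •
          (PowerSeries.X : ℂ⟦X⟧) • cls (polyOf α σ) (MvPolynomial.monomial Γ s) := by
  set w : Fin (n + 2) → GMfree (polyOf α σ) := fun k =>
    cls (polyOf α σ) (MvPolynomial.monomial (α k + Γ) (σ k * s)) with hw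
  have key : ∑ i, (((Mtilde α)⁻¹ j i : ℚ) : ℂ) • ∑ k, ((Mtilde α i k : ℚ) : ℂ) • w k = w j := by
    simp only [Finset.smul_sum, smul_smul]
    rw [Finset.sum_comm]
    simp only [← Finset.sum_smul]
    have h : ∀ k, ∑ i, (((Mtilde α)⁻¹ j i : ℚ) : ℂ) * ((Mtilde α i k : ℚ) : ℂ) =
        if j = k then 1 else 0 := by
      intro k
      have := congrFun (congrFun (inv_mul_Mtilde hC) j) k
      rw [Matrix.mul_apply, Matrix.one_apply] at this
      have h2 := congrArg (fun q : ℚ => (q : ℂ)) this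
      push_cast at h2
      rw [h2]
      split_ifs <;> simp
    simp only [h, ite_smul, one_smul, zero_smul, Finset.sum_ite_eq, Finset.mem_univ, if_true]
  change w j = _
  rw [← key, Fin.sum_univ_succ]
  congr 1
  · simp only [Mtilde_zero, Rat.cast_one, one_smul]
    rw [op_cls_monomial]
    rfl
  · rw [Rat.cast_sum, Finset.sum_smul]
    refine Finset.sum_congr rfl fun i _ => ?_
    have h := X_smul_cls_monomial α σ i Γ s
    simp only [Mtilde_succ, Rat.cast_natCast]
    rw [← h, smul_smul]
    congr 1
    push_cast
    ring

theorem sum_map_apply (l : List (Fin (n + 2))) (i : Fin (n + 1)) :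
    (l.map α).sum i = ∑ k, α k i * l.count k := by
  induction l with
  | nil => simp
  | cons j l ih =>
    rw [List.map_cons, List.sum_cons, Finsupp.add_apply, ih]
    simp only [List.count_cons, mul_add, Finset.sum_add_distrib, beq_iff_eq, mul_ite, mul_one,
      mul_zero, Finset.sum_ite_eq, Finset.mem_univ, if_true]
    rw [add_comm]

theorem action_linear {M : Type} [AddCommGroup M] [Module ℂ M] [Module ℂ⟦X⟧ M]
    [IsScalarTower ℂ ℂ⟦X⟧ M] (c : ConnOp dPow M) (r t : ℂ) (x : M) :
    c.action (r • genA + t • genB) x = r • c.op x + t • (PowerSeries.X : ℂ⟦X⟧) • x := by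
  rw [map_add, map_smul, map_smul, LinearMap.add_apply, LinearMap.smul_apply, LinearMap.smul_apply,
    ConnOp.action_genA, ConnOp.action_genB]

/-- `χ(m^γ) [μ] = [m^γ μ]`. -/
theorem action_chi (hC : (Mtilde α).rank = n + 2) (β : Fin (n + 1) →₀ ℕ)
    (l : List (Fin (n + 2))) :
    (connGMfree (polyOf α σ)).action (chi α β l) (cls (polyOf α σ) (MvPolynomial.monomial β 1)) =
      cls (polyOf α σ) (MvPolynomial.monomial ((l.map α).sum + β) (l.map σ).prod) := by
  induction l with
  | nil => simp [chi]
  | cons j l ih =>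
    have hθ : thetaCoeff α β (fun k => l.count k) j = ∑ i : Fin (n + 1),
        (Mtilde α)⁻¹ j i.succ * ((((l.map α).sum + β) i + 1 : ℕ) : ℚ) :=
      Finset.sum_congr rfl fun i _ => by
        rw [Finsupp.add_apply, sum_map_apply, add_comm (∑ k, _) (β i)]
    rw [chi, map_mul, Module.End.mul_apply, ih, action_linear, List.map_cons, List.map_cons,
      List.sum_cons, List.prod_cons, add_assoc, cls_monomial_mul σ hC, hθ]

/-- The vector k satisfies M̃ k = (∑ k_j, 0, …, 0); invert M̃. It follows that η_j ≠ 0 for every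
factor m_j of m^δ or m^Δ, so these products can be made monic. -/
theorem etaCoeff_mul_sum (hC : (Mtilde α).rank = n + 2) {k : Fin (n + 2) → ℤ}
    (hk : ∀ i, ∑ j, k j * (α j i : ℤ) = 0) (j : Fin (n + 2)) :
    etaCoeff α j * ((∑ j, k j : ℤ) : ℚ) = k j := by
  have h : Matrix.mulVec (Mtilde α) (fun j => (k j : ℚ)) =
      Pi.single 0 ((∑ j, k j : ℤ) : ℚ) := by
    ext i
    refine Fin.cases ?_ (fun i => ?_) i
    · simp [Matrix.mulVec, dotProduct, Mtilde_zero]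
    · rw [Pi.single_eq_of_ne (Fin.succ_ne_zero i)]
      have h1 := congrArg (fun z : ℤ => (z : ℚ)) (hk i)
      push_cast at h1
      rw [← h1]
      simp only [Matrix.mulVec, dotProduct, Mtilde_succ]
      exact Finset.sum_congr rfl fun j _ => mul_comm _ _
  have h2 := congrArg (Matrix.mulVec (Mtilde α)⁻¹) h
  rw [Matrix.mulVec_mulVec, inv_mul_Mtilde hC, Matrix.one_mulVec, Matrix.mulVec_single] at h2
  have h3 := congrFun h2 j
  rw [h3]
  simp [etaCoeff, Matrix.col]

theorem length_eq_sum_count (l : List (Fin (n + 2))) : l.length = ∑ j, l.count j := by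
  have h := (Finset.sum_list_map_count l fun _ => (1 : ℕ))
  have h2 : (l.map fun _ => 1).sum = l.length := by simp
  rw [← h2, h]
  simp only [smul_eq_mul, mul_one]
  refine Finset.sum_subset (Finset.subset_univ _) fun j _ hj => ?_
  rw [List.count_eq_zero]
  simpa using hj

theorem exists_list_count (g : Fin (n + 2) → ℕ) : ∃ l : List (Fin (n + 2)), ∀ j, l.count j = g j := by
  refine ⟨(∑ j, Multiset.replicate (g j) j).toList, fun j => ?_⟩
  rw [← Multiset.coe_count, Multiset.coe_toList, Multiset.count_sum']
  simp [Multiset.count_replicate]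

end MonomialRelations

end BarletAB

end

/-! ### The relation for f and the conclusion. -/

theorem mainTheorem7 (n : ℕ) (α : Fin (n + 2) → (Fin (n + 1) →₀ ℕ)) (σ : Fin (n + 2) → ℂ)
    (hσ : ∀ j, σ j ≠ 0) (hC : (BarletAB.Mtilde α).rank = n + 2)
    (k : Fin (n + 2) → ℤ) (hk : ∀ i, ∑ j, k j * (α j i : ℤ) = 0) (hk_pos : 0 < ∑ j, k j)
    (hk_gcd : Finset.univ.gcd k = 1)
    (β : Fin (n + 1) →₀ ℕ)
    (l : List (Fin (n + 2))) (hl : ∀ j, l.count j = (-k j).toNat)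
    (f : BarletAB.Pol n) (hf : f = BarletAB.polyOf α σ)
    (W : Submodule (PowerSeries ℂ) (BarletAB.GMfree f))
    (hW : W = BarletAB.cyclicModule f (MvPolynomial.monomial β 1)) :
    (BarletAB.connGMfree f).IsABModule W ∧
      ∃ W₀ W₁ : Submodule (PowerSeries ℂ) (BarletAB.GMfree f),
        (BarletAB.connGMfree f).IsLocalDecomposition W W₀ W₁ ∧
        (BarletAB.connGMfree f).IsRegular W₀ ∧
        ∃ Q : BarletAB.ABAlg, (BarletAB.connGMfree f).IsBernsteinElement W₀ Q ∧
          ∃ Z : BarletAB.ABAlg, BarletAB.monicChi α β l = Z * Q := by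
  subst hf hW
  -- The list l' enumerates the factors of m^Δ, as l does for m^δ.
  obtain ⟨l', hl'⟩ := BarletAB.exists_list_count fun j => (k j).toNat
  have hη : ∀ j, k j ≠ 0 → BarletAB.etaCoeff α j ≠ 0 := by
    intro j hj h
    have h1 := BarletAB.etaCoeff_mul_sum hC hk j
    rw [h, zero_mul] at h1
    exact hj (by exact_mod_cast h1.symm)
  have hηl : ∀ j ∈ l, BarletAB.etaCoeff α j ≠ 0 := fun j hj => hη j (by
    have h1 := List.count_pos_iff.2 hj
    have h2 := hl j
    omega)
  have hηl' : ∀ j ∈ l', BarletAB.etaCoeff α j ≠ 0 := fun j hj => hη j (by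
    have h1 := List.count_pos_iff.2 hj
    have h2 := hl' j
    omega)
  -- The degrees differ by ∑ (Δ_j - δ_j) = ∑ k_j > 0.
  have hlen : l.length < l'.length := by
    have h1 : ((l'.length : ℤ) - l.length) = ∑ j, k j := by
      rw [BarletAB.length_eq_sum_count, BarletAB.length_eq_sum_count, Nat.cast_sum, Nat.cast_sum,
        ← Finset.sum_sub_distrib]
      refine Finset.sum_congr rfl fun j _ => ?_
      rw [hl, hl']
      omega
    omega
  have hsum : (l'.map α).sum = (l.map α).sum := by
    ext i
    rw [BarletAB.sum_map_apply, BarletAB.sum_map_apply]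
    have h1 : ∑ j, (α j i : ℤ) * (l'.count j : ℤ) - ∑ j, (α j i : ℤ) * (l.count j : ℤ) = 0 := by
      rw [← Finset.sum_sub_distrib, ← hk i]
      refine Finset.sum_congr rfl fun j _ => ?_
      rw [hl, hl', ← mul_sub, mul_comm]
      congr 1
      omega
    exact_mod_cast sub_eq_zero.1 h1
  have hprod : ∀ L : List (Fin (n + 2)), (L.map σ).prod ≠ 0 := fun L =>
    List.prod_ne_zero (by simp [hσ])
  have hηprod : ∀ L : List (Fin (n + 2)), (∀ j ∈ L, BarletAB.etaCoeff α j ≠ 0) →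
      (((L.map (BarletAB.etaCoeff α)).prod : ℚ) : ℂ) ≠ 0 := fun L hL => by
    refine Rat.cast_ne_zero.2 (List.prod_ne_zero fun h => ?_)
    obtain ⟨j, hj, h0⟩ := List.mem_map.1 h
    exact hL j hj h0
  obtain ⟨p, hp, hpd, hpχ⟩ := BarletAB.exists_chi_eq_homogElt α β l hηl
  obtain ⟨p', hp', hpd', hpχ'⟩ := BarletAB.exists_chi_eq_homogElt α β l' hηl'
  have hE := hηprod l hηl
  have hE' := hηprod l' hηl'
  have hmonic : BarletAB.monicChi α β l = BarletAB.homogElt p.natDegree p := by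
    rw [BarletAB.monicChi, hpχ, hpd, smul_smul, Rat.cast_inv, inv_mul_cancel₀ hE, one_smul]
  have h1 := BarletAB.action_chi σ hC β l
  have h2 := BarletAB.action_chi σ hC β l'
  rw [hpχ, map_smul, LinearMap.smul_apply, ← hpd] at h1
  rw [hpχ', map_smul, LinearMap.smul_apply, ← hpd', hsum] at h2
  -- The two monomials have the same exponent, so they differ by the ratio of their coefficients.
  -- After both sides are normalized to be monic, this ratio gives κ.
  have h3 : (MvPolynomial.monomial ((l.map α).sum + β) (l'.map σ).prod : BarletAB.Pol n) =
      ((l'.map σ).prod * (l.map σ).prod⁻¹) •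
        MvPolynomial.monomial ((l.map α).sum + β) (l.map σ).prod := by
    rw [MvPolynomial.smul_monomial, smul_eq_mul, inv_mul_cancel_right₀ (hprod l)]
  rw [h3, BarletAB.cls_smul, ← h1, smul_smul] at h2
  have h4 := congrArg (fun y => (((l'.map (BarletAB.etaCoeff α)).prod : ℚ) : ℂ)⁻¹ • y) h2
  simp only [smul_smul, inv_mul_cancel₀ hE', one_smul] at h4
  rw [hmonic]
  exact BarletAB.ConnOp.atildeSpan_structure hp hp' (by rw [hpd, hpd']; exact hlen)
    (mul_ne_zero (inv_ne_zero hE') (mul_ne_zero (mul_ne_zero (hprod l') (inv_ne_zero (hprod l))) hE))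
    h4
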